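/- **Setting.** Let $(\mathcal H_\tau)_{\tau\in T}$ be a family of separable complex Hilbert spaces, all continuously embedded into one of them, the center space $\mathcal H_0=\mathcal H_{\tau_0}$. Assume that for all $\tau_1,\tau_2\in T$ there is $\tau_3\in T$ such that $\mathcal H_{\tau_3}$ is continuously included in $\mathcal H_{\tau_1}$ and in $\mathcal H_{\tau_2}$, that for every $\tau_1\in T$ there is $\tau_2\in T$ such that $\mathcal H_{\tau_2}\subset\mathcal H_{\tau_1}$ with an inclusion of Hilbert–Schmidt class, and that $\Phi:=\bigcap_{\tau}\mathcal H_\tau$ is dense in each $\mathcal H_\tau$. (This includes the case where the $\mathcal H_\tau$ are complexifications of real Hilbert spaces with these properties.) Let $\mathcal H_{-\tau}$ be the dual of $\mathcal H_\tau$, regarded as a space of linear functionals on $\Phi$, and $\Phi'=\bigcup_\tau\mathcal H_{-\tau}$, with bilinear pairing $\langle\omega,\xi\rangle$. For $n\in\mathbb N_0$ let $\mathcal H_\tau^{\odot n}$ be the symmetric Hilbert tensor power, $\Phi^{\odot n}=\bigcap_\tau\mathcal H_\tau^{\odot n}$, with norms $\|\cdot\|_\tau$, and $\Phi'^{\odot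 n}=\bigcup_\tau\mathcal H_{-\tau}^{\odot n}$ its dual, with the inductive limit topology; $\|\cdot\|_{-\tau}$ denotes the norm of $\mathcal H_{-\tau}^{\odot n}$, dual to $\|\cdot\|_\tau$. **The spaces $\mathcal E^\alpha_{\min}(\Phi')$.** For $\alpha>0$, $\mathcal E^\alpha_{\min}(\Phi')$ is the space of all $f:\Phi'\to\mathbb C$ whose restriction to each $\mathcal H_{-\tau}$ is entire with $$\mathbf n_{\tau,l,\alpha}(f)=\sup_{\omega\in\mathcal H_{-\tau}}|f(\omega)|\exp(-2^{-l}\|\omega\|_{-\tau}^\alpha)<\infty\quad\text{for all }l\in\mathbb N_0,$$ with the projective limit topology given by the norms $\mathbf n_{\tau,l,\alpha}$, $\tau\in T$, $l\in\mathbb N_0$. Further, $\mathcal E^0_{\min}(\Phi')$ is the projective limit (the intersection) of the spaces $\mathcal E^a_{\min}(\Phi')$, $a>0$. **Appell sequences.** A sequence of monic polynomials on $\Phi'$ is a sequence of maps $S^{(n)}:\Phi'\to\Phi'^{\odot n}$, $n\in\mathbb N_0$, of the form $S^{(n)}(\omega)=\sum_{k=0}^nU_{n,k}\,\omega^{\otimes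 k}$ with continuous linear $U_{n,k}:\Phi'^{\odot k}\to\Phi'^{\odot n}$ and $U_{n,n}=\mathbf 1$. It is an Appell sequence if there are $\rho^{(n)}\in\Phi'^{\odot n}$ with $\rho^{(0)}=1$ such that, for $\rho(\xi)=\sum_{n\ge0}\langle\rho^{(n)},\xi^{\otimes n}\rangle$ and as formal power series in $\xi\in\Phi$, $$\sum_{n=0}^\infty\frac1{n!}\langle S^{(n)}(\omega),\xi^{\otimes n}\rangle=\frac{\exp[\langle\omega,\xi\rangle]}{\rho(\xi)},\qquad\omega\in\Phi'.$$ Let $\theta^{(n)}\in\Phi'^{\odot n}$ be given by $1/\rho(\xi)=\sum_{n\ge0}\langle\theta^{(n)},\xi^{\otimes n}\rangle$. Let $\mathcal P(\Phi')$ be the space of polynomials $p(\omega)=\sum_{k=0}^n\langle\omega^{\otimes k},\varphi^{(k)}\rangle$ with $\varphi^{(k)}\in\Phi^{\odot k}$. The Sheffer operator $\mathfrak S$ is the linear operator on $\mathcal P(\Phi')$ that maps $\langle\omega^{\otimes n},\varphi^{(n)}\rangle$ to $\langle S^{(n)}(\omega),\varphi^{(n)}\rangle$ for $\varphi^{(n)}\in\Phi^{\odot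 n}$, $n\in\mathbb N_0$. **Theorem.** Let $(S^{(n)})_{n\ge0}$ be an Appell sequence on $\Phi'$ with $\rho^{(n)}$, $\theta^{(n)}$ as above, and let $\beta\in(1,\infty)$. Assume that there exist $\tau\in T$ and a constant $C\ge1$ such that $$\|\theta^{(n)}\|_{-\tau}\le C^n(n!)^{\frac1\beta-1},\qquad\|\rho^{(n)}\|_{-\tau}\le C^n(n!)^{\frac1\beta-1},\qquad n\in\mathbb N.$$ Then, for each $\alpha\in[0,\beta]$, the Sheffer operator $\mathfrak S$ extends by continuity to a linear self-homeomorphism of $\mathcal E^\alpha_{\min}(\Phi')$; that is, $\mathcal P(\Phi')$ is a dense subspace of $\mathcal E^\alpha_{\min}(\Phi')$, and there is a linear homeomorphism of $\mathcal E^\alpha_{\min}(\Phi')$ onto itself that agrees with $\mathfrak S$ on $\mathcal P(\Phi')$. -/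

import Mathlib

open scoped ENNReal InnerProductSpace

noncomputable section

universe u v

/-- A bounded operator between Hilbert spaces is of Hilbert-Schmidt class if `∑ ‖A bᵢ‖² < ∞` for an
orthonormal (Hilbert) basis `b` of its domain. -/
def IsHilbertSchmidt {E F : Type*} [NormedAddCommGroup E] [InnerProductSpace ℂ E]
    [NormedAddCommGroup F] [InnerProductSpace ℂ F] (A : E →L[ℂ] F) : Prop :=
  ∃ (w : Set E) (b : HilbertBasis w ℂ E), Summable fun i => ‖A (b i)‖ ^ 2

/-- A symmetric multilinear form that vanishes on the diagonal is zero. -/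
lemma polarization_zero {V : Type*} [AddCommGroup V] [Module ℂ V] {n : ℕ}
    (φ : MultilinearMap ℂ (fun _ : Fin n => V) ℂ)
    (hs : ∀ (σ : Equiv.Perm (Fin n)) (w : Fin n → V), φ (fun i => w (σ i)) = φ w)
    (h0 : ∀ w : V, φ (fun _ => w) = 0) : φ = 0 := by
  ext v
  let m : (Fin n → Fin n) → (Fin n →₀ ℕ) := fun r => ∑ i, Finsupp.single (r i) 1
  let p : MvPolynomial (Fin n) ℂ :=
    ∑ r : Fin n → Fin n, MvPolynomial.monomial (m r) (φ fun i => v (r i))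
  have hp : p = 0 := by
    apply MvPolynomial.funext
    intro c
    have h1 := h0 (∑ j, c j • v j)
    rw [φ.map_sum (fun _ j => c j • v j)] at h1
    rw [map_zero, ← h1, map_sum]
    refine Finset.sum_congr rfl fun r _ => ?_
    rw [φ.map_smul_univ (fun i => c (r i)), MvPolynomial.eval_monomial, smul_eq_mul, mul_comm]
    congr 1
    simp only [m]
    rw [← Finsupp.prod_finsetSum_index (fun _ => pow_zero _) (fun _ _ _ => pow_add _ _ _)]
    simp
  have hc := congrArg (MvPolynomial.coeff (m id)) hp
  simp only [p, MvPolynomial.coeff_sum, MvPolynomial.coeff_monomial, MvPolynomial.coeff_zero] at hc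
  have hr : ∀ r : Fin n → Fin n, (if m r = m id then (φ fun i => v (r i)) else 0) =
      if m r = m id then φ v else 0 := by
    intro r
    split_ifs with h
    · have hsurj : Function.Surjective r := by
        intro j
        by_contra hj
        push Not at hj
        have := DFunLike.congr_fun h j
        simp [m, Finsupp.finsetSum_apply, Finsupp.single_apply, hj] at this
      exact hs (Equiv.ofBijective r (Finite.surjective_iff_bijective.1 hsurj)) v
    · rfl
  rw [Finset.sum_congr rfl fun r _ => hr r, ← Finset.sum_filter, Finset.sum_const, nsmul_eq_mul,
    mul_eq_zero] at hc
  rcases hc with hc | hc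
  · exfalso
    have h2 : (Finset.univ.filter fun r : Fin n → Fin n => m r = m id).card = 0 := by
      exact_mod_cast hc
    rw [Finset.card_eq_zero] at h2
    have : id ∈ (Finset.univ.filter fun r : Fin n → Fin n => m r = m id) := by simp
    rw [h2] at this
    simp at this
  · simpa using hc

/-- The data of a complex Gel'fand triple `Φ = ⋂ H_τ ⊆ H_0 ⊆ Φ' = ⋃ H_{-τ}`: a family of Hilbert
spaces `H τ`, each continuously embedded (by `emb τ`) in the center space `H center`, directed
under continuous inclusion, with Hilbert-Schmidt inclusions, and with `⋂ H_τ` dense in each `H τ`.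
An inclusion `H τ₂ ⊆ H τ₁` is a map `j` compatible with the embeddings into the center space. -/
structure GelfandTriple {T : Type u} (H : T → Type v) [∀ τ, NormedAddCommGroup (H τ)]
    [∀ τ, InnerProductSpace ℂ (H τ)] where
  center : T
  emb : ∀ τ, H τ →L[ℂ] H center
  emb_injective : ∀ τ, Function.Injective (emb τ)
  emb_center : emb center = ContinuousLinearMap.id ℂ (H center)
  directed : ∀ τ₁ τ₂, ∃ τ₃, (∃ j : H τ₃ →L[ℂ] H τ₁, emb τ₁ ∘L j = emb τ₃) ∧
    (∃ j : H τ₃ →L[ℂ] H τ₂, emb τ₂ ∘L j = emb τ₃)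
  hilbertSchmidt : ∀ τ₁, ∃ τ₂, ∃ j : H τ₂ →L[ℂ] H τ₁, emb τ₁ ∘L j = emb τ₂ ∧ IsHilbertSchmidt j
  dense : ∀ τ, Dense {x : H τ | ∀ σ, emb τ x ∈ LinearMap.range (emb σ).toLinearMap}

namespace GelfandTriple

section Defs

variable {T : Type u} {H : T → Type v} [∀ τ, NormedAddCommGroup (H τ)]
  [∀ τ, InnerProductSpace ℂ (H τ)] (G : GelfandTriple H)

/-- The nuclear space `Φ = ⋂_τ H_τ`, as a subspace of the center space. -/
def Test : Submodule ℂ (H G.center) := ⨅ τ, LinearMap.range (G.emb τ).toLinearMap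

/-- The inclusion `Φ → H_τ`. -/
def toH (τ : T) : G.Test →ₗ[ℂ] H τ :=
  (LinearEquiv.ofInjective (G.emb τ).toLinearMap (G.emb_injective τ)).symm.toLinearMap ∘ₗ
    Submodule.inclusion (iInf_le (fun τ => LinearMap.range (G.emb τ).toLinearMap) τ)

/-- The Hilbert space `H_{-τ}` is the dual of `H_τ`, with the dual norm. Its elements are
functionals on `Φ`, by restriction (injective, as `Φ` is dense in `H_τ`). -/
def restrictDual (τ : T) : StrongDual ℂ (H τ) →ₗ[ℂ] Module.Dual ℂ G.Test where
  toFun w := w.toLinearMap ∘ₗ G.toH τ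
  map_add' _ _ := rfl
  map_smul' _ _ := rfl

/-- The co-nuclear space `Φ'`: the linear functionals on `Φ` that belong to some `H_{-τ}`
(a directed supremum, hence a union). The pairing `⟨ω, ξ⟩` is `ω.1 ξ`; it is bilinear. -/
def Dual : Submodule ℂ (Module.Dual ℂ G.Test) := ⨆ τ, LinearMap.range (G.restrictDual τ)

/-- The inclusion `H_{-τ} → Φ'`. -/
def incl (τ : T) : StrongDual ℂ (H τ) →ₗ[ℂ] G.Dual :=
  (G.restrictDual τ).codRestrict G.Dual fun w =>
    (le_iSup (fun τ => LinearMap.range (G.restrictDual τ)) τ) ⟨w, rfl⟩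

lemma toH_spec (τ : T) (ξ : G.Test) : G.emb τ (G.toH τ ξ) = ξ.1 := by
  have := LinearEquiv.apply_symm_apply
    (LinearEquiv.ofInjective (G.emb τ).toLinearMap (G.emb_injective τ))
    (Submodule.inclusion (iInf_le (fun τ => LinearMap.range (G.emb τ).toLinearMap) τ) ξ)
  exact congrArg Subtype.val this

lemma exists_incl (w : G.Dual) : ∃ τ, ∃ x : StrongDual ℂ (H τ), G.incl τ x = w := by
  have : Nonempty T := ⟨G.center⟩
  have key : ∀ τ σ (j : H σ →L[ℂ] H τ), G.emb τ ∘L j = G.emb σ →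
      LinearMap.range (G.restrictDual τ) ≤ LinearMap.range (G.restrictDual σ) := by
    rintro τ σ j hj _ ⟨x, rfl⟩
    refine ⟨x ∘L j, ?_⟩
    ext ξ
    have h : j (G.toH σ ξ) = G.toH τ ξ := by
      apply G.emb_injective τ
      rw [G.toH_spec, ← G.toH_spec σ ξ, ← hj]
      rfl
    change x (j (G.toH σ ξ)) = x (G.toH τ ξ)
    rw [h]
  have hd : Directed (· ≤ ·) fun τ => LinearMap.range (G.restrictDual τ) := by
    intro a b
    obtain ⟨c, ⟨j, hj⟩, ⟨k, hk⟩⟩ := G.directed a b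
    exact ⟨c, key a c j hj, key b c k hk⟩
  obtain ⟨τ, x, hx⟩ := (Submodule.mem_iSup_of_directed _ hd).1 w.2
  exact ⟨τ, x, Subtype.ext hx⟩

/-- The weighted functions whose supremum over `H_{-τ}` is the norm `n_{τ,l,a}(f)`. -/
def growth (a : ℝ) (τ : T) (l : ℕ) (f : G.Dual → ℂ) (w : StrongDual ℂ (H τ)) : ℝ :=
  ‖f (G.incl τ w)‖ * Real.exp (-(((2 : ℝ) ^ l)⁻¹ * ‖w‖ ^ a))

/-- `n_{τ,l,a}(f) = sup_{ω ∈ H_{-τ}} |f(ω)| exp(-2^{-l} ‖ω‖_{-τ}^a)`. -/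
def growthNorm (a : ℝ) (τ : T) (l : ℕ) (f : G.Dual → ℂ) : ℝ := ⨆ w, G.growth a τ l f w

lemma growth_add_le (a : ℝ) (τ : T) (l : ℕ) (f g : G.Dual → ℂ) (w : StrongDual ℂ (H τ)) :
    G.growth a τ l (f + g) w ≤ G.growth a τ l f w + G.growth a τ l g w := by
  unfold growth
  rw [← add_mul]
  exact mul_le_mul_of_nonneg_right (norm_add_le _ _) (Real.exp_nonneg _)

lemma growth_smul (a : ℝ) (τ : T) (l : ℕ) (c : ℂ) (f : G.Dual → ℂ) (w : StrongDual ℂ (H τ)) :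
    G.growth a τ l (c • f) w = ‖c‖ * G.growth a τ l f w := by
  unfold growth
  rw [Pi.smul_apply, norm_smul, mul_assoc]

/-- For `a > 0`, the space `ℰ^a_min(Φ')` of functions on `Φ'` whose restriction to each `H_{-τ}` is
entire with `n_{τ,l,a}(f) < ∞` for all `l`. -/
def EminPos (a : ℝ) : Submodule ℂ (G.Dual → ℂ) where
  carrier := {f | ∀ τ, Differentiable ℂ (fun w : StrongDual ℂ (H τ) => f (G.incl τ w)) ∧
    ∀ l : ℕ, BddAbove (Set.range (G.growth a τ l f))}
  zero_mem' := by
    intro τ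
    refine ⟨differentiable_const (0 : ℂ), fun l => ⟨0, ?_⟩⟩
    rintro _ ⟨w, rfl⟩
    simp [growth]
  add_mem' := by
    intro f g hf hg τ
    refine ⟨(hf τ).1.add (hg τ).1, fun l => ?_⟩
    obtain ⟨A, hA⟩ := (hf τ).2 l
    obtain ⟨B, hB⟩ := (hg τ).2 l
    refine ⟨A + B, ?_⟩
    rintro _ ⟨w, rfl⟩
    exact (G.growth_add_le a τ l f g w).trans (add_le_add (hA ⟨w, rfl⟩) (hB ⟨w, rfl⟩))
  smul_mem' := by
    intro c f hf τ
    refine ⟨(hf τ).1.const_smul c, fun l => ?_⟩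
    obtain ⟨A, hA⟩ := (hf τ).2 l
    refine ⟨‖c‖ * A, ?_⟩
    rintro _ ⟨w, rfl⟩
    rw [growth_smul]
    exact mul_le_mul_of_nonneg_left (hA ⟨w, rfl⟩) (norm_nonneg c)

/-- The exponents `a > 0` that define `ℰ^α_min(Φ')`: only `a = α` if `α > 0`, and all `a > 0` if
`α = 0`. -/
def Exponent (α : ℝ) : Type := {a : ℝ // 0 < a ∧ (a = α ∨ α = 0)}

/-- The underlying vector space of `ℰ^α_min(Φ')`, `α ≥ 0`; by definition
`ℰ^0_min(Φ') = ⋂_{a > 0} ℰ^a_min(Φ')`. -/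
def eminSubmodule (α : ℝ) : Submodule ℂ (G.Dual → ℂ) := ⨅ a : Exponent α, G.EminPos a.1

/-- The space `ℰ^α_min(Φ')`, as a type of its own, since its topology is not that of pointwise
convergence. -/
def Emin (α : ℝ) : Type _ := G.eminSubmodule α

instance (α : ℝ) : AddCommGroup (G.Emin α) := inferInstanceAs (AddCommGroup (G.eminSubmodule α))

instance (α : ℝ) : Module ℂ (G.Emin α) := inferInstanceAs (Module ℂ (G.eminSubmodule α))

/-- An element of `ℰ^α_min(Φ')` as a function on `Φ'`. -/
def Emin.toFun {G : GelfandTriple H} {α : ℝ} (f : G.Emin α) : G.Dual → ℂ :=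
  Subtype.val (p := fun f => f ∈ G.eminSubmodule α) f

lemma Emin.bddAbove {G : GelfandTriple H} {α : ℝ} (f : G.Emin α) (a : Exponent α) (τ : T) (l : ℕ) :
    BddAbove (Set.range (G.growth a.1 τ l f.toFun)) :=
  ((Submodule.mem_iInf _).1 (Subtype.property (p := fun f => f ∈ G.eminSubmodule α) f) a τ).2 l

/-- The norms `n_{τ,l,a}` on `ℰ^α_min(Φ')`. -/
def eminSeminorm (α : ℝ) (i : Exponent α × T × ℕ) : Seminorm ℂ (G.Emin α) :=
  Seminorm.of (fun f => G.growthNorm i.1.1 i.2.1 i.2.2 f.toFun)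
    (fun f g => ciSup_le fun w => (G.growth_add_le _ _ _ f.toFun g.toFun w).trans
      (add_le_add (le_ciSup (f.bddAbove i.1 i.2.1 i.2.2) w)
        (le_ciSup (g.bddAbove i.1 i.2.1 i.2.2) w)))
    (fun c f => by
      change ⨆ w, G.growth _ _ _ (c • f.toFun) w = ‖c‖ * ⨆ w, _
      rw [Real.mul_iSup_of_nonneg (norm_nonneg c)]
      exact iSup_congr fun w => G.growth_smul _ _ _ c _ w)

/-- The projective limit topology on `ℰ^α_min(Φ')`, generated by the norms `n_{τ,l,a}`. -/
instance (α : ℝ) : TopologicalSpace (G.Emin α) :=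
  ⨅ i, (G.eminSeminorm α i).toSeminormedAddCommGroup.toUniformSpace.toTopologicalSpace

variable [∀ τ, CompleteSpace (H τ)]

/-- The norm of `H_τ^{⊗n}` for an `n`-linear form `φ` on `Φ'`. The Hilbert tensor power
`H_τ^{⊗n}` is realized as the space of Hilbert-Schmidt `n`-linear forms on the dual space `H_{-τ}`
(`x₁ ⊗ ⋯ ⊗ xₙ` being `(ω₁, …, ωₙ) ↦ ∏ ⟨ωᵢ, xᵢ⟩`), with the Hilbert-Schmidt norm
`(∑ |φ(e_{i₁}, …, e_{iₙ})|²)^{1/2}`, the supremum over all finite orthonormal systems `e` of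
`H_{-τ}` (that is, over the Riesz images of the finite orthonormal systems of `H_τ`). -/
def hsNorm {n : ℕ} (τ : T) (φ : MultilinearMap ℂ (fun _ : Fin n => G.Dual) ℂ) : ℝ≥0∞ :=
  (⨆ (m : ℕ) (e : Fin m → H τ) (_ : Orthonormal ℂ e),
    ∑ i : Fin n → Fin m,
      ‖φ fun k => G.incl τ (InnerProductSpace.toDual ℂ (H τ) (e (i k)))‖ₑ ^ 2) ^ (1 / 2 : ℝ)

lemma hsNorm_lt_top_iff {n : ℕ} (τ : T) (φ : MultilinearMap ℂ (fun _ : Fin n => G.Dual) ℂ) :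
    G.hsNorm τ φ < ∞ ↔ ∃ C : ℝ≥0∞, C < ∞ ∧ ∀ (m : ℕ) (e : Fin m → H τ), Orthonormal ℂ e →
      ∑ i : Fin n → Fin m,
        ‖φ fun k => G.incl τ (InnerProductSpace.toDual ℂ (H τ) (e (i k)))‖ₑ ^ 2 ≤ C := by
  unfold hsNorm
  rw [ENNReal.rpow_lt_top_iff_of_pos (by norm_num)]
  constructor
  · intro h
    exact ⟨_, h, fun m e he => le_iSup_of_le m (le_iSup_of_le e (le_iSup_of_le he le_rfl))⟩
  · rintro ⟨C, hC, h⟩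
    exact lt_of_le_of_lt (iSup_le fun m => iSup_le fun e => iSup_le fun he => h m e he) hC

/-- `Φ^{⊙n} = ⋂_τ H_τ^{⊙n}`: the symmetric `n`-linear forms on `Φ'` that are Hilbert-Schmidt on
every `H_{-τ}`. -/
def SymTest (n : ℕ) : Submodule ℂ (MultilinearMap ℂ (fun _ : Fin n => G.Dual) ℂ) where
  carrier := {φ | (∀ (σ : Equiv.Perm (Fin n)) (w : Fin n → G.Dual), φ (fun i => w (σ i)) = φ w) ∧
    ∀ τ, G.hsNorm τ φ < ∞}
  zero_mem' := by
    refine ⟨fun _ _ => rfl, fun τ => (G.hsNorm_lt_top_iff τ _).2 ⟨0, by simp, ?_⟩⟩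
    intro m e _
    simp
  add_mem' := by
    rintro a b ⟨ha, ha'⟩ ⟨hb, hb'⟩
    refine ⟨fun σ w => ?_, fun τ => (G.hsNorm_lt_top_iff τ _).2 ?_⟩
    · simp only [_root_.add_apply, ha, hb]
    obtain ⟨C, hC, h⟩ := (G.hsNorm_lt_top_iff τ _).1 (ha' τ)
    obtain ⟨D, hD, h'⟩ := (G.hsNorm_lt_top_iff τ _).1 (hb' τ)
    refine ⟨2 * (C + D), ENNReal.mul_lt_top (by simp) (ENNReal.add_lt_top.2 ⟨hC, hD⟩), ?_⟩
    intro m e he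
    refine le_trans ?_ (mul_le_mul_right (add_le_add (h m e he) (h' m e he)) 2)
    rw [← Finset.sum_add_distrib, Finset.mul_sum]
    refine Finset.sum_le_sum fun i _ => ?_
    rw [_root_.add_apply]
    refine (pow_le_pow_left' (enorm_add_le _ _) 2).trans ?_
    have := ENNReal.rpow_add_le_mul_rpow_add_rpow
      ‖a fun k => G.incl τ (InnerProductSpace.toDual ℂ (H τ) (e (i k)))‖ₑ
      ‖b fun k => G.incl τ (InnerProductSpace.toDual ℂ (H τ) (e (i k)))‖ₑ
      (p := 2) (by norm_num)
    norm_num at this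
    exact this
  smul_mem' := by
    rintro c a ⟨ha, ha'⟩
    refine ⟨fun σ w => ?_, fun τ => (G.hsNorm_lt_top_iff τ _).2 ?_⟩
    · simp only [_root_.smul_apply, ha]
    obtain ⟨C, hC, h⟩ := (G.hsNorm_lt_top_iff τ _).1 (ha' τ)
    refine ⟨‖c‖ₑ ^ 2 * C, ENNReal.mul_lt_top (ENNReal.pow_lt_top enorm_lt_top) hC, ?_⟩
    intro m e he
    refine le_trans (le_of_eq ?_) (mul_le_mul_right (h m e he) _)
    rw [Finset.mul_sum]
    refine Finset.sum_congr rfl fun i _ => ?_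
    rw [_root_.smul_apply, smul_eq_mul, enorm_mul, mul_pow]

/-- The tensor power `ξ^{⊗n} ∈ Φ^{⊙n}` of `ξ ∈ Φ`. -/
def testPow (n : ℕ) (ξ : G.Test) : G.SymTest n :=
  ⟨(MultilinearMap.mkPiAlgebra ℂ (Fin n) ℂ).compLinearMap
      (fun _ => (Module.Dual.eval ℂ G.Test ξ) ∘ₗ G.Dual.subtype), by
    refine ⟨fun σ w => ?_, fun τ => (G.hsNorm_lt_top_iff τ _).2
      ⟨ENNReal.ofReal ((‖G.toH τ ξ‖ ^ 2) ^ n), ENNReal.ofReal_lt_top, ?_⟩⟩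
    · simpa using Equiv.prod_comp σ fun i => (w i).1 ξ
    intro m e he
    have h1 : ∀ i : Fin n → Fin m,
        ‖((MultilinearMap.mkPiAlgebra ℂ (Fin n) ℂ).compLinearMap
          (fun _ => (Module.Dual.eval ℂ G.Test ξ) ∘ₗ G.Dual.subtype))
          fun k => G.incl τ (InnerProductSpace.toDual ℂ (H τ) (e (i k)))‖ₑ ^ 2
        = ENNReal.ofReal (∏ k, ‖inner ℂ (e (i k)) (G.toH τ ξ)‖ ^ 2) := by
      intro i
      rw [← ofReal_norm, ← ENNReal.ofReal_pow (norm_nonneg _), Finset.prod_pow, ← norm_prod]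
      rfl
    rw [Finset.sum_congr rfl fun i _ => h1 i, ← ENNReal.ofReal_sum_of_nonneg
      (fun i _ => Finset.prod_nonneg fun k _ => by positivity)]
    apply ENNReal.ofReal_le_ofReal
    have h2 := Fintype.sum_pow (fun k : Fin m => ‖inner ℂ (e k) (G.toH τ ξ)‖ ^ 2) n
    rw [← h2]
    exact pow_le_pow_left₀ (Finset.sum_nonneg fun _ _ => by positivity)
      (he.sum_inner_products_le _) n⟩

/-- The norm `‖Ψ‖_{-τ}` of `H_{-τ}^{⊙n}`, the dual of `H_τ^{⊙n}`. -/
def negNorm {n : ℕ} (τ : T) (Ψ : Module.Dual ℂ (G.SymTest n)) : ℝ≥0∞ :=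
  ⨆ (φ : G.SymTest n) (_ : G.hsNorm τ φ.1 ≤ 1), ‖Ψ φ‖ₑ

/-- The space `H_{-τ}^{⊙n}`, as a space of functionals on `Φ^{⊙n}`. -/
def SymNeg (n : ℕ) (τ : T) : Submodule ℂ (Module.Dual ℂ (G.SymTest n)) where
  carrier := {Ψ | G.negNorm τ Ψ < ∞}
  zero_mem' := by simp [negNorm]
  add_mem' := by
    intro a b ha hb
    refine lt_of_le_of_lt (b := G.negNorm τ a + G.negNorm τ b) ?_ (ENNReal.add_lt_top.2 ⟨ha, hb⟩)
    refine iSup₂_le fun φ hφ => (enorm_add_le _ _).trans (add_le_add ?_ ?_)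
    · exact le_iSup₂ (f := fun (φ : G.SymTest n) (_ : G.hsNorm τ φ.1 ≤ 1) => ‖a φ‖ₑ) φ hφ
    · exact le_iSup₂ (f := fun (φ : G.SymTest n) (_ : G.hsNorm τ φ.1 ≤ 1) => ‖b φ‖ₑ) φ hφ
  smul_mem' := by
    intro c a ha
    refine lt_of_le_of_lt (b := ‖c‖ₑ * G.negNorm τ a) ?_ (ENNReal.mul_lt_top enorm_lt_top ha)
    refine iSup₂_le fun φ hφ => ?_
    rw [LinearMap.smul_apply, smul_eq_mul, enorm_mul]
    exact mul_le_mul_right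
      (le_iSup₂ (f := fun (φ : G.SymTest n) (_ : G.hsNorm τ φ.1 ≤ 1) => ‖a φ‖ₑ) φ hφ) _

/-- `Φ'^{⊙n} = ⋃_τ H_{-τ}^{⊙n}` (a directed supremum, hence a union), the dual of `Φ^{⊙n}`; the
pairing `⟨Ψ, φ⟩` is `Ψ.1 φ`. -/
def SymDual (n : ℕ) : Submodule ℂ (Module.Dual ℂ (G.SymTest n)) := ⨆ τ, G.SymNeg n τ

/-- The inductive limit topology on `Φ'^{⊙n}`: the finest locally convex vector space topology for
which all the inclusions `H_{-τ}^{⊙n} → Φ'^{⊙n}` are continuous. -/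
instance (n : ℕ) : TopologicalSpace (G.SymDual n) :=
  sInf {_t : TopologicalSpace (G.SymDual n) | IsTopologicalAddGroup (G.SymDual n) ∧ ContinuousSMul ℂ (G.SymDual n) ∧
    LocallyConvexSpace ℝ (G.SymDual n) ∧
    ∀ τ, ∀ V ∈ nhds (0 : G.SymDual n), ∃ r : ℝ, 0 < r ∧
      ∀ Ψ : G.SymDual n, G.negNorm τ Ψ.1 ≤ ENNReal.ofReal r → Ψ ∈ V}

/-- The tensor power `ω^{⊗n} ∈ Φ'^{⊙n}` of `ω ∈ Φ'`, with `⟨ω^{⊗n}, φ⟩ = φ(ω, …, ω)`. -/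
def dualPow (n : ℕ) (w : G.Dual) : G.SymDual n :=
  ⟨{ toFun := fun φ => φ.1 fun _ => w
     map_add' := fun _ _ => rfl
     map_smul' := fun _ _ => rfl }, by
    obtain ⟨τ, x', rfl⟩ := G.exists_incl w
    obtain ⟨x, rfl⟩ := (InnerProductSpace.toDual ℂ (H τ)).surjective x'
    refine (le_iSup (fun τ => G.SymNeg n τ) τ) ?_
    change G.negNorm τ _ < ∞
    refine lt_of_le_of_lt (b := ENNReal.ofReal (‖x‖ ^ n)) ?_ ENNReal.ofReal_lt_top
    refine iSup₂_le fun φ hφ => ?_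
    have hφ' : ∀ (m : ℕ) (e : Fin m → H τ), Orthonormal ℂ e → ∀ i : Fin n → Fin m,
        ‖φ.1 fun k => G.incl τ (InnerProductSpace.toDual ℂ (H τ) (e (i k)))‖ₑ ≤ 1 := by
      intro m e he i
      have h0 : ‖φ.1 fun k => G.incl τ (InnerProductSpace.toDual ℂ (H τ) (e (i k)))‖ₑ ^ 2 ≤
          ⨆ (m : ℕ) (e : Fin m → H τ) (_ : Orthonormal ℂ e), ∑ i : Fin n → Fin m,
            ‖φ.1 fun k => G.incl τ (InnerProductSpace.toDual ℂ (H τ) (e (i k)))‖ₑ ^ 2 :=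
        le_trans (Finset.single_le_sum (f := fun i : Fin n → Fin m =>
            ‖φ.1 fun k => G.incl τ (InnerProductSpace.toDual ℂ (H τ) (e (i k)))‖ₑ ^ 2)
            (fun _ _ => zero_le) (Finset.mem_univ i))
          (le_iSup_of_le m (le_iSup_of_le e (le_iSup_of_le he le_rfl)))
      have h1 := ENNReal.rpow_le_rpow h0 (z := 1 / 2) (by norm_num)
      have h2 := h1.trans hφ
      rwa [← ENNReal.rpow_natCast, ← ENNReal.rpow_mul, show ((2 : ℕ) : ℝ) * (1 / 2) = 1 by norm_num,
        ENNReal.rpow_one] at h2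
    change ‖φ.1 fun _ => G.incl τ (InnerProductSpace.toDual ℂ (H τ) x)‖ₑ ≤ _
    by_cases hx : x = 0
    · subst hx
      rcases Nat.eq_zero_or_pos n with rfl | hn
      · have := hφ' 0 (fun i => i.elim0) ⟨fun i => i.elim0, fun i => i.elim0⟩ (fun i => i.elim0)
        simp only [pow_zero, ENNReal.ofReal_one]
        convert this
      · have : Nonempty (Fin n) := ⟨⟨0, hn⟩⟩
        rw [φ.1.map_coord_zero (⟨0, hn⟩ : Fin n) (by simp)]
        simp
    · have hx' : ‖x‖ ≠ 0 := norm_ne_zero_iff.2 hx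
      set y : H τ := ((‖x‖ : ℂ)⁻¹) • x with hy
      have hy1 : ‖y‖ = 1 := by
        rw [hy, norm_smul, norm_inv, Complex.norm_real, norm_norm, inv_mul_cancel₀ hx']
      have hyo : Orthonormal ℂ (fun _ : Fin 1 => y) :=
        ⟨fun _ => hy1, fun i j hij => absurd (Subsingleton.elim i j) hij⟩
      have hb := hφ' 1 _ hyo (fun _ => 0)
      have hxy : x = (‖x‖ : ℂ) • y := by
        rw [hy, smul_smul, mul_inv_cancel₀ (by exact_mod_cast hx'), one_smul]
      have he : (φ.1 fun _ => G.incl τ (InnerProductSpace.toDual ℂ (H τ) x)) =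
          (‖x‖ : ℂ) ^ n * φ.1 fun _ => G.incl τ (InnerProductSpace.toDual ℂ (H τ) y) := by
        have h3 : G.incl τ (InnerProductSpace.toDual ℂ (H τ) x) =
            (‖x‖ : ℂ) • G.incl τ (InnerProductSpace.toDual ℂ (H τ) y) := by
          conv_lhs => rw [hxy]
          rw [map_smulₛₗ, map_smul, Complex.conj_ofReal]
        rw [h3, φ.1.map_smul_univ (fun _ => (‖x‖ : ℂ))]
        simp
      rw [he, enorm_mul, enorm_pow]
      refine (mul_le_mul_right hb _).trans ?_
      rw [mul_one, ← ofReal_norm, Complex.norm_real, norm_norm, ENNReal.ofReal_pow (norm_nonneg _)]⟩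

/-- A sequence of monic polynomials on `Φ'`: `S⁽ⁿ⁾(ω) = ∑_{k ≤ n} U_{n,k} ω^{⊗k}` with continuous
linear `U_{n,k} : Φ'^{⊙k} → Φ'^{⊙n}` and `U_{n,n} = 1`. -/
def IsMonicPolynomialSequence (S : ∀ n, G.Dual → G.SymDual n) : Prop :=
  ∃ U : ∀ n k, G.SymDual k →L[ℂ] G.SymDual n,
    (∀ n, U n n = ContinuousLinearMap.id ℂ (G.SymDual n)) ∧
    ∀ n w, S n w = ∑ k ∈ Finset.range (n + 1), U n k (G.dualPow k w)

/-- The formal power series `ρ(ξ) = ∑ₙ ⟨ρ⁽ⁿ⁾, ξ^{⊗n}⟩`, as the formal series of `z ↦ ρ(zξ)`. -/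
def formalSeries (ρ : ∀ n, G.SymDual n) (ξ : G.Test) : PowerSeries ℂ :=
  PowerSeries.mk fun n => (ρ n).1 (G.testPow n ξ)

/-- `S` is the Appell sequence on `Φ'` with generating function
`∑ₙ (1/n!) ⟨S⁽ⁿ⁾(ω), ξ^{⊗n}⟩ = exp⟨ω, ξ⟩ / ρ(ξ)`, where `ρ⁽⁰⁾ = 1`. -/
def IsAppellSequence (S : ∀ n, G.Dual → G.SymDual n) (ρ : ∀ n, G.SymDual n) : Prop :=
  G.IsMonicPolynomialSequence S ∧ ρ 0 = G.dualPow 0 0 ∧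
    ∀ (w : G.Dual) (ξ : G.Test),
      PowerSeries.mk (fun n => ((n.factorial : ℂ))⁻¹ * (S n w).1 (G.testPow n ξ)) =
        PowerSeries.mk (fun n => ((n.factorial : ℂ))⁻¹ * (w.1 ξ) ^ n) * (G.formalSeries ρ ξ)⁻¹

/-- `θ⁽ⁿ⁾` are the coefficients of `1/ρ(ξ) = ∑ₙ ⟨θ⁽ⁿ⁾, ξ^{⊗n}⟩`. -/
def IsReciprocal (θ ρ : ∀ n, G.SymDual n) : Prop :=
  ∀ ξ : G.Test, G.formalSeries θ ξ = (G.formalSeries ρ ξ)⁻¹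

/-- For finitely many nonzero `φ⁽ⁿ⁾ ∈ Φ^{⊙n}`, the function `ω ↦ ∑ₙ ⟨P⁽ⁿ⁾(ω), φ⁽ⁿ⁾⟩` on `Φ'`. -/
def sumPairing (P : ∀ n, G.Dual → G.SymDual n) :
    (Π₀ n, G.SymTest n) →ₗ[ℂ] (G.Dual → ℂ) :=
  LinearMap.pi fun w => DFinsupp.lsum ℕ fun n => (P n w).1

/-- The space `𝒫(Φ')` of polynomials `p(ω) = ∑_{k ≤ n} ⟨ω^{⊗k}, φ⁽ᵏ⁾⟩` on `Φ'`. -/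
def Polynomials : Submodule ℂ (G.Dual → ℂ) := LinearMap.range (G.sumPairing G.dualPow)

open Classical in
lemma sumPairing_apply (P : ∀ n, G.Dual → G.SymDual n) (c : Π₀ n, G.SymTest n) (w : G.Dual) :
    G.sumPairing P c w = ∑ n ∈ c.support, (P n w).1 (c n) := by
  change DFinsupp.lsum ℕ (fun n => (P n w).1) c = _
  rw [DFinsupp.lsum_apply_apply, DFinsupp.sumAddHom_apply]
  rfl

/-- The coefficients `φ⁽ⁿ⁾` of a polynomial on `Φ'` are unique. -/
lemma sumPairing_dualPow_injective : Function.Injective (G.sumPairing G.dualPow) := by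
  classical
  refine (injective_iff_map_eq_zero _).2 ?_
  intro c hc
  have key : ∀ (w : G.Dual) (n : ℕ), (c n).1 (fun _ => w) = 0 := by
    intro w n
    let p : Polynomial ℂ := ∑ k ∈ c.support, Polynomial.monomial k ((c k).1 fun _ => w)
    have hp : p = 0 := by
      apply Polynomial.funext
      intro z
      have h1 := congrFun hc (z • w)
      rw [sumPairing_apply] at h1
      simp only [p, Polynomial.eval_finsetSum, Polynomial.eval_monomial,
        Polynomial.eval_zero] at h1 ⊢
      rw [Pi.zero_apply] at h1
      rw [← h1]
      refine Finset.sum_congr rfl fun k _ => ?_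
      change _ = (c k).1 fun _ => z • w
      rw [(c k).1.map_smul_univ (fun _ => z)]
      simp [mul_comm]
    have h2 := congrArg (fun q => Polynomial.coeff q n) hp
    simp only [p, Polynomial.finsetSum_coeff, Polynomial.coeff_monomial,
      Polynomial.coeff_zero, Finset.sum_ite_eq', DFinsupp.mem_support_toFun] at h2
    by_cases hn : c n = 0
    · rw [hn]; rfl
    · simpa [hn] using h2
  ext n : 1
  exact Subtype.ext (polarization_zero _ (c n).2.1 fun w => key w n)

/-- The Sheffer operator `𝔖` of a sequence `S`: the linear operator on polynomials that sends
`⟨ω^{⊗n}, φ⟩` to `⟨S⁽ⁿ⁾(ω), φ⟩`. -/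
def shefferOperator (S : ∀ n, G.Dual → G.SymDual n) : G.Polynomials →ₗ[ℂ] (G.Dual → ℂ) :=
  G.sumPairing S ∘ₗ
    (LinearEquiv.ofInjective (G.sumPairing G.dualPow) G.sumPairing_dualPow_injective).symm.toLinearMap

/-- The defining formula of the Sheffer operator. -/
lemma shefferOperator_apply (S : ∀ n, G.Dual → G.SymDual n) (n : ℕ) (φ : G.SymTest n)
    (p : G.Polynomials) (hp : ∀ w, p.1 w = (G.dualPow n w).1 φ) (w : G.Dual) :
    G.shefferOperator S p w = (S n w).1 φ := by
  have h : ∀ (P : ∀ n, G.Dual → G.SymDual n) w,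
      G.sumPairing P (DFinsupp.single n φ) w = (P n w).1 φ := fun P w =>
    DFinsupp.lsum_single (R := ℂ) ℕ (F := fun n => (P n w).1) (x := φ)
  have h1 : p = LinearEquiv.ofInjective (G.sumPairing G.dualPow) G.sumPairing_dualPow_injective
      (DFinsupp.single n φ) :=
    Subtype.ext (funext fun w => (hp w).trans (h G.dualPow w).symm)
  rw [h1]
  change G.sumPairing S ((LinearEquiv.ofInjective (G.sumPairing G.dualPow)
    G.sumPairing_dualPow_injective).symm _) w = _
  rw [LinearEquiv.symm_apply_apply, h]

end Defs

end GelfandTriple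

end

/-!
The Sheffer operator of an Appell sequence is a differential operator of infinite order: the
generating function `exp⟨ω, ξ⟩ / ρ(ξ)` says that, on powers `⟨ω, ξ⟩ⁿ`, it is the operator `f ↦ ∑ₘ
⟨θ⁽ᵐ⁾, D^m f⟩`, where `D^m f(ω) ∈ Φ^{⊙m}` is the derivative of order `m`. This formula makes sense
for every `f` in `ℰ^α_min(Φ')`, and defines the required extension.

Continuity is a Cauchy estimate (`FunctionalBound.exists_norm_term_le`). Suppose that `f` is of
order `a ≤ β` and minimal type, so that `|f(ω)| ≤ N exp(ε ‖ω‖^a)` on `H_{-σ}`. On the ball of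
radius `m r` around `ω`, this bounds `D^m f(ω)`, as a bounded form, by `N exp(ε (‖ω‖ + m r)^a) /
r^m`. With `m r` of the size of `m^{1/a}`, the powers `r^m` beat the bounds `A^m (m!)^{1/β-1}` on
the functionals `θ⁽ᵐ⁾`, precisely because `a ≤ β`, and the exponential costs only a factor `e^m`,
if `ε` is small (`exists_radius_estimate`). The terms then decay geometrically. The Cauchy
estimate controls `D^m f(ω)` as a bounded form on `H_{-σ}` and not in the Hilbert-Schmidt norm
whose dual is `‖·‖_{-τ}`. If the inclusion `H_σ ⊆ H_τ` is of Hilbert-Schmidt class, however,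
bounded forms on `H_{-σ}` are Hilbert-Schmidt forms on `H_{-τ}`, with a loss of a factor `κ^m`
only (`exists_hsNorm_le`). The same fact shows that derivatives of entire functions are in
`Φ^{⊙m}`. For `α = 0`, the seminorms with exponents `a ≤ β` suffice.

The operator with coefficients `ρ⁽ᵐ⁾` is continuous for the same reason. On powers, composing two
such operators multiplies the series `∑ ⟨θ⁽ᵐ⁾, ξ^{⊗m}⟩` and `∑ ⟨ρ⁽ᵐ⁾, ξ^{⊗m}⟩`, and the product is
`1` (`diffOp_comp_testPow`). An identity on powers extends to all `⟨ω^{⊗n}, φ⟩`, since both sides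
are bounded functionals of `φ` and tensor powers are total in `Φ^{⊙n}` (`eq_zero_of_testPow`, by
polarization and finite rank approximation of the Hilbert-Schmidt inclusions). It then extends to
`ℰ^α_min(Φ')`, since Taylor series converge there (`tendsto_taylorSum`), which also gives the
density of the polynomials. The two operators are therefore inverse to each other, and the first
one agrees with the Sheffer operator on polynomials (`IsAppellSequence.map_monomialEmin`).

Holomorphy on Banach spaces of infinite dimension is taken in the sense of complex Fréchet
differentiability; the smoothness, analyticity and Cauchy estimates this implies are proved here
from the theory in one complex variable.
-/

/-! ### Holomorphic maps between complex Banach spaces -/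

section BanachHolomorphy

variable {E F : Type*} [NormedAddCommGroup E] [NormedSpace ℂ E] [NormedAddCommGroup F]
  [NormedSpace ℂ F]

/-- The Cauchy estimate for the derivative of a holomorphic map between Banach spaces. -/
theorem norm_fderiv_le_of_forall_mem_closedBall {f : E → F} (hf : Differentiable ℂ f) {x : E}
    {r M : ℝ} (hr : 0 < r) (hM : ∀ y ∈ Metric.closedBall x r, ‖f y‖ ≤ M) :
    ‖fderiv ℂ f x‖ ≤ M / r := by
  have hM0 : 0 ≤ M := (norm_nonneg _).trans (hM x (Metric.mem_closedBall_self hr.le))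
  refine ContinuousLinearMap.opNorm_le_bound _ (by positivity) fun v => ?_
  rcases eq_or_ne v 0 with rfl | hv
  · simp
  have hv' : 0 < ‖v‖ := norm_pos_iff.2 hv
  have hline : HasDerivAt (fun z : ℂ => f (x + z • v)) (fderiv ℂ f x v) 0 := by
    have h1 : HasFDerivAt f (fderiv ℂ f x) (x + (0 : ℂ) • v) := by
      simpa using (hf x).hasFDerivAt
    have h2 : HasDerivAt (fun z : ℂ => x + z • v) v 0 := by
      simpa using ((hasDerivAt_id (0 : ℂ)).smul_const v).const_add x
    exact h1.comp_hasDerivAt 0 h2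
  have hd : Differentiable ℂ (fun z : ℂ => f (x + z • v)) :=
    hf.comp ((differentiable_const x).add (differentiable_id.smul_const v))
  have h := Complex.norm_deriv_le_of_forall_mem_sphere_norm_le (c := 0) (C := M)
    (R := r / ‖v‖) (f := fun z : ℂ => f (x + z • v)) (by positivity)
    hd.diffContOnCl (fun z hz => hM _ (by
      have hz' : ‖z‖ = r / ‖v‖ := by simpa using hz
      rw [Metric.mem_closedBall, dist_eq_norm, add_sub_cancel_left, norm_smul, hz',
        div_mul_cancel₀ _ hv'.ne']))
  rw [hline.deriv] at h
  exact h.trans_eq (by field_simp)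

/-- Holomorphic maps are locally bounded, hence their derivatives are locally Lipschitz. -/
theorem exists_lipschitz_fderiv {f : E → F} (hf : Differentiable ℂ f) {x : E} {r M : ℝ}
    (hr : 0 < r) (hM : ∀ y ∈ Metric.ball x (4 * r), ‖f y‖ ≤ M) :
    ∀ y ∈ Metric.ball x r, ∀ z ∈ Metric.ball x r,
      ‖fderiv ℂ f y - fderiv ℂ f z‖ ≤ M / r ^ 2 * ‖y - z‖ := by
  intro y hy z hz
  have h1 : ∀ u ∈ Metric.ball x (3 * r), ‖fderiv ℂ f u‖ ≤ M / r := fun u hu =>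
    norm_fderiv_le_of_forall_mem_closedBall hf hr fun w hw => hM w (by
      have := dist_triangle w u x
      rw [Metric.mem_closedBall] at hw
      rw [Metric.mem_ball] at hu ⊢
      linarith)
  have hdiff : Differentiable ℂ (fun u => f (u + (y - z)) - f u) :=
    (hf.comp (differentiable_id.add_const _)).sub hf
  have h2 : ∀ u ∈ Metric.closedBall z r, ‖f (u + (y - z)) - f u‖ ≤ M / r * ‖y - z‖ := by
    intro u hu
    have h3 := (convex_ball x (3 * r)).norm_image_sub_le_of_norm_fderiv_le (𝕜 := ℂ)
      (fun w _ => hf w) h1 (x := u) (y := u + (y - z)) ?_ ?_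
    · simpa using h3
    · have := dist_triangle u z x
      rw [Metric.mem_closedBall] at hu
      rw [Metric.mem_ball] at hz ⊢
      linarith
    · rw [Metric.mem_closedBall, dist_eq_norm] at hu
      rw [Metric.mem_ball, dist_eq_norm] at hy ⊢
      calc ‖u + (y - z) - x‖ = ‖(u - z) + (y - x)‖ := by congr 1; abel
        _ ≤ ‖u - z‖ + ‖y - x‖ := norm_add_le _ _
        _ < 3 * r := by linarith
  have h4 := norm_fderiv_le_of_forall_mem_closedBall hdiff hr h2
  have h5 : fderiv ℂ (fun u => f (u + (y - z)) - f u) z = fderiv ℂ f y - fderiv ℂ f z := by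
    have h6 : DifferentiableAt ℂ (fun u => f (u + (y - z))) z :=
      (hf.comp (differentiable_id.add_const _)) z
    rw [fderiv_fun_sub h6 (hf z), fderiv_comp_add_right]
    congr 2
    abel
  rw [h5] at h4
  exact h4.trans_eq (by field_simp)

theorem exists_ball_norm_le {f : E → F} (hf : Differentiable ℂ f) (x : E) :
    ∃ r > 0, ∃ M : ℝ, ∀ y ∈ Metric.ball x (4 * r), ‖f y‖ ≤ M := by
  have h := (hf.continuous.norm.continuousAt (x := x)).eventually (gt_mem_nhds (lt_add_one ‖f x‖))
  obtain ⟨r, hr, h⟩ := Metric.eventually_nhds_iff_ball.1 h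
  refine ⟨r / 4, by positivity, _, fun y hy => (h y ?_).le⟩
  rwa [mul_div_cancel₀ _ (by norm_num : (4 : ℝ) ≠ 0)] at hy

/-- A limit of holomorphic maps on a Banach space that is uniform near every point is
holomorphic. -/
theorem differentiable_of_tendstoUniformlyOn [CompleteSpace F] {f : ℕ → E → F} {g : E → F}
    (hf : ∀ n, Differentiable ℂ (f n))
    (h : ∀ x, ∃ r > 0, TendstoUniformlyOn f g Filter.atTop (Metric.ball x r)) :
    Differentiable ℂ g := by
  intro x
  obtain ⟨r, hr, hu⟩ := h x
  have hc : UniformCauchySeqOn (fun n => fderiv ℂ (f n)) Filter.atTop (Metric.ball x (r / 2)) := by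
    rw [Metric.uniformCauchySeqOn_iff]
    intro ε hε
    obtain ⟨N, hN⟩ := Metric.uniformCauchySeqOn_iff.1 hu.uniformCauchySeqOn (ε * (r / 8))
      (by positivity)
    refine ⟨N, fun m hm n hn y hy => ?_⟩
    have hdiff : Differentiable ℂ (fun u => f m u - f n u) := (hf m).sub (hf n)
    have h1 := norm_fderiv_le_of_forall_mem_closedBall hdiff (x := y) (r := r / 4)
      (M := ε * (r / 8)) (by positivity) (fun z hz => by
        rw [← dist_eq_norm]
        refine (hN m hm n hn z ?_).le
        have := dist_triangle z y x
        rw [Metric.mem_closedBall] at hz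
        rw [Metric.mem_ball] at hy ⊢
        linarith)
    rw [fderiv_fun_sub (hf m y) (hf n y)] at h1
    rw [dist_eq_norm]
    refine h1.trans_lt ?_
    rw [div_lt_iff₀ (by positivity)]
    nlinarith [mul_pos hε hr]
  have hlim : ∀ y ∈ Metric.ball x (r / 2), ∃ L, Filter.Tendsto (fun n => fderiv ℂ (f n) y)
      Filter.atTop (nhds L) := fun y hy => cauchySeq_tendsto_of_complete (hc.cauchySeq hy)
  choose! g' hg' using hlim
  exact (hasFDerivAt_of_tendstoUniformlyOn Metric.isOpen_ball
    (hc.tendstoUniformlyOn_of_tendsto fun y hy => hg' y hy)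
    (fun n y _ => (hf n y).hasFDerivAt)
    (fun y hy => hu.tendsto_at (Metric.ball_subset_ball (by linarith) hy))
    (Metric.mem_ball_self (by positivity))).differentiableAt

/-- The directional derivatives of a holomorphic map are locally uniform limits of difference
quotients, hence holomorphic. -/
theorem differentiable_fderiv_apply [CompleteSpace F] {f : E → F} (hf : Differentiable ℂ f)
    (v : E) : Differentiable ℂ (fun x => fderiv ℂ f x v) := by
  let t : ℕ → ℝ := fun n => 1 / ((n : ℝ) + 1)
  have ht : ∀ n, 0 < t n := fun n => by positivity
  refine differentiable_of_tendstoUniformlyOn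
    (f := fun n x => ((t n : ℂ))⁻¹ • (f (x + (t n : ℂ) • v) - f x)) (fun n =>
      ((hf.comp (differentiable_id.add_const _)).sub hf).const_smul _) fun x => ?_
  obtain ⟨r, hr, M, hM⟩ := exists_ball_norm_le hf x
  have hL := exists_lipschitz_fderiv hf hr hM
  have hM0 : 0 ≤ M := (norm_nonneg _).trans (hM x (Metric.mem_ball_self (by positivity)))
  refine ⟨r / 2, by positivity, ?_⟩
  rw [Metric.tendstoUniformlyOn_iff]
  intro ε hε
  have htend : Filter.Tendsto t Filter.atTop (nhds 0) := tendsto_one_div_add_atTop_nhds_zero_nat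
  have h1 : ∀ᶠ n in Filter.atTop, t n * ‖v‖ < r / 2 := by
    have := htend.mul_const ‖v‖
    rw [zero_mul] at this
    exact this.eventually (gt_mem_nhds (by positivity))
  have h2 : ∀ᶠ n in Filter.atTop, t n * (M / r ^ 2 * ‖v‖ ^ 2) < ε := by
    have := htend.mul_const (M / r ^ 2 * ‖v‖ ^ 2)
    rw [zero_mul] at this
    exact this.eventually (gt_mem_nhds hε)
  filter_upwards [h1, h2] with n hn1 hn2 y hy
  have hnorm : ‖(t n : ℂ) • v‖ = t n * ‖v‖ := by
    rw [norm_smul, Complex.norm_real, Real.norm_of_nonneg (ht n).le]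
  have hsub : Metric.ball y (r / 2) ⊆ Metric.ball x r := by
    intro z hz
    have := dist_triangle z y x
    rw [Metric.mem_ball] at hy hz ⊢
    linarith
  have hseg : segment ℝ y (y + (t n : ℂ) • v) ⊆ Metric.ball y (r / 2) :=
    (convex_ball y (r / 2)).segment_subset (Metric.mem_ball_self (by positivity)) (by
      rw [Metric.mem_ball, dist_eq_norm, add_sub_cancel_left, hnorm]
      exact hn1)
  have h3 := (convex_segment y (y + (t n : ℂ) • v)).norm_image_sub_le_of_norm_fderiv_le' (𝕜 := ℂ)
    (fun w _ => hf w) (φ := fderiv ℂ f y) (C := M / r ^ 2 * (t n * ‖v‖)) (fun w hw => by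
      refine (hL w (hsub (hseg hw)) y (hsub (Metric.mem_ball_self (by positivity)))).trans ?_
      refine mul_le_mul_of_nonneg_left ?_ (by positivity)
      rw [← hnorm]
      have h := norm_sub_le_of_mem_segment hw
      rwa [add_sub_cancel_left] at h) (left_mem_segment ℝ _ _)
    (right_mem_segment ℝ _ _)
  rw [add_sub_cancel_left, hnorm, map_smul] at h3
  have htc : (t n : ℂ) ≠ 0 := by exact_mod_cast (ht n).ne'
  have h4 : fderiv ℂ f y v - (t n : ℂ)⁻¹ • (f (y + (t n : ℂ) • v) - f y) =
      -((t n : ℂ)⁻¹ • (f (y + (t n : ℂ) • v) - f y - (t n : ℂ) • fderiv ℂ f y v)) := by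
    rw [smul_sub _ _ ((t n : ℂ) • fderiv ℂ f y v), smul_smul, inv_mul_cancel₀ htc, one_smul]
    abel
  rw [dist_eq_norm, h4, norm_neg, norm_smul, norm_inv, Complex.norm_real,
    Real.norm_of_nonneg (ht n).le]
  refine lt_of_le_of_lt ?_ hn2
  rw [inv_mul_le_iff₀ (ht n)]
  exact h3.trans_eq (by ring)

/-- The derivative of a holomorphic map between Banach spaces is holomorphic. -/
theorem differentiable_fderiv_of_complex [CompleteSpace F] {f : E → F}
    (hf : Differentiable ℂ f) : Differentiable ℂ (fderiv ℂ f) := by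
  intro x
  have hv := fun v => differentiable_fderiv_apply hf v
  obtain ⟨r, hr, M, hM⟩ := exists_ball_norm_le hf x
  have hM0 : 0 ≤ M := (norm_nonneg _).trans (hM x (Metric.mem_ball_self (by positivity)))
  have h1 : ∀ v, ∀ u ∈ Metric.ball x (3 * r), ‖fderiv ℂ f u v‖ ≤ M / r * ‖v‖ := fun v u hu =>
    (fderiv ℂ f u).le_of_opNorm_le (norm_fderiv_le_of_forall_mem_closedBall hf hr fun w hw =>
      hM w (by
        have := dist_triangle w u x
        rw [Metric.mem_closedBall] at hw
        rw [Metric.mem_ball] at hu ⊢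
        linarith)) v
  -- The second derivative, assembled from the derivatives of the directional derivatives.
  let B : E →L[ℂ] E →L[ℂ] F := LinearMap.mkContinuous₂
    (LinearMap.mk₂ ℂ (fun h v => fderiv ℂ (fun y => fderiv ℂ f y v) x h)
      (fun _ _ _ => map_add _ _ _) (fun _ _ _ => map_smul _ _ _)
      (fun h v w => by
        have : (fun y => fderiv ℂ f y (v + w)) =
            fun y => fderiv ℂ f y v + fderiv ℂ f y w := by ext y; rw [map_add]
        rw [this, fderiv_fun_add (hv v x) (hv w x)]
        rfl)
      (fun c h v => by
        have : (fun y => fderiv ℂ f y (c • v)) = fun y => c • fderiv ℂ f y v := by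
          ext y; rw [map_smul]
        rw [this, fderiv_fun_const_smul (hv v x)]
        rfl)) (M / r ^ 2) (fun h v => by
        have h2 := norm_fderiv_le_of_forall_mem_closedBall (hv v) (x := x) hr (fun y hy =>
          h1 v y (by
            rw [Metric.mem_closedBall] at hy
            rw [Metric.mem_ball]
            linarith))
        refine ((fderiv ℂ (fun y => fderiv ℂ f y v) x).le_of_opNorm_le h2 h).trans_eq ?_
        field_simp)
  have hB : ∀ h v, B h v = fderiv ℂ (fun y => fderiv ℂ f y v) x h := fun _ _ => rfl
  refine ⟨B, ?_⟩
  rw [hasFDerivAt_iff_isLittleO_nhds_zero]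
  set s := r / 2 with hs
  have hs0 : 0 < s := by positivity
  have key : ∀ h ∈ Metric.ball (0 : E) s,
      ‖fderiv ℂ f (x + h) - fderiv ℂ f x - B h‖ ≤ M / r / s ^ 2 * ‖h‖ * ‖h‖ := by
    intro h hh
    rw [mem_ball_zero_iff] at hh
    refine ContinuousLinearMap.opNorm_le_bound _ (by positivity) fun v => ?_
    have hL := exists_lipschitz_fderiv (hv v) (x := x) hs0 (M := M / r * ‖v‖) (fun u hu =>
      h1 v u (Metric.ball_subset_ball (by rw [hs]; linarith) hu))
    have hseg : segment ℝ x (x + h) ⊆ Metric.ball x s :=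
      (convex_ball x s).segment_subset (Metric.mem_ball_self hs0) (by simpa using hh)
    have h3 := (convex_segment x (x + h)).norm_image_sub_le_of_norm_fderiv_le' (𝕜 := ℂ)
      (fun w _ => hv v w) (φ := fderiv ℂ (fun y => fderiv ℂ f y v) x)
      (C := M / r * ‖v‖ / s ^ 2 * ‖h‖) (fun w hw => by
        refine (hL w (hseg hw) x (Metric.mem_ball_self hs0)).trans ?_
        refine mul_le_mul_of_nonneg_left ?_ (by positivity)
        have h := norm_sub_le_of_mem_segment hw
        rwa [add_sub_cancel_left] at h) (left_mem_segment ℝ _ _)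
      (right_mem_segment ℝ _ _)
    rw [add_sub_cancel_left] at h3
    refine h3.trans_eq ?_
    ring
  rw [Asymptotics.isLittleO_iff]
  intro c hc
  have hev : ∀ᶠ h in nhds (0 : E), M / r / s ^ 2 * ‖h‖ < c := by
    have : Filter.Tendsto (fun h : E => M / r / s ^ 2 * ‖h‖) (nhds 0) (nhds 0) := by
      have h : Continuous fun h : E => M / r / s ^ 2 * ‖h‖ := continuous_const.mul continuous_norm
      have h' := h.tendsto 0
      rwa [norm_zero, mul_zero] at h'
    exact this.eventually (gt_mem_nhds hc)
  filter_upwards [Metric.ball_mem_nhds (0 : E) hs0, hev] with h hh hh'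
  exact (key h hh).trans (mul_le_mul_of_nonneg_right hh'.le (norm_nonneg h))

/-- Stated for an arbitrary isometry `e`, to be applied to the currying isometries. -/
theorem differentiable_comp_fderiv_of_complex [CompleteSpace F] {F' : Type*}
    [NormedAddCommGroup F'] [NormedSpace ℂ F'] (e : (E →L[ℂ] F) ≃ₗᵢ[ℂ] F') {f : E → F}
    (hf : Differentiable ℂ f) : Differentiable ℂ (e ∘ fderiv ℂ f) :=
  e.differentiable.comp (differentiable_fderiv_of_complex hf)

theorem differentiable_iteratedFDeriv_of_complex [CompleteSpace F] {f : E → F}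
    (hf : Differentiable ℂ f) (n : ℕ) : Differentiable ℂ (iteratedFDeriv ℂ n f) := by
  induction n with
  | zero =>
    rw [iteratedFDeriv_zero_eq_comp]
    exact (LinearIsometryEquiv.differentiable _).comp hf
  | succ n ih =>
    rw [iteratedFDeriv_succ_eq_comp_left]
    exact differentiable_comp_fderiv_of_complex
      (continuousMultilinearCurryLeftEquiv ℂ (fun _ : Fin (n + 1) => E) F).symm ih

/-- Complex differentiable maps between Banach spaces are smooth. -/
theorem contDiff_of_complex_differentiable [CompleteSpace F] {f : E → F}
    (hf : Differentiable ℂ f) (n : ℕ∞) : ContDiff ℂ n f :=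
  contDiff_of_differentiable_iteratedFDeriv fun m _ => differentiable_iteratedFDeriv_of_complex hf m

/-- The Cauchy estimate for the derivatives of order `n`, obtained by spending the radius `r` on
each of the `n` differentiations. -/
theorem norm_iteratedFDeriv_le_of_forall_mem_closedBall [CompleteSpace F] {f : E → F}
    (hf : Differentiable ℂ f) {r M : ℝ} (hr : 0 < r) (n : ℕ) {x : E}
    (hM : ∀ y ∈ Metric.closedBall x (n * r), ‖f y‖ ≤ M) :
    ‖iteratedFDeriv ℂ n f x‖ ≤ M / r ^ n := by
  induction n generalizing x with
  | zero => simpa using hM x (by simp)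
  | succ n ih =>
    rw [← norm_fderiv_iteratedFDeriv]
    refine (norm_fderiv_le_of_forall_mem_closedBall
      (differentiable_iteratedFDeriv_of_complex hf n) hr fun y hy => ih fun z hz => hM z ?_).trans_eq
      (by rw [pow_succ, div_div])
    have := dist_triangle z y x
    rw [Metric.mem_closedBall] at hy hz ⊢
    push_cast
    linarith

/-- The derivatives along a complex line `z ↦ x + z y`. -/
theorem iteratedDeriv_comp_line [CompleteSpace F] {f : E → F} (hf : Differentiable ℂ f)
    (x y : E) (n : ℕ) : iteratedDeriv n (fun z : ℂ => f (z • y + x)) 0 =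
      iteratedFDeriv ℂ n f x fun _ => y := by
  let ℓ : ℂ →L[ℂ] E := ContinuousLinearMap.toSpanSingleton ℂ y
  have hg : Differentiable ℂ (fun z => f (z + x)) := hf.comp (differentiable_id.add_const _)
  have hℓ : (fun z : ℂ => f (z • y + x)) = (fun z => f (z + x)) ∘ ℓ := by
    funext z
    simp [ℓ]
  rw [hℓ, iteratedDeriv_eq_iteratedFDeriv,
    ℓ.iteratedFDeriv_comp_right (contDiff_of_complex_differentiable hg n) 0 le_rfl,
    ContinuousMultilinearMap.compContinuousLinearMap_apply, iteratedFDeriv_comp_add_right]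
  simp [ℓ]

theorem differentiable_comp_line {f : E → F} (hf : Differentiable ℂ f) (x y : E) :
    Differentiable ℂ (fun z : ℂ => f (z • y + x)) :=
  hf.comp ((differentiable_id.smul_const y).add_const x)

/-- The Taylor expansion of an entire function on a Banach space. -/
theorem hasSum_iteratedFDeriv_of_complex [CompleteSpace F] {f : E → F} (hf : Differentiable ℂ f)
    (x y : E) :
    HasSum (fun n : ℕ => (n.factorial : ℂ)⁻¹ • iteratedFDeriv ℂ n f x fun _ => y) (f (x + y)) := by
  have h := Complex.hasSum_taylorSeries_of_entire (differentiable_comp_line hf x y) 0 1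
  simpa only [iteratedDeriv_comp_line hf, sub_zero, one_pow, one_smul, add_comm y x] using h

/-- Complex differentiable maps between Banach spaces are analytic. -/
theorem analyticAt_of_complex_differentiable [CompleteSpace F] {f : E → F}
    (hf : Differentiable ℂ f) (x : E) : AnalyticAt ℂ f x := by
  obtain ⟨r, hr, M, hM⟩ := exists_ball_norm_le hf x
  have hM0 : 0 ≤ M := (norm_nonneg _).trans (hM x (Metric.mem_ball_self (by positivity)))
  let p : FormalMultilinearSeries ℂ E F := fun n => (n.factorial : ℂ)⁻¹ • iteratedFDeriv ℂ n f x
  have hbound : ∀ n, ‖p n‖ * (r / Real.exp 1) ^ n ≤ M := by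
    intro n
    have hf0 : (0 : ℝ) < n.factorial := by exact_mod_cast n.factorial_pos
    simp only [p]
    rw [norm_smul, norm_inv, Complex.norm_natCast]
    rcases Nat.eq_zero_or_pos n with rfl | hn
    · simpa using hM x (Metric.mem_ball_self (by positivity))
    have hn0 : (0 : ℝ) < n := by exact_mod_cast hn
    have h1 := norm_iteratedFDeriv_le_of_forall_mem_closedBall hf (r := r / n) (M := M)
      (by positivity) n (x := x) (fun y hy => hM y (by
        rw [mul_div_cancel₀ _ hn0.ne', Metric.mem_closedBall] at hy
        rw [Metric.mem_ball]
        linarith))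
    have h2 := Real.pow_div_factorial_le_exp (n : ℝ) hn0.le n
    have h3 : Real.exp n = Real.exp 1 ^ n := by rw [← Real.exp_nat_mul, mul_one]
    calc (n.factorial : ℝ)⁻¹ * ‖iteratedFDeriv ℂ n f x‖ * (r / Real.exp 1) ^ n
        ≤ (n.factorial : ℝ)⁻¹ * (M / (r / n) ^ n) * (r / Real.exp 1) ^ n := by gcongr
      _ = (n : ℝ) ^ n / n.factorial * (M / Real.exp 1 ^ n) := by
          rw [div_pow, div_pow]; field_simp
      _ ≤ Real.exp 1 ^ n * (M / Real.exp 1 ^ n) := by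
          rw [← h3] at *; gcongr
      _ = M := by field_simp
  have hrad : ENNReal.ofReal (r / Real.exp 1) ≤ p.radius := by
    have := p.le_radius_of_bound (r := (r / Real.exp 1).toNNReal) M (fun n => by
      rw [Real.coe_toNNReal _ (by positivity)]
      exact hbound n)
    exact this
  exact ⟨p, ENNReal.ofReal (r / Real.exp 1), hrad, by positivity,
    fun {y} _ => hasSum_iteratedFDeriv_of_complex hf x y⟩

theorem iteratedFDeriv_perm_of_complex_differentiable [CompleteSpace F] {f : E → F}
    (hf : Differentiable ℂ f) (x : E) {n : ℕ} (v : Fin n → E) (π : Equiv.Perm (Fin n)) :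
    iteratedFDeriv ℂ n f x (fun i => v (π i)) = iteratedFDeriv ℂ n f x v :=
  (analyticAt_of_complex_differentiable hf x).contDiffAt.iteratedFDeriv_comp_perm v π

/-- Hahn-Banach: a linear functional dominated by the norm of the image under `R` factors through
a bounded functional. -/
theorem exists_strongDual_comp_eq {V : Type*} [AddCommGroup V] [Module ℂ V] (R : V →ₗ[ℂ] E)
    (ψ : V →ₗ[ℂ] ℂ) (C : ℝ) (h : ∀ v, ‖ψ v‖ ≤ C * ‖R v‖) :
    ∃ Θ : StrongDual ℂ E, ∀ v, Θ (R v) = ψ v := by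
  obtain ⟨s, hs⟩ := R.rangeRestrict.exists_rightInverse_of_surjective R.range_rangeRestrict
  have hs' : ∀ y : LinearMap.range R, R (s y) = y := fun y =>
    congrArg Subtype.val (LinearMap.congr_fun hs y)
  let g : StrongDual ℂ (LinearMap.range R) := (ψ ∘ₗ s).mkContinuous C (fun y => by
    refine (h (s y)).trans_eq ?_
    rw [hs']; rfl)
  obtain ⟨Θ, hΘ, -⟩ := exists_extension_norm_eq _ g
  refine ⟨Θ, fun v => ?_⟩
  have h1 := hΘ (R.rangeRestrict v)
  have h2 : ψ (s (R.rangeRestrict v) - v) = 0 := by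
    rw [← norm_le_zero_iff]
    refine (h _).trans_eq ?_
    rw [map_sub, hs']
    simp
  rw [map_sub, sub_eq_zero] at h2
  exact h1.trans h2

end BanachHolomorphy

/-! ### Forms on the co-nuclear space and Hilbert-Schmidt bounds -/

noncomputable section

universe u v

/-- Parseval's identity for a functional on a Hilbert space. -/
theorem hasSum_norm_sq_strongDual {E : Type*} [NormedAddCommGroup E] [InnerProductSpace ℂ E]
    [CompleteSpace E] {ι : Type*} (b : HilbertBasis ι ℂ E) (x : StrongDual ℂ E) :
    HasSum (fun i => ‖x (b i)‖ ^ 2) (‖x‖ ^ 2) := by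
  obtain ⟨u, rfl⟩ := (InnerProductSpace.toDual ℂ E).surjective x
  have h := b.hasSum_inner_mul_inner u u
  have h1 : ∀ i, ⟪u, b i⟫_ℂ * ⟪b i, u⟫_ℂ = ((‖InnerProductSpace.toDual ℂ E u (b i)‖ ^ 2 : ℝ) : ℂ) := by
    intro i
    rw [InnerProductSpace.toDual_apply_apply, ← inner_conj_symm (b i) u, Complex.mul_conj,
      Complex.normSq_eq_norm_sq]
  simp only [h1, inner_self_eq_norm_sq_to_K] at h
  rw [LinearIsometryEquiv.norm_map]
  refine Complex.hasSum_ofReal.1 ?_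
  rw [Complex.ofReal_pow]
  exact h

namespace GelfandTriple

variable {T : Type u} {H : T → Type v} [∀ τ, NormedAddCommGroup (H τ)]
  [∀ τ, InnerProductSpace ℂ (H τ)] (G : GelfandTriple H)

/-- A continuous inclusion `H_σ ⊆ H_τ`, compatible with the embeddings into the center space. -/
def IsInclusion {σ τ : T} (j : H σ →L[ℂ] H τ) : Prop := G.emb τ ∘L j = G.emb σ

variable {G}

theorem IsInclusion.apply_toH {σ τ : T} {j : H σ →L[ℂ] H τ} (hj : G.IsInclusion j) (ξ : G.Test) :
    j (G.toH σ ξ) = G.toH τ ξ := by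
  apply G.emb_injective τ
  rw [G.toH_spec, ← G.toH_spec σ ξ, ← hj]
  rfl

/-- The transpose of an inclusion `H_σ ⊆ H_τ` is the inclusion `H_{-τ} ⊆ H_{-σ}`. -/
theorem IsInclusion.incl_comp {σ τ : T} {j : H σ →L[ℂ] H τ} (hj : G.IsInclusion j)
    (x : StrongDual ℂ (H τ)) : G.incl σ (x ∘L j) = G.incl τ x := by
  apply Subtype.ext
  ext ξ
  exact congrArg x (hj.apply_toH ξ)

theorem IsInclusion.comp {σ τ υ : T} {j : H σ →L[ℂ] H τ} {k : H τ →L[ℂ] H υ}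
    (hk : G.IsInclusion k) (hj : G.IsInclusion j) : G.IsInclusion (k ∘L j) := by
  unfold IsInclusion at *
  rw [← ContinuousLinearMap.comp_assoc, hk, hj]

variable (G)

theorem denseRange_toH (τ : T) : DenseRange (G.toH τ) := by
  refine (G.dense τ).mono fun x hx => ?_
  have hmem : G.emb τ x ∈ G.Test := (Submodule.mem_iInf _).2 hx
  exact ⟨⟨_, hmem⟩, G.emb_injective τ (G.toH_spec τ ⟨_, hmem⟩)⟩

theorem incl_injective (τ : T) : Function.Injective (G.incl τ) := by
  intro x y hxy
  refine ContinuousLinearMap.ext fun z => ?_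
  refine congrFun ((G.denseRange_toH τ).equalizer x.continuous y.continuous ?_) z
  funext ξ
  exact LinearMap.congr_fun (congrArg Subtype.val hxy) ξ

/-- Finitely many of the spaces `H_τ` contain a common one. -/
theorem exists_common_inclusion {ι : Type*} [Finite ι] (f : ι → T) :
    ∃ σ, ∀ i, ∃ j : H σ →L[ℂ] H (f i), G.IsInclusion j := by
  let r : T → T → Prop := fun τ σ => ∃ j : H σ →L[ℂ] H τ, G.IsInclusion j
  have : IsTrans T r := ⟨by
    rintro a b c ⟨j, hj⟩ ⟨k, hk⟩
    exact ⟨j ∘L k, hj.comp hk⟩⟩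
  have : Nonempty T := ⟨G.center⟩
  have hd : Directed r (id : T → T) := fun a b => by
    obtain ⟨c, h1, h2⟩ := G.directed a b
    exact ⟨c, h1, h2⟩
  exact hd.finite_le f

/-- Finitely many elements of `Φ'` belong to a common `H_{-τ}`. -/
theorem exists_incl_family {ι : Type*} [Finite ι] (w : ι → G.Dual) :
    ∃ τ, ∃ x : ι → StrongDual ℂ (H τ), ∀ i, G.incl τ (x i) = w i := by
  choose f x hx using fun i => G.exists_incl (w i)
  obtain ⟨σ, hσ⟩ := G.exists_common_inclusion f
  choose j hj using hσ
  exact ⟨σ, fun i => x i ∘L j i, fun i => ((hj i).incl_comp _).trans (hx i)⟩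

/-- The bound `|φ(ω₁, …, ωₙ)| ≤ K ∏ ‖ωᵢ‖_{-τ}` for an `n`-linear form `φ` on `Φ'`. -/
def FormBound (τ : T) {n : ℕ} (φ : MultilinearMap ℂ (fun _ : Fin n => G.Dual) ℂ) (K : ℝ) : Prop :=
  ∀ x : Fin n → StrongDual ℂ (H τ), ‖φ fun i => G.incl τ (x i)‖ ≤ K * ∏ i, ‖x i‖

variable {G}

theorem FormBound.of_inclusion {σ τ : T} {j : H σ →L[ℂ] H τ} (hj : G.IsInclusion j) {n : ℕ}
    {φ : MultilinearMap ℂ (fun _ : Fin n => G.Dual) ℂ} {K : ℝ} (hK : 0 ≤ K)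
    (h : G.FormBound σ φ K) : G.FormBound τ φ (‖j‖ ^ n * K) := by
  intro x
  have h1 := h fun i => x i ∘L j
  simp only [hj.incl_comp] at h1
  refine h1.trans ?_
  calc K * ∏ i, ‖x i ∘L j‖ ≤ K * ∏ i, (‖j‖ * ‖x i‖) := by
        gcongr with i
        rw [mul_comm]
        exact ContinuousLinearMap.opNorm_comp_le _ _
    _ = ‖j‖ ^ n * K * ∏ i, ‖x i‖ := by
        rw [Finset.prod_mul_distrib, Finset.prod_const, Finset.card_univ, Fintype.card_fin]
        ring

theorem FormBound.smul {τ : T} {n : ℕ} {φ : MultilinearMap ℂ (fun _ : Fin n => G.Dual) ℂ} {K : ℝ}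
    (h : G.FormBound τ φ K) (c : ℂ) : G.FormBound τ (c • φ) (‖c‖ * K) := by
  intro x
  rw [smul_apply, norm_smul, mul_assoc]
  exact mul_le_mul_of_nonneg_left (h x) (norm_nonneg c)

theorem FormBound.mono {τ : T} {n : ℕ} {φ : MultilinearMap ℂ (fun _ : Fin n => G.Dual) ℂ}
    {K K' : ℝ} (h : G.FormBound τ φ K) (hK : K ≤ K') : G.FormBound τ φ K' := fun x =>
  (h x).trans (mul_le_mul_of_nonneg_right hK (Finset.prod_nonneg fun _ _ => norm_nonneg _))

variable (G)

/-- Compatible multilinear forms on the spaces `H_{-τ}` are the restrictions of a multilinear form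
on their union `Φ'`. -/
theorem exists_multilinearMap_of_compatible {n : ℕ}
    (A : ∀ τ, MultilinearMap ℂ (fun _ : Fin n => StrongDual ℂ (H τ)) ℂ)
    (hA : ∀ (σ τ : T) (j : H σ →L[ℂ] H τ), G.IsInclusion j → ∀ x, A τ x = A σ fun i => x i ∘L j) :
    ∃ φ : MultilinearMap ℂ (fun _ : Fin n => G.Dual) ℂ,
      ∀ τ x, (φ fun i => G.incl τ (x i)) = A τ x := by
  classical
  have hc : ∀ w : Fin n → G.Dual, ∃ c : ℂ, ∀ τ (x : Fin n → StrongDual ℂ (H τ)),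
      (∀ i, G.incl τ (x i) = w i) → A τ x = c := by
    intro w
    obtain ⟨τ, x, hx⟩ := G.exists_incl_family w
    refine ⟨A τ x, fun τ' x' hx' => ?_⟩
    obtain ⟨σ, ⟨j, hj⟩, ⟨k, hk⟩⟩ := G.directed τ τ'
    rw [hA σ τ j hj x, hA σ τ' k hk x']
    congr 1
    funext i
    apply G.incl_injective σ
    rw [IsInclusion.incl_comp hk, IsInclusion.incl_comp hj, hx, hx']
  choose φ hφ using hc
  have hupd : ∀ (τ : T) (x : Fin n → StrongDual ℂ (H τ)) (i : Fin n) (a : StrongDual ℂ (H τ))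
      (w : Fin n → G.Dual), (∀ i, G.incl τ (x i) = w i) →
      φ (Function.update w i (G.incl τ a)) = A τ (Function.update x i a) := by
    intro τ x i a w hx
    refine (hφ _ τ _ fun k => ?_).symm
    rcases eq_or_ne k i with rfl | hk
    · simp
    · simp [hk, hx]
  refine ⟨{ toFun := φ, map_update_add' := ?_, map_update_smul' := ?_ }, fun τ x =>
    (hφ _ τ x fun _ => rfl).symm⟩
  · intro inst w i a b
    obtain rfl : inst = _ := Subsingleton.elim _ (instDecidableEqFin n)
    obtain ⟨τ, x, hx⟩ := G.exists_incl_family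
      (fun o : Option (Option (Fin n)) => o.elim a fun o => o.elim b w)
    have ha : G.incl τ (x none) = a := hx none
    have hb : G.incl τ (x (some none)) = b := hx (some none)
    have hw : ∀ i, G.incl τ (x (some (some i))) = w i := fun i => hx (some (some i))
    rw [← ha, ← hb, ← map_add, hupd τ _ i _ w hw, hupd τ _ i _ w hw, hupd τ _ i _ w hw,
      MultilinearMap.map_update_add]
  · intro inst w i c a
    obtain rfl : inst = _ := Subsingleton.elim _ (instDecidableEqFin n)
    obtain ⟨τ, x, hx⟩ := G.exists_incl_family (fun o : Option (Fin n) => o.elim a w)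
    have ha : G.incl τ (x none) = a := hx none
    have hw : ∀ i, G.incl τ (x (some i)) = w i := fun i => hx (some i)
    rw [← ha, ← map_smul, hupd τ _ i _ w hw, hupd τ _ i _ w hw, MultilinearMap.map_update_smul]

section HilbertSchmidt

variable [∀ τ, CompleteSpace (H τ)]

/-- Bounded forms on `H_{-σ}` are Hilbert-Schmidt on `H_{-τ}` if the inclusion `H_σ ⊆ H_τ` is
Hilbert-Schmidt. -/
theorem exists_hsNorm_le {σ τ : T} {j : H σ →L[ℂ] H τ} (hj : G.IsInclusion j)
    (hs : IsHilbertSchmidt j) :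
    ∃ κ : ℝ, 1 ≤ κ ∧ ∀ (n : ℕ) (φ : MultilinearMap ℂ (fun _ : Fin n => G.Dual) ℂ) (K : ℝ),
      0 ≤ K → G.FormBound σ φ K → G.hsNorm τ φ ≤ ENNReal.ofReal (κ ^ n * K) := by
  obtain ⟨w, b, hsum⟩ := hs
  set s := ∑' i, ‖j (b i)‖ ^ 2 with hs
  have hs0 : 0 ≤ s := tsum_nonneg fun _ => by positivity
  refine ⟨max 1 (√s), le_max_left _ _, fun n φ K hK hφ => ?_⟩
  set κ := max 1 (√s) with hκ
  have hκs : s ≤ κ ^ 2 := by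
    rw [← Real.sq_sqrt hs0]
    exact pow_le_pow_left₀ (Real.sqrt_nonneg _) (le_max_right _ _) 2
  have hκ0 : 0 ≤ κ := zero_le_one.trans (le_max_left _ _)
  have key : ∀ (m : ℕ) (e : Fin m → H τ), Orthonormal ℂ e →
      ∑ i : Fin n → Fin m,
        ‖φ fun k => G.incl τ (InnerProductSpace.toDual ℂ (H τ) (e (i k)))‖ₑ ^ 2 ≤
      ENNReal.ofReal ((κ ^ n * K) ^ 2) := by
    intro m e he
    have h1 : ∑ k, ‖InnerProductSpace.toDual ℂ (H τ) (e k) ∘L j‖ ^ 2 ≤ s := by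
      have h2 : ∀ k, HasSum (fun i => ‖⟪e k, j (b i)⟫_ℂ‖ ^ 2)
          (‖InnerProductSpace.toDual ℂ (H τ) (e k) ∘L j‖ ^ 2) := fun k =>
        hasSum_norm_sq_strongDual b (InnerProductSpace.toDual ℂ (H τ) (e k) ∘L j)
      refine hasSum_le (fun i => ?_) (hasSum_sum fun k _ => h2 k) hsum.hasSum
      exact he.sum_inner_products_le (j (b i))
    have h3 : ∀ i : Fin n → Fin m,
        ‖φ fun k => G.incl τ (InnerProductSpace.toDual ℂ (H τ) (e (i k)))‖ ^ 2 ≤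
          K ^ 2 * ∏ k, ‖InnerProductSpace.toDual ℂ (H τ) (e (i k)) ∘L j‖ ^ 2 := by
      intro i
      have h := hφ fun k => InnerProductSpace.toDual ℂ (H τ) (e (i k)) ∘L j
      simp only [hj.incl_comp] at h
      rw [Finset.prod_pow, ← mul_pow]
      exact pow_le_pow_left₀ (norm_nonneg _) h 2
    have h4 : ∑ i : Fin n → Fin m,
        ‖φ fun k => G.incl τ (InnerProductSpace.toDual ℂ (H τ) (e (i k)))‖ ^ 2 ≤
          (κ ^ n * K) ^ 2 := by
      refine (Finset.sum_le_sum fun i _ => h3 i).trans ?_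
      rw [← Finset.mul_sum,
        ← Fintype.sum_pow (fun k => ‖InnerProductSpace.toDual ℂ (H τ) (e k) ∘L j‖ ^ 2) n]
      calc K ^ 2 * (∑ k, ‖InnerProductSpace.toDual ℂ (H τ) (e k) ∘L j‖ ^ 2) ^ n
          ≤ K ^ 2 * (κ ^ 2) ^ n := by
            gcongr
            exact h1.trans hκs
        _ = (κ ^ n * K) ^ 2 := by ring
    refine le_trans (le_of_eq ?_) (ENNReal.ofReal_le_ofReal h4)
    rw [ENNReal.ofReal_sum_of_nonneg fun i _ => by positivity]
    refine Finset.sum_congr rfl fun i _ => ?_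
    rw [ENNReal.ofReal_pow (norm_nonneg _), ofReal_norm]
  unfold hsNorm
  have h5 := ENNReal.rpow_le_rpow (iSup_le fun m => iSup_le fun e => iSup_le fun he => key m e he)
    (z := 1 / 2) (by norm_num)
  refine h5.trans_eq ?_
  rw [ENNReal.ofReal_rpow_of_nonneg (by positivity) (by norm_num), ← Real.sqrt_eq_rpow,
    Real.sqrt_sq (by positivity)]

/-- Hilbert-Schmidt forms are bounded. -/
theorem exists_formBound_of_hsNorm_lt_top {n : ℕ} {τ : T}
    {φ : MultilinearMap ℂ (fun _ : Fin n => G.Dual) ℂ} (h : G.hsNorm τ φ < ∞) :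
    ∃ K, 0 ≤ K ∧ G.FormBound τ φ K := by
  obtain ⟨C, hC, hb⟩ := (G.hsNorm_lt_top_iff τ φ).1 h
  refine ⟨√C.toReal, Real.sqrt_nonneg _, fun x => ?_⟩
  let y : Fin n → H τ := fun k => (InnerProductSpace.toDual ℂ (H τ)).symm (x k)
  have hy : ∀ k, x k = InnerProductSpace.toDual ℂ (H τ) (y k) := fun k => by simp [y]
  -- The argument takes place in the finite-dimensional span of the given vectors.
  let V : Submodule ℂ (H τ) := Submodule.span ℂ (Set.range y)
  have : FiniteDimensional ℂ V := FiniteDimensional.span_of_finite ℂ (Set.finite_range y)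
  let e := stdOrthonormalBasis ℂ V
  let e' : Fin (Module.finrank ℂ V) → H τ := fun i => (e i : H τ)
  have he' : Orthonormal ℂ e' := e.orthonormal.comp_linearIsometry V.subtypeₗᵢ
  have hyV : ∀ k, y k ∈ V := fun k => Submodule.subset_span ⟨k, rfl⟩
  have hexp : ∀ k, G.incl τ (x k) = ∑ i, (starRingEnd ℂ ⟪e' i, y k⟫_ℂ) •
      G.incl τ (InnerProductSpace.toDual ℂ (H τ) (e' i)) := by
    intro k
    have h1 := congrArg (Subtype.val) (e.sum_repr' ⟨y k, hyV k⟩)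
    rw [Submodule.coe_sum] at h1
    have h2 : ∑ i, ⟪e' i, y k⟫_ℂ • e' i = y k := h1
    rw [hy k]
    conv_lhs => rw [← h2]
    simp only [map_sum, map_smulₛₗ, RingHom.id_apply]
  have hsum : ∀ k, ∑ i, ‖starRingEnd ℂ ⟪e' i, y k⟫_ℂ‖ ^ 2 ≤ ‖x k‖ ^ 2 := by
    intro k
    simp only [RCLike.norm_conj]
    rw [hy k, LinearIsometryEquiv.norm_map]
    exact he'.sum_inner_products_le (y k)
  have hφ : (φ fun k => G.incl τ (x k)) = ∑ i : Fin n → Fin (Module.finrank ℂ V),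
      (∏ k, starRingEnd ℂ ⟪e' (i k), y k⟫_ℂ) *
        φ fun k => G.incl τ (InnerProductSpace.toDual ℂ (H τ) (e' (i k))) := by
    simp only [hexp]
    rw [φ.map_sum]
    refine Finset.sum_congr rfl fun i _ => ?_
    rw [φ.map_smul_univ, smul_eq_mul]
  have hb' : ∑ i : Fin n → Fin (Module.finrank ℂ V),
      ‖φ fun k => G.incl τ (InnerProductSpace.toDual ℂ (H τ) (e' (i k)))‖ ^ 2 ≤ C.toReal := by
    have h1 := ENNReal.toReal_mono hC.ne (hb _ e' he')
    rw [ENNReal.toReal_sum fun i _ => by finiteness] at h1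
    simpa using h1
  rw [hφ, ← Finset.prod_congr rfl fun k _ => Real.sqrt_sq (norm_nonneg (x k))]
  refine (norm_sum_le _ _).trans ?_
  simp only [norm_mul, norm_prod]
  refine (Real.sum_mul_le_sqrt_mul_sqrt _ _ _).trans ?_
  rw [mul_comm]
  refine mul_le_mul (Real.sqrt_le_sqrt hb') ?_ (Real.sqrt_nonneg _) (Real.sqrt_nonneg _)
  rw [← Real.sqrt_prod _ fun k _ => by positivity]
  refine Real.sqrt_le_sqrt ?_
  simp only [← Finset.prod_pow]
  rw [← Fintype.piFinset_univ, ← Finset.prod_univ_sum (fun _ => Finset.univ)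
    (fun k i => ‖starRingEnd ℂ ⟪e' i, y k⟫_ℂ‖ ^ 2)]
  exact Finset.prod_le_prod (fun k _ => Finset.sum_nonneg fun _ _ => by positivity)
    fun k _ => hsum k

theorem exists_formBound {n : ℕ} (φ : G.SymTest n) (τ : T) :
    ∃ K, 0 ≤ K ∧ G.FormBound τ φ.1 K :=
  G.exists_formBound_of_hsNorm_lt_top (φ.2.2 τ)

/-- Since the inclusions are Hilbert-Schmidt, `Φ^{⊙n}` consists of all symmetric forms that are
bounded on every `H_{-τ}`. -/
theorem mem_symTest {n : ℕ} {φ : MultilinearMap ℂ (fun _ : Fin n => G.Dual) ℂ}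
    (hsymm : ∀ (π : Equiv.Perm (Fin n)) (w : Fin n → G.Dual), φ (fun i => w (π i)) = φ w)
    (hb : ∀ τ, ∃ K, 0 ≤ K ∧ G.FormBound τ φ K) : φ ∈ G.SymTest n := by
  refine ⟨hsymm, fun τ => ?_⟩
  obtain ⟨σ, j, hj, hs⟩ := G.hilbertSchmidt τ
  obtain ⟨κ, -, hκ⟩ := G.exists_hsNorm_le hj hs
  obtain ⟨K, hK, hφ⟩ := hb σ
  exact (hκ n φ K hK hφ).trans_lt ENNReal.ofReal_lt_top

/-- The norm of `H_{-τ}^{⊙n}` controls functionals in terms of bounds of forms on `H_{-σ}`, if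
`H_σ ⊆ H_τ` is Hilbert-Schmidt. -/
theorem exists_norm_le_of_negNorm_le (τ : T) :
    ∃ (σ : T) (κ : ℝ), 1 ≤ κ ∧ ∀ (n : ℕ) (Ψ : Module.Dual ℂ (G.SymTest n)) (B : ℝ), 0 ≤ B →
      G.negNorm τ Ψ ≤ ENNReal.ofReal B → ∀ (φ : G.SymTest n) (K : ℝ), 0 ≤ K →
        G.FormBound σ φ.1 K → ‖Ψ φ‖ ≤ B * κ ^ n * K := by
  obtain ⟨σ, j, hj, hs⟩ := G.hilbertSchmidt τ
  obtain ⟨κ, hκ1, hκ⟩ := G.exists_hsNorm_le hj hs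
  refine ⟨σ, κ, hκ1, fun n Ψ B hB hΨ φ K hK hφ => ?_⟩
  have hκ0 : 0 < κ ^ n := by positivity
  -- The bound `K` may be `0`, so the form is normalized by a positive `K' ≥ K` instead.
  have key : ∀ K' > 0, K ≤ K' → ‖Ψ φ‖ ≤ B * κ ^ n * K' := by
    intro K' hK' hle
    let c : ℂ := ((κ ^ n * K' : ℝ) : ℂ)⁻¹
    have hc : ‖c‖ = (κ ^ n * K')⁻¹ := by
      rw [norm_inv, Complex.norm_real, Real.norm_of_nonneg (by positivity)]
    have h1 : G.hsNorm τ (c • φ).1 ≤ 1 := by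
      refine (hκ n _ (‖c‖ * K') (by positivity) ((hφ.mono hle).smul c)).trans_eq ?_
      rw [hc, show κ ^ n * ((κ ^ n * K')⁻¹ * K') = 1 by field_simp, ENNReal.ofReal_one]
    have h2 : ‖Ψ (c • φ)‖ₑ ≤ ENNReal.ofReal B := le_trans
      (le_iSup₂ (f := fun (φ : G.SymTest n) (_ : G.hsNorm τ φ.1 ≤ 1) => ‖Ψ φ‖ₑ) (c • φ) h1) hΨ
    rw [← ofReal_norm, ENNReal.ofReal_le_ofReal_iff hB, map_smul, norm_smul, hc,
      inv_mul_le_iff₀ (by positivity)] at h2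
    exact h2.trans_eq (by ring)
  rcases hK.eq_or_lt with rfl | hK
  · refine le_of_forall_pos_le_add fun ε hε => ?_
    have h := key (ε / (B * κ ^ n + 1)) (by positivity) (by positivity)
    rw [mul_zero, zero_add]
    refine h.trans ?_
    rw [mul_div_assoc', div_le_iff₀ (by positivity)]
    nlinarith
  · exact key K hK le_rfl

end HilbertSchmidt

end GelfandTriple

end

/-! ### Totality of tensor powers -/

noncomputable section

universe u v

namespace GelfandTriple

variable {T : Type u} {H : T → Type v} [∀ τ, NormedAddCommGroup (H τ)]
  [∀ τ, InnerProductSpace ℂ (H τ)] (G : GelfandTriple H)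

theorem incl_apply (τ : T) (x : StrongDual ℂ (H τ)) (ξ : G.Test) :
    (G.incl τ x).1 ξ = x (G.toH τ ξ) := rfl

/-- The `n`-linear form `(ω₁, …, ωₙ) ↦ ∏ ⟨ωᵢ, ξᵢ⟩`. -/
def tensorForm {n : ℕ} (ξ : Fin n → G.Test) : MultilinearMap ℂ (fun _ : Fin n => G.Dual) ℂ :=
  (MultilinearMap.mkPiAlgebra ℂ (Fin n) ℂ).compLinearMap
    fun k => (Module.Dual.eval ℂ G.Test (ξ k)) ∘ₗ G.Dual.subtype

theorem tensorForm_apply {n : ℕ} (ξ : Fin n → G.Test) (w : Fin n → G.Dual) :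
    G.tensorForm ξ w = ∏ k, (w k).1 (ξ k) := by
  simp [tensorForm]

/-- The sum of `ξ_{π(1)} ⊗ ⋯ ⊗ ξ_{π(n)}` over all permutations `π`, as a form on `Φ'`. -/
def symForm {n : ℕ} (ξ : Fin n → G.Test) : MultilinearMap ℂ (fun _ : Fin n => G.Dual) ℂ :=
  ∑ π : Equiv.Perm (Fin n), (G.tensorForm ξ).domDomCongr π

theorem symForm_apply {n : ℕ} (ξ : Fin n → G.Test) (w : Fin n → G.Dual) :
    G.symForm ξ w = ∑ π : Equiv.Perm (Fin n), ∏ k, (w (π k)).1 (ξ k) := by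
  simp [symForm, tensorForm_apply]

theorem symForm_perm {n : ℕ} (ξ : Fin n → G.Test) (π : Equiv.Perm (Fin n)) (w : Fin n → G.Dual) :
    G.symForm ξ (fun i => w (π i)) = G.symForm ξ w := by
  rw [symForm_apply, symForm_apply]
  exact Fintype.sum_equiv (Equiv.mulLeft π) _ _ fun _ => rfl

theorem exists_formBound_symForm {n : ℕ} (ξ : Fin n → G.Test) (τ : T) :
    ∃ K, 0 ≤ K ∧ G.FormBound τ (G.symForm ξ) K := by
  refine ⟨∑ _π : Equiv.Perm (Fin n), ∏ k, ‖G.toH τ (ξ k)‖,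
    Finset.sum_nonneg fun _ _ => Finset.prod_nonneg fun _ _ => norm_nonneg _, fun x => ?_⟩
  rw [symForm_apply, Finset.sum_mul]
  refine norm_sum_le_of_le _ fun π _ => ?_
  rw [norm_prod, ← Equiv.prod_comp π fun i => ‖x i‖, ← Finset.prod_mul_distrib]
  refine Finset.prod_le_prod (fun _ _ => norm_nonneg _) fun k _ => ?_
  rw [incl_apply, mul_comm]
  exact (x (π k)).le_opNorm _

section Complete

variable [∀ τ, CompleteSpace (H τ)]

/-- The symmetrized tensor product `∑_π ξ_{π(1)} ⊗ ⋯ ⊗ ξ_{π(n)} ∈ Φ^{⊙n}` as a multilinear function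
of `ξ₁, …, ξₙ ∈ Φ`. -/
def symProd (n : ℕ) : MultilinearMap ℂ (fun _ : Fin n => G.Test) (G.SymTest n) where
  toFun ξ := ⟨G.symForm ξ, G.mem_symTest (G.symForm_perm ξ) (G.exists_formBound_symForm ξ)⟩
  map_update_add' := by
    intro inst ξ i a b
    apply Subtype.ext
    ext w
    change G.symForm _ w = G.symForm _ w + G.symForm _ w
    simp only [symForm_apply, ← Finset.sum_add_distrib]
    refine Finset.sum_congr rfl fun π _ => ?_
    exact ((MultilinearMap.mkPiAlgebra ℂ (Fin n) ℂ).compLinearMap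
      fun k => (w (π k)).1).map_update_add ξ i a b
  map_update_smul' := by
    intro inst ξ i c a
    apply Subtype.ext
    ext w
    change G.symForm _ w = c • G.symForm _ w
    simp only [symForm_apply, Finset.smul_sum]
    refine Finset.sum_congr rfl fun π _ => ?_
    exact ((MultilinearMap.mkPiAlgebra ℂ (Fin n) ℂ).compLinearMap
      fun k => (w (π k)).1).map_update_smul ξ i c a

theorem symProd_apply {n : ℕ} (ξ : Fin n → G.Test) (w : Fin n → G.Dual) :
    (G.symProd n ξ).1 w = ∑ π : Equiv.Perm (Fin n), ∏ k, (w (π k)).1 (ξ k) :=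
  G.symForm_apply ξ w

theorem testPow_apply {n : ℕ} (ξ : G.Test) (w : Fin n → G.Dual) :
    (G.testPow n ξ).1 w = ∏ k, (w k).1 ξ := by
  simp [testPow]

theorem symProd_perm {n : ℕ} (ξ : Fin n → G.Test) (π : Equiv.Perm (Fin n)) :
    G.symProd n (fun i => ξ (π i)) = G.symProd n ξ := by
  apply Subtype.ext
  ext w
  rw [symProd_apply, symProd_apply]
  refine Fintype.sum_equiv (Equiv.mulRight π⁻¹) _ _ fun π' => ?_
  rw [← Equiv.prod_comp π fun k => (w ((Equiv.mulRight π⁻¹ π') k)).1 (ξ k)]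
  refine Finset.prod_congr rfl fun k _ => ?_
  change _ = (w (π' (π⁻¹ (π k)))).1 (ξ (π k))
  rw [show π⁻¹ (π k) = k from π.symm_apply_apply k]

theorem symProd_const {n : ℕ} (ξ : G.Test) :
    G.symProd n (fun _ => ξ) = (n.factorial : ℂ) • G.testPow n ξ := by
  apply Subtype.ext
  ext w
  change (G.symProd n fun _ => ξ).1 w = (n.factorial : ℂ) * (G.testPow n ξ).1 w
  rw [symProd_apply, testPow_apply,
    Finset.sum_congr rfl fun π _ => Equiv.prod_comp π fun k => (w k).1 ξ]
  simp [Fintype.card_perm]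

/-- A functional on `Φ^{⊙n}` vanishing on tensor powers vanishes on symmetrized tensor products. -/
theorem apply_symProd_eq_zero {n : ℕ} (Ψ : G.SymTest n →ₗ[ℂ] ℂ)
    (h0 : ∀ ξ, Ψ (G.testPow n ξ) = 0) (ξ : Fin n → G.Test) : Ψ (G.symProd n ξ) = 0 := by
  have h := polarization_zero (Ψ.compMultilinearMap (G.symProd n))
    (fun π w => by simp [symProd_perm]) (fun w => by simp [symProd_const, h0])
  exact MultilinearMap.congr_fun h ξ

/-- A Hilbert-Schmidt inclusion is approximated in norm by finite rank operators with range in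
`Φ`. -/
theorem exists_finite_rank_approx {σ τ : T} {j : H σ →L[ℂ] H τ} (hs : IsHilbertSchmidt j)
    {ε : ℝ} (hε : 0 < ε) :
    ∃ (w : Set (H σ)) (F : Finset w) (a : w → StrongDual ℂ (H σ)) (ξ : w → G.Test),
      ∀ x : StrongDual ℂ (H τ), ‖x ∘L j - ∑ i ∈ F, x (G.toH τ (ξ i)) • a i‖ ≤ ε * ‖x‖ := by
  classical
  obtain ⟨w, b, hsum⟩ := hs
  obtain ⟨F, hF⟩ : ∃ F : Finset w, (∑' i, ‖j (b i)‖ ^ 2) - ∑ i ∈ F, ‖j (b i)‖ ^ 2 ≤ (ε / 2) ^ 2 := by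
    have h1 : (∑' i, ‖j (b i)‖ ^ 2) - (ε / 2) ^ 2 < ∑' i, ‖j (b i)‖ ^ 2 := by
      have : 0 < (ε / 2) ^ 2 := by positivity
      linarith
    obtain ⟨F, hF⟩ := (hsum.hasSum.eventually (lt_mem_nhds h1)).exists
    exact ⟨F, by linarith⟩
  let η : ℝ := ε / 2 / (F.card + 1)
  have hη : 0 < η := by positivity
  choose ξ hξ using fun i => (G.denseRange_toH τ).exists_dist_lt (j (b i)) hη
  refine ⟨w, F, fun i => InnerProductSpace.toDual ℂ (H σ) (b i), ξ, fun x => ?_⟩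
  -- The truncation error is estimated by Parseval's identity.
  have hA : ‖x ∘L j - ∑ i ∈ F, x (j (b i)) • InnerProductSpace.toDual ℂ (H σ) (b i)‖ ≤
      ε / 2 * ‖x‖ := by
    set D := x ∘L j - ∑ i ∈ F, x (j (b i)) • InnerProductSpace.toDual ℂ (H σ) (b i) with hD
    have hDb : ∀ l, ‖D (b l)‖ ^ 2 ≤
        ‖x‖ ^ 2 * (‖j (b l)‖ ^ 2 - if l ∈ F then ‖j (b l)‖ ^ 2 else 0) := by
      intro l
      have h1 : D (b l) = x (j (b l)) - if l ∈ F then x (j (b l)) else 0 := by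
        simp only [hD, _root_.sub_apply, ContinuousLinearMap.comp_apply,
          _root_.sum_apply, _root_.smul_apply, InnerProductSpace.toDual_apply_apply,
          orthonormal_iff_ite.1 b.orthonormal, smul_eq_mul,
          mul_ite, mul_one, mul_zero, Finset.sum_ite_eq']
      rw [h1]
      split_ifs
      · simp
      · rw [sub_zero, sub_zero, ← mul_pow]
        exact pow_le_pow_left₀ (norm_nonneg _) (x.le_opNorm _) 2
    have h2 : HasSum (fun l => if l ∈ F then ‖j (b l)‖ ^ 2 else 0) (∑ i ∈ F, ‖j (b i)‖ ^ 2) := by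
      have h := hasSum_sum_of_ne_finset_zero (L := SummationFilter.unconditional w) (s := F)
        (f := fun l => if l ∈ F then ‖j (b l)‖ ^ 2 else 0) (fun l hl => by simp [hl])
      rwa [Finset.sum_congr rfl fun l (hl : l ∈ F) => if_pos hl] at h
    have h3 := hasSum_le hDb (hasSum_norm_sq_strongDual b D)
      ((hsum.hasSum.sub h2).mul_left (‖x‖ ^ 2))
    refine le_of_sq_le_sq ?_ (by positivity)
    refine h3.trans ?_
    rw [mul_pow, mul_comm]
    exact mul_le_mul_of_nonneg_right hF (by positivity)
  have hB : ‖∑ i ∈ F, (x (j (b i)) - x (G.toH τ (ξ i))) •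
      InnerProductSpace.toDual ℂ (H σ) (b i)‖ ≤ ε / 2 * ‖x‖ := by
    have h1 : ∀ i ∈ F, ‖(x (j (b i)) - x (G.toH τ (ξ i))) •
        InnerProductSpace.toDual ℂ (H σ) (b i)‖ ≤ η * ‖x‖ := by
      intro i _
      rw [norm_smul, LinearIsometryEquiv.norm_map, b.orthonormal.norm_eq_one, mul_one, ← map_sub,
        mul_comm]
      refine (x.le_opNorm _).trans (mul_le_mul_of_nonneg_left ?_ (norm_nonneg _))
      rw [← dist_eq_norm]
      exact (hξ i).le
    refine (norm_sum_le_of_le _ h1).trans ?_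
    rw [Finset.sum_const, nsmul_eq_mul, ← mul_assoc]
    refine mul_le_mul_of_nonneg_right ?_ (norm_nonneg _)
    simp only [η]
    rw [mul_div_assoc', div_le_iff₀ (by positivity)]
    nlinarith
  have hsplit : x ∘L j - ∑ i ∈ F, x (G.toH τ (ξ i)) • InnerProductSpace.toDual ℂ (H σ) (b i) =
      (x ∘L j - ∑ i ∈ F, x (j (b i)) • InnerProductSpace.toDual ℂ (H σ) (b i)) +
      ∑ i ∈ F, (x (j (b i)) - x (G.toH τ (ξ i))) • InnerProductSpace.toDual ℂ (H σ) (b i) := by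
    have h : ∀ i, (x (j (b i)) - x (G.toH τ (ξ i))) • InnerProductSpace.toDual ℂ (H σ) (b i) =
        x (j (b i)) • InnerProductSpace.toDual ℂ (H σ) (b i) -
          x (G.toH τ (ξ i)) • InnerProductSpace.toDual ℂ (H σ) (b i) := fun i =>
      ContinuousLinearMap.ext fun y => sub_mul (x (j (b i))) _ _
    rw [Finset.sum_congr rfl fun i _ => h i, Finset.sum_sub_distrib]
    abel
  rw [hsplit]
  refine (norm_add_le _ _).trans ((add_le_add hA hB).trans_eq (by ring))

/-- The composition of `φ ∈ Φ^{⊙n}` with a finite rank operator `ω ↦ ∑ ⟨ω, ξᵢ⟩ aᵢ` is a linear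
combination of symmetrized tensor products. -/
theorem sum_smul_symProd_apply {n : ℕ} (φ : G.SymTest n) {ι : Type*} (F : Finset ι)
    (a : ι → G.Dual) (ξ : ι → G.Test) (w : Fin n → G.Dual) :
    (∑ r ∈ Fintype.piFinset fun _ : Fin n => F,
      φ.1 (fun k => a (r k)) • G.symProd n (fun k => ξ (r k))).1 w =
    (n.factorial : ℂ) * φ.1 fun k => ∑ i ∈ F, (w k).1 (ξ i) • a i := by
  have h1 : ∀ π : Equiv.Perm (Fin n), (φ.1 fun k => ∑ i ∈ F, (w k).1 (ξ i) • a i) =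
      ∑ r ∈ Fintype.piFinset fun _ : Fin n => F,
        φ.1 (fun k => a (r k)) * ∏ k, (w (π k)).1 (ξ (r k)) := by
    intro π
    rw [← φ.2.1 π, φ.1.map_sum_finset]
    refine Finset.sum_congr rfl fun r _ => ?_
    rw [φ.1.map_smul_univ, smul_eq_mul, mul_comm]
  have h2 : (n.factorial : ℂ) * (φ.1 fun k => ∑ i ∈ F, (w k).1 (ξ i) • a i) =
      ∑ _π : Equiv.Perm (Fin n), φ.1 fun k => ∑ i ∈ F, (w k).1 (ξ i) • a i := by
    simp [Fintype.card_perm]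
  rw [h2, Finset.sum_congr rfl fun π _ => h1 π, Finset.sum_comm, Submodule.coe_sum,
    _root_.sum_apply]
  refine Finset.sum_congr rfl fun r _ => ?_
  rw [← Finset.mul_sum, ← symProd_apply]
  rfl

/-- The tensor powers `ξ^{⊗n}` are total in `Φ^{⊙n}`: a functional on `Φ^{⊙n}` that is bounded with
respect to the forms on some `H_{-τ}` is determined by its values on tensor powers. -/
theorem eq_zero_of_testPow {n : ℕ} (Ψ : G.SymTest n →ₗ[ℂ] ℂ) {τ : T} {C : ℝ}
    (hΨ : ∀ (φ : G.SymTest n) (K : ℝ), 0 ≤ K → G.FormBound τ φ.1 K → ‖Ψ φ‖ ≤ C * K)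
    (h0 : ∀ ξ, Ψ (G.testPow n ξ) = 0) : Ψ = 0 := by
  ext φ
  obtain ⟨σ, j, hj, hs⟩ := G.hilbertSchmidt τ
  obtain ⟨K, hK, hφ⟩ := G.exists_formBound φ σ
  set B : ℝ := ‖j‖ + 1 with hB
  have key : ∀ ε, 0 < ε → ε ≤ 1 → ‖Ψ φ‖ ≤ C * (K * (n * (ε * B ^ n))) := by
    intro ε hε hε1
    obtain ⟨w, F, a, ξ, happ⟩ := G.exists_finite_rank_approx hs hε
    let ψ : G.SymTest n := ((n.factorial : ℂ))⁻¹ • ∑ r ∈ Fintype.piFinset fun _ : Fin n => F,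
      φ.1 (fun k => G.incl σ (a (r k))) • G.symProd n (fun k => ξ (r k))
    have hψ0 : Ψ ψ = 0 := by
      simp [ψ, G.apply_symProd_eq_zero Ψ h0]
    have hψ : ∀ v, ψ.1 v = φ.1 fun k => ∑ i ∈ F, (v k).1 (ξ i) • G.incl σ (a i) := by
      intro v
      change ((n.factorial : ℂ))⁻¹ * (∑ r ∈ Fintype.piFinset fun _ : Fin n => F,
        φ.1 (fun k => G.incl σ (a (r k))) • G.symProd n (fun k => ξ (r k))).1 v = _
      rw [G.sum_smul_symProd_apply φ F (fun i => G.incl σ (a i)) ξ v,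
        inv_mul_cancel_left₀ (by exact_mod_cast n.factorial_ne_zero)]
    have hb : G.FormBound τ (φ - ψ).1 (K * (n * (ε * B ^ n))) := by
      intro x
      let m₁ : Fin n → StrongDual ℂ (H σ) := fun k => x k ∘L j
      let m₂ : Fin n → StrongDual ℂ (H σ) := fun k => ∑ i ∈ F, x k (G.toH τ (ξ i)) • a i
      have h1 : ((φ - ψ).1 fun k => G.incl τ (x k)) =
          (φ.1.compLinearMap fun _ => G.incl σ) m₁ - (φ.1.compLinearMap fun _ => G.incl σ) m₂ := by
        change (φ.1 fun k => G.incl τ (x k)) - ψ.1 (fun k => G.incl τ (x k)) = _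
        rw [hψ]
        simp only [MultilinearMap.compLinearMap_apply, m₁, m₂, IsInclusion.incl_comp hj, map_sum,
          map_smul, incl_apply]
      have hsub : ∀ k, ‖m₁ k - m₂ k‖ ≤ ε * ‖x k‖ := fun k => happ (x k)
      have hm₁ : ∀ k, ‖m₁ k‖ ≤ ‖j‖ * ‖x k‖ := fun k =>
        (ContinuousLinearMap.opNorm_comp_le _ _).trans_eq (mul_comm _ _)
      have hm₂ : ∀ k, ‖m₂ k‖ ≤ B * ‖x k‖ := fun k => by
        have h2 : ‖m₂ k‖ ≤ ‖m₁ k‖ + ‖m₁ k - m₂ k‖ := by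
          rw [norm_sub_rev]
          simpa using norm_add_le (m₁ k) (m₂ k - m₁ k)
        nlinarith [hsub k, hm₁ k, norm_nonneg (x k)]
      rw [h1]
      refine ((φ.1.compLinearMap fun _ => G.incl σ).norm_image_sub_le_of_bound' hK hφ m₁ m₂).trans ?_
      rw [mul_assoc]
      refine mul_le_mul_of_nonneg_left ?_ hK
      have h3 : ∀ i : Fin n, (∏ k, if k = i then ‖m₁ i - m₂ i‖ else max ‖m₁ k‖ ‖m₂ k‖) ≤
          ε * B ^ n * ∏ k, ‖x k‖ := by
        intro i
        have h4 : (∏ k : Fin n, (if k = i then ε else 1) * (B * ‖x k‖)) =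
            ε * B ^ n * ∏ k, ‖x k‖ := by
          rw [Finset.prod_mul_distrib, Finset.prod_ite_eq', Finset.prod_mul_distrib]
          simp [mul_assoc]
        rw [← h4]
        refine Finset.prod_le_prod (fun k _ => by split_ifs <;> positivity) fun k _ => ?_
        split_ifs with hk
        · subst hk
          refine (hsub k).trans (mul_le_mul_of_nonneg_left ?_ hε.le)
          nlinarith [norm_nonneg (x k), norm_nonneg j]
        · rw [one_mul]
          refine max_le ((hm₁ k).trans ?_) (hm₂ k)
          nlinarith [norm_nonneg (x k), norm_nonneg j]
      refine (Finset.sum_le_sum fun i _ => h3 i).trans_eq ?_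
      simp [mul_assoc]
    have h5 := hΨ (φ - ψ) _ (by positivity) hb
    rwa [map_sub, hψ0, sub_zero] at h5
  have hlim : Filter.Tendsto (fun ε : ℝ => C * (K * (n * (ε * B ^ n)))) (nhdsWithin 0 (Set.Ioi 0))
      (nhds 0) := by
    have h : Continuous fun ε : ℝ => C * (K * (n * (ε * B ^ n))) := by fun_prop
    have h' := h.tendsto 0
    simp only [zero_mul, mul_zero] at h'
    exact h'.mono_left nhdsWithin_le_nhds
  have h1 : ‖Ψ φ‖ ≤ 0 := ge_of_tendsto hlim (by
    filter_upwards [Ioc_mem_nhdsGT (zero_lt_one' ℝ)] with ε hε using key ε hε.1 hε.2)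
  exact norm_le_zero_iff.1 h1

end Complete

end GelfandTriple

end

/-! ### Scalar growth estimates -/

section ScalarEstimates

open Real

/-- By `m^m ≤ e^m m!` and `m! ≤ m^m`; the condition `a ≤ β` is used for
`(m!)^{1/β} ≤ (m^m)^{1/a}`. -/
theorem rpow_factorial_mul_pow_le {a β : ℝ} (ha : 0 < a) (haβ : a ≤ β) {m : ℕ} (hm : 1 ≤ m) :
    (m.factorial : ℝ) ^ (1 / β - 1) * (m : ℝ) ^ m ≤ exp 1 ^ m * ((m : ℝ) ^ (1 / a)) ^ m := by
  have hm1 : (1 : ℝ) ≤ m := by exact_mod_cast hm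
  have hm0 : (0 : ℝ) < m := by linarith
  have hf : (0 : ℝ) < m.factorial := by exact_mod_cast m.factorial_pos
  have hβ : 0 < β := ha.trans_le haβ
  have h1 : (m : ℝ) ^ m ≤ exp 1 ^ m * m.factorial := by
    have h := pow_div_factorial_le_exp (m : ℝ) hm0.le m
    rw [div_le_iff₀ hf] at h
    rwa [← exp_nat_mul, mul_one]
  have h2 : (m.factorial : ℝ) ^ (1 / β) ≤ ((m : ℝ) ^ (1 / a)) ^ m := by
    have h3 : (m.factorial : ℝ) ≤ (m : ℝ) ^ m := by exact_mod_cast m.factorial_le_pow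
    have h4 : (1 : ℝ) ≤ (m : ℝ) ^ m := one_le_pow₀ hm1
    calc (m.factorial : ℝ) ^ (1 / β) ≤ ((m : ℝ) ^ m) ^ (1 / β) :=
          rpow_le_rpow hf.le h3 (by positivity)
      _ ≤ ((m : ℝ) ^ m) ^ (1 / a) :=
          rpow_le_rpow_of_exponent_le h4 (one_div_le_one_div_of_le ha haβ)
      _ = ((m : ℝ) ^ (1 / a)) ^ m := by
          rw [← rpow_natCast, ← rpow_natCast, ← rpow_mul hm0.le, ← rpow_mul hm0.le, mul_comm]
  rw [rpow_sub hf, rpow_one, div_mul_eq_mul_div, div_le_iff₀ hf]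
  calc (m.factorial : ℝ) ^ (1 / β) * (m : ℝ) ^ m
      ≤ ((m : ℝ) ^ (1 / a)) ^ m * (exp 1 ^ m * m.factorial) := by gcongr
    _ = exp 1 ^ m * ((m : ℝ) ^ (1 / a)) ^ m * m.factorial := by ring

theorem add_rpow_le_two_rpow_mul {a s t : ℝ} (ha : 0 < a) (hs : 0 ≤ s) (ht : 0 ≤ t) :
    (s + t) ^ a ≤ 2 ^ a * (s ^ a + t ^ a) := by
  have hs' := rpow_nonneg hs a
  have ht' := rpow_nonneg ht a
  have h2 : (0 : ℝ) ≤ 2 ^ a := by positivity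
  rcases le_total s t with h | h
  · calc (s + t) ^ a ≤ (2 * t) ^ a := rpow_le_rpow (by positivity) (by linarith) ha.le
      _ = 2 ^ a * t ^ a := mul_rpow (by norm_num) ht
      _ ≤ 2 ^ a * (s ^ a + t ^ a) := by gcongr; linarith
  · calc (s + t) ^ a ≤ (2 * s) ^ a := rpow_le_rpow (by positivity) (by linarith) ha.le
      _ = 2 ^ a * s ^ a := mul_rpow (by norm_num) hs
      _ ≤ 2 ^ a * (s ^ a + t ^ a) := by gcongr; linarith

/-- The scalar inequality behind the continuity of Sheffer operators. The radius `m ρ` of the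
polydisc in the Cauchy estimate of order `m` has to grow like `m ^ (1 / a)`, and this is where the
condition `a ≤ β` enters. -/
theorem exists_radius_estimate {a β A δ : ℝ} (ha : 0 < a) (haβ : a ≤ β) (hA : 0 < A)
    (hδ : 0 < δ) :
    ∃ ε > 0, ∀ m : ℕ, ∃ ρ > 0, ∀ t ≥ 0,
      A ^ m * (m.factorial : ℝ) ^ (1 / β - 1) * (exp (ε * (t + m * ρ) ^ a) / ρ ^ m) ≤
        (1 / 2) ^ m * exp (δ * t ^ a) := by
  -- The radius is `m ρ = s m ^ (1 / a)`. One factor `e` in `s` absorbs `m ^ m / m!`, the other one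
  -- the growth `exp(ε 2 ^ a s ^ a m) ≤ e ^ m`, and the factor `2` leaves the geometric decay.
  set s := 2 * exp 1 ^ 2 * A with hs
  have hs0 : 0 < s := by positivity
  have h2 : (0 : ℝ) < 2 ^ a := by positivity
  have hsa : 0 < s ^ a := by positivity
  set ε := min (1 / (2 ^ a * s ^ a)) (δ / 2 ^ a) with hε
  have hε0 : 0 < ε := lt_min (by positivity) (by positivity)
  have hε1 : ε * 2 ^ a * s ^ a ≤ 1 := by
    have h := min_le_left (1 / (2 ^ a * s ^ a)) (δ / 2 ^ a)
    rw [← hε, le_div_iff₀ (by positivity)] at h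
    linarith
  have hε2 : ε * 2 ^ a ≤ δ := by
    have h := min_le_right (1 / (2 ^ a * s ^ a)) (δ / 2 ^ a)
    rwa [← hε, le_div_iff₀ (by positivity)] at h
  refine ⟨ε, hε0, fun m => ?_⟩
  rcases Nat.eq_zero_or_pos m with rfl | hm
  · refine ⟨1, one_pos, fun t ht => ?_⟩
    simp only [pow_zero, Nat.factorial_zero, Nat.cast_one, one_rpow, Nat.cast_zero, zero_mul,
      add_zero, div_one, one_mul]
    refine exp_le_exp.2 (mul_le_mul_of_nonneg_right ?_ (rpow_nonneg ht a))
    nlinarith [one_le_rpow (one_le_two : (1 : ℝ) ≤ 2) ha.le]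
  · have hm0 : (0 : ℝ) < m := by exact_mod_cast hm
    refine ⟨s * (m : ℝ) ^ (1 / a) / m, by positivity, fun t ht => ?_⟩
    have hr : (m : ℝ) * (s * (m : ℝ) ^ (1 / a) / m) = s * (m : ℝ) ^ (1 / a) := by field_simp
    have hra : (s * (m : ℝ) ^ (1 / a)) ^ a = s ^ a * m := by
      rw [mul_rpow hs0.le (by positivity), ← rpow_mul hm0.le, one_div_mul_cancel ha.ne', rpow_one]
    have hexp : exp (ε * (t + s * (m : ℝ) ^ (1 / a)) ^ a) ≤ exp 1 ^ m * exp (δ * t ^ a) := by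
      rw [← exp_nat_mul, mul_one, ← exp_add]
      refine exp_le_exp.2 ?_
      have h3 := add_rpow_le_two_rpow_mul ha ht (by positivity : 0 ≤ s * (m : ℝ) ^ (1 / a))
      rw [hra] at h3
      calc ε * (t + s * (m : ℝ) ^ (1 / a)) ^ a ≤ ε * (2 ^ a * (t ^ a + s ^ a * m)) := by gcongr
        _ = (ε * 2 ^ a * s ^ a) * m + (ε * 2 ^ a) * t ^ a := by ring
        _ ≤ 1 * m + δ * t ^ a := by
            have := rpow_nonneg ht a
            gcongr
        _ = m + δ * t ^ a := by rw [one_mul]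
    have hfac := rpow_factorial_mul_pow_le ha haβ hm
    rw [hr, mul_div_assoc', div_le_iff₀ (by positivity)]
    have h5 : (1 / 2 : ℝ) ^ m * exp (δ * t ^ a) * (s * (m : ℝ) ^ (1 / a) / m) ^ m =
        A ^ m * (exp 1 ^ m * ((m : ℝ) ^ (1 / a)) ^ m) / (m : ℝ) ^ m *
          (exp 1 ^ m * exp (δ * t ^ a)) := by
      have : (1 / 2 : ℝ) ^ m * s ^ m = (exp 1 ^ m) ^ 2 * A ^ m := by
        rw [← mul_pow, ← pow_mul, mul_comm m 2, pow_mul, ← mul_pow]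
        congr 1
        rw [hs]; ring
      rw [div_pow _ (m : ℝ), mul_pow]
      linear_combination (exp (δ * t ^ a) * ((m : ℝ) ^ (1 / a)) ^ m / (m : ℝ) ^ m) * this
    rw [h5]
    refine mul_le_mul ?_ hexp (exp_nonneg _) (by positivity)
    rw [le_div_iff₀ (by positivity), mul_assoc]
    exact mul_le_mul_of_nonneg_left hfac (by positivity)

/-- Powers are of order zero. -/
theorem exists_pow_le_mul_exp {a ε : ℝ} (ha : 0 < a) (hε : 0 < ε) (n : ℕ) :
    ∃ C, 0 ≤ C ∧ ∀ t ≥ 0, t ^ n ≤ C * exp (ε * t ^ a) := by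
  obtain ⟨k, hk⟩ := exists_nat_ge (n / a)
  rw [div_le_iff₀ ha] at hk
  refine ⟨max 1 (k.factorial / ε ^ k), by positivity, fun t ht => ?_⟩
  have hta : 0 ≤ t ^ a := rpow_nonneg ht a
  rcases le_total t 1 with h | h
  · calc t ^ n ≤ 1 := pow_le_one₀ ht h
      _ ≤ 1 * exp (ε * t ^ a) := by rw [one_mul]; exact one_le_exp (by positivity)
      _ ≤ _ := mul_le_mul_of_nonneg_right (le_max_left _ _) (exp_nonneg _)
  · have hf : (0 : ℝ) < k.factorial := by exact_mod_cast k.factorial_pos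
    have h1 := pow_div_factorial_le_exp (ε * t ^ a) (by positivity) k
    calc t ^ n = t ^ (n : ℝ) := (rpow_natCast _ _).symm
      _ ≤ t ^ (k * a) := rpow_le_rpow_of_exponent_le h hk
      _ = (t ^ a) ^ k := by rw [mul_comm, rpow_mul ht, rpow_natCast]
      _ = k.factorial / ε ^ k * ((ε * t ^ a) ^ k / k.factorial) := by
          rw [mul_pow]; field_simp
      _ ≤ k.factorial / ε ^ k * exp (ε * t ^ a) := by gcongr
      _ ≤ _ := mul_le_mul_of_nonneg_right (le_max_right _ _) (exp_nonneg _)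

theorem rpow_le_one_add_rpow {a b t : ℝ} (ha : 0 ≤ a) (hab : a ≤ b) (ht : 0 ≤ t) :
    t ^ a ≤ 1 + t ^ b := by
  have hb : 0 ≤ t ^ b := rpow_nonneg ht b
  rcases le_total t 1 with h | h
  · linarith [rpow_le_one ht h ha]
  · linarith [rpow_le_rpow_of_exponent_le h hab]

theorem exists_inv_two_pow_le {ε : ℝ} (hε : 0 < ε) : ∃ l : ℕ, ((2 : ℝ) ^ l)⁻¹ ≤ ε := by
  obtain ⟨l, hl⟩ := exists_pow_lt_of_lt_one hε (by norm_num : (1 / 2 : ℝ) < 1)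
  exact ⟨l, by rw [← inv_pow, ← one_div]; exact hl.le⟩

end ScalarEstimates

/-! ### Differential operators of infinite order -/

noncomputable section

universe u v

namespace GelfandTriple

variable {T : Type u} {H : T → Type v} [∀ τ, NormedAddCommGroup (H τ)]
  [∀ τ, InnerProductSpace ℂ (H τ)] (G : GelfandTriple H)

/-- A function on `Φ'` is entire if its restriction to every `H_{-τ}` is holomorphic. -/
def IsEntire (f : G.Dual → ℂ) : Prop :=
  ∀ τ, Differentiable ℂ fun x : StrongDual ℂ (H τ) => f (G.incl τ x)

/-- The bound `|f(ω)| ≤ N exp(2^{-l} ‖ω‖_{-τ}^a)` on `H_{-τ}`. -/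
def GrowthBound (a : ℝ) (τ : T) (l : ℕ) (f : G.Dual → ℂ) (N : ℝ) : Prop :=
  ∀ x : StrongDual ℂ (H τ), ‖f (G.incl τ x)‖ ≤ N * Real.exp (((2 : ℝ) ^ l)⁻¹ * ‖x‖ ^ a)

variable {G}

theorem growth_le_iff {a : ℝ} {τ : T} {l : ℕ} {f : G.Dual → ℂ} {N : ℝ}
    {x : StrongDual ℂ (H τ)} : G.growth a τ l f x ≤ N ↔
      ‖f (G.incl τ x)‖ ≤ N * Real.exp (((2 : ℝ) ^ l)⁻¹ * ‖x‖ ^ a) := by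
  rw [growth, Real.exp_neg, ← div_eq_mul_inv, div_le_iff₀ (Real.exp_pos _)]

theorem GrowthBound.bddAbove {a : ℝ} {τ : T} {l : ℕ} {f : G.Dual → ℂ} {N : ℝ}
    (h : G.GrowthBound a τ l f N) : BddAbove (Set.range (G.growth a τ l f)) := by
  refine ⟨N, ?_⟩
  rintro _ ⟨x, rfl⟩
  exact growth_le_iff.2 (h x)

theorem GrowthBound.growthNorm_le {a : ℝ} {τ : T} {l : ℕ} {f : G.Dual → ℂ} {N : ℝ}
    (h : G.GrowthBound a τ l f N) : G.growthNorm a τ l f ≤ N :=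
  ciSup_le fun x => growth_le_iff.2 (h x)

theorem growthBound_growthNorm {a : ℝ} {τ : T} {l : ℕ} {f : G.Dual → ℂ}
    (h : BddAbove (Set.range (G.growth a τ l f))) :
    G.GrowthBound a τ l f (G.growthNorm a τ l f) := fun x =>
  growth_le_iff.1 (le_ciSup h x)

theorem GrowthBound.nonneg {a : ℝ} {τ : T} {l : ℕ} {f : G.Dual → ℂ} {N : ℝ}
    (h : G.GrowthBound a τ l f N) : 0 ≤ N :=
  nonneg_of_mul_nonneg_left ((norm_nonneg _).trans (h 0)) (Real.exp_pos _)

/-- A bound of order `b` implies a bound of any larger order `a`. -/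
theorem GrowthBound.of_le {a b : ℝ} (hb : 0 ≤ b) (hba : b ≤ a) {τ : T} {l : ℕ} {f : G.Dual → ℂ}
    {N : ℝ} (h : G.GrowthBound b τ l f N) : G.GrowthBound a τ l f (Real.exp 1 * N) := by
  intro x
  refine (h x).trans ?_
  rw [mul_comm (Real.exp 1), mul_assoc, ← Real.exp_add]
  refine mul_le_mul_of_nonneg_left (Real.exp_le_exp.2 ?_) h.nonneg
  have h1 := rpow_le_one_add_rpow hb hba (norm_nonneg x)
  have h2 : ((2 : ℝ) ^ l)⁻¹ ≤ 1 := inv_le_one_of_one_le₀ (one_le_pow₀ one_le_two)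
  have h3 : (0 : ℝ) ≤ ((2 : ℝ) ^ l)⁻¹ := by positivity
  nlinarith [mul_le_mul_of_nonneg_left h1 h3]

theorem mem_eminPos_iff {a : ℝ} {f : G.Dual → ℂ} : f ∈ G.EminPos a ↔
    G.IsEntire f ∧ ∀ τ l, ∃ N, G.GrowthBound a τ l f N :=
  ⟨fun h => ⟨fun τ => (h τ).1, fun τ l => ⟨_, growthBound_growthNorm ((h τ).2 l)⟩⟩,
    fun h τ => ⟨h.1 τ, fun l => (h.2 τ l).choose_spec.bddAbove⟩⟩

/-- The inclusion `H_{-τ} ⊆ H_{-σ}` as a continuous linear map. -/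
def transpose {σ τ : T} (j : H σ →L[ℂ] H τ) : StrongDual ℂ (H τ) →L[ℂ] StrongDual ℂ (H σ) :=
  (ContinuousLinearMap.compL ℂ (H σ) (H τ) ℂ).flip j

theorem incl_transpose {σ τ : T} {j : H σ →L[ℂ] H τ} (hj : G.IsInclusion j)
    (x : StrongDual ℂ (H τ)) : G.incl σ (transpose j x) = G.incl τ x := hj.incl_comp x

theorem norm_transpose_le {σ τ : T} (j : H σ →L[ℂ] H τ) (x : StrongDual ℂ (H τ)) :
    ‖transpose j x‖ ≤ ‖j‖ * ‖x‖ :=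
  (ContinuousLinearMap.opNorm_comp_le x j).trans_eq (mul_comm _ _)

theorem IsEntire.translate {f : G.Dual → ℂ} (hf : G.IsEntire f) (w : G.Dual) :
    G.IsEntire fun w' => f (w' + w) := by
  intro τ
  obtain ⟨τ', y, rfl⟩ := G.exists_incl w
  obtain ⟨σ, ⟨j, hj⟩, ⟨k, hk⟩⟩ := G.directed τ τ'
  have h : (fun x => f (G.incl τ x + G.incl τ' y)) =
      fun x => f (G.incl σ (transpose j x + transpose k y)) := by
    funext x
    rw [map_add, incl_transpose hj, incl_transpose hk]
  rw [h]
  exact (hf σ).comp ((transpose j).differentiable.add_const _)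

section Complete

variable [∀ τ, CompleteSpace (H τ)]

/-- The derivatives of the restrictions of an entire function to the spaces `H_{-τ}` are compatible
symmetric forms, bounded on every `H_{-τ}`, and hence define an element of `Φ^{⊙m}`. -/
theorem IsEntire.exists_derivative {f : G.Dual → ℂ} (hf : G.IsEntire f) (m : ℕ) (w : G.Dual) :
    ∃ φ : G.SymTest m, ∀ τ x, (φ.1 fun i => G.incl τ (x i)) =
      iteratedFDeriv ℂ m (fun y => f (G.incl τ y + w)) 0 x := by
  have ht := hf.translate w
  obtain ⟨φ, hφ⟩ := G.exists_multilinearMap_of_compatible (n := m)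
    (fun τ => (iteratedFDeriv ℂ m (fun y => f (G.incl τ y + w)) 0).toMultilinearMap) (by
      intro σ τ j hj x
      have h1 : (fun y => f (G.incl τ y + w)) =
          (fun y => f (G.incl σ y + w)) ∘ transpose j := by
        funext y
        rw [Function.comp_apply, incl_transpose hj]
      change iteratedFDeriv ℂ m (fun y => f (G.incl τ y + w)) 0 x = _
      rw [h1, (transpose j).iteratedFDeriv_comp_right
        (contDiff_of_complex_differentiable (ht σ) m) 0 le_rfl, map_zero]
      rfl)
  refine ⟨⟨φ, G.mem_symTest ?_ fun τ =>
    ⟨‖iteratedFDeriv ℂ m (fun y => f (G.incl τ y + w)) 0‖, norm_nonneg _, fun x => ?_⟩⟩, hφ⟩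
  · intro π v
    obtain ⟨τ, x, hx⟩ := G.exists_incl_family v
    obtain rfl : (fun i => G.incl τ (x i)) = v := funext hx
    rw [hφ τ fun i => x (π i), hφ]
    exact iteratedFDeriv_perm_of_complex_differentiable (ht τ) 0 x π
  · rw [hφ]
    exact ContinuousMultilinearMap.le_opNorm _ _

variable (G)

open Classical in
/-- The derivative `D^m f(ω) ∈ Φ^{⊙m}` of order `m` of an entire function `f` on `Φ'`: the
symmetric `m`-linear form on `Φ'` that on each `H_{-τ}` is the derivative of `f(· + ω)` at `0`. The
value is `0` if `f` is not entire. -/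
def derivative (f : G.Dual → ℂ) (m : ℕ) (w : G.Dual) : G.SymTest m :=
  if hf : G.IsEntire f then (hf.exists_derivative m w).choose else 0

variable {G}

theorem IsEntire.derivative_apply {f : G.Dual → ℂ} (hf : G.IsEntire f) (m : ℕ) {τ : T}
    (y : StrongDual ℂ (H τ)) (x : Fin m → StrongDual ℂ (H τ)) :
    ((G.derivative f m (G.incl τ y)).1 fun i => G.incl τ (x i)) =
      iteratedFDeriv ℂ m (fun z => f (G.incl τ z)) y x := by
  rw [derivative, dif_pos hf, (hf.exists_derivative m _).choose_spec τ x]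
  have h := iteratedFDeriv_comp_add_right (𝕜 := ℂ) (f := fun z => f (G.incl τ z)) m y 0
  simp only [map_add, zero_add] at h
  rw [h]

theorem symTest_ext {m : ℕ} {φ ψ : G.SymTest m}
    (h : ∀ τ (x : Fin m → StrongDual ℂ (H τ)),
      (φ.1 fun i => G.incl τ (x i)) = ψ.1 fun i => G.incl τ (x i)) : φ = ψ := by
  apply Subtype.ext
  ext v
  obtain ⟨τ, x, hx⟩ := G.exists_incl_family v
  obtain rfl : (fun i => G.incl τ (x i)) = v := funext hx
  exact h τ x

/-- A form that agrees with the derivatives of `f` near `ω` is `D^m f(ω)`. -/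
theorem IsEntire.derivative_eq {f : G.Dual → ℂ} (hf : G.IsEntire f) {m : ℕ} {w : G.Dual}
    {φ : G.SymTest m} (h : ∀ τ y, G.incl τ y = w → ∀ x, (φ.1 fun i => G.incl τ (x i)) =
      iteratedFDeriv ℂ m (fun z => f (G.incl τ z)) y x) : G.derivative f m w = φ := by
  refine symTest_ext fun τ x => ?_
  obtain ⟨τ', y, rfl⟩ := G.exists_incl w
  obtain ⟨σ, ⟨j, hj⟩, ⟨k, hk⟩⟩ := G.directed τ τ'
  have h1 : ∀ i, G.incl τ (x i) = G.incl σ (transpose j (x i)) := fun i =>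
    (incl_transpose hj (x i)).symm
  rw [← incl_transpose hk y] at h ⊢
  simp only [h1]
  rw [hf.derivative_apply, h σ _ rfl]

theorem IsEntire.derivative_add {f g : G.Dual → ℂ} (hf : G.IsEntire f) (hg : G.IsEntire g) (m : ℕ)
    (w : G.Dual) : G.derivative (f + g) m w = G.derivative f m w + G.derivative g m w := by
  refine IsEntire.derivative_eq (fun τ => (hf τ).add (hg τ)) fun τ y hy x => ?_
  subst hy
  change ((G.derivative f m _).1 fun i => G.incl τ (x i)) +
    ((G.derivative g m _).1 fun i => G.incl τ (x i)) = _
  rw [hf.derivative_apply, hg.derivative_apply]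
  have h := iteratedFDeriv_add_apply
    (contDiff_of_complex_differentiable (hf τ) m).contDiffAt
    (contDiff_of_complex_differentiable (hg τ) m).contDiffAt (x := y)
  exact (congrArg (fun φ => φ x) h).symm

theorem IsEntire.derivative_smul {f : G.Dual → ℂ} (hf : G.IsEntire f) (c : ℂ) (m : ℕ)
    (w : G.Dual) : G.derivative (c • f) m w = c • G.derivative f m w := by
  refine IsEntire.derivative_eq (fun τ => (hf τ).const_smul c) fun τ y hy x => ?_
  subst hy
  change c • ((G.derivative f m _).1 fun i => G.incl τ (x i)) = _
  rw [hf.derivative_apply]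
  have h := iteratedFDeriv_const_smul_apply (a := c)
    (contDiff_of_complex_differentiable (hf τ) m).contDiffAt (x := y)
  exact (congrArg (fun φ => φ x) h).symm

/-- The Cauchy estimate for `D^m f(ω)`. -/
theorem IsEntire.formBound_derivative {f : G.Dual → ℂ} (hf : G.IsEntire f) {a : ℝ} (ha : 0 < a)
    {τ : T} {l : ℕ} {N : ℝ} (hN : G.GrowthBound a τ l f N) (m : ℕ) (y : StrongDual ℂ (H τ))
    {r : ℝ} (hr : 0 < r) :
    G.FormBound τ (G.derivative f m (G.incl τ y)).1
      (N * Real.exp (((2 : ℝ) ^ l)⁻¹ * (‖y‖ + m * r) ^ a) / r ^ m) := by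
  intro x
  rw [hf.derivative_apply]
  refine ContinuousMultilinearMap.le_of_opNorm_le ?_ x
  refine norm_iteratedFDeriv_le_of_forall_mem_closedBall (hf τ) hr m fun z hz => ?_
  refine (hN z).trans (mul_le_mul_of_nonneg_left (Real.exp_le_exp.2 ?_) hN.nonneg)
  refine mul_le_mul_of_nonneg_left (Real.rpow_le_rpow (norm_nonneg _) ?_ ha.le) (by positivity)
  rw [Metric.mem_closedBall, dist_eq_norm] at hz
  have := norm_add_le y (z - y)
  rw [add_sub_cancel] at this
  linarith

variable (G)

/-- A form in `Φ^{⊙m}`, restricted to `H_{-τ}`, as a continuous multilinear map. -/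
def restrictForm (τ : T) (m : ℕ) : G.SymTest m →ₗ[ℂ]
    ContinuousMultilinearMap ℂ (fun _ : Fin m => StrongDual ℂ (H τ)) ℂ where
  toFun φ := (φ.1.compLinearMap fun _ => G.incl τ).mkContinuous
    (G.exists_formBound φ τ).choose (G.exists_formBound φ τ).choose_spec.2
  map_add' _ _ := rfl
  map_smul' _ _ := rfl

theorem restrictForm_apply (τ : T) {m : ℕ} (φ : G.SymTest m) (x : Fin m → StrongDual ℂ (H τ)) :
    G.restrictForm τ m φ x = φ.1 fun i => G.incl τ (x i) := rfl

theorem formBound_norm_restrictForm (τ : T) {m : ℕ} (φ : G.SymTest m) :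
    G.FormBound τ φ.1 ‖G.restrictForm τ m φ‖ := fun x =>
  (G.restrictForm τ m φ).le_opNorm x

/-- Functionals `θ⁽ᵐ⁾` on `Φ^{⊙m}` with the bounds `A^m (m!)^{1/β-1}` relative to the bounded forms
on `H_{-σ}`. -/
def FunctionalBound (β : ℝ) (θ : ∀ m, Module.Dual ℂ (G.SymTest m)) (σ : T) (A : ℝ) : Prop :=
  ∀ (m : ℕ) (φ : G.SymTest m) (K : ℝ), 0 ≤ K → G.FormBound σ φ.1 K →
    ‖θ m φ‖ ≤ A ^ m * (m.factorial : ℝ) ^ (1 / β - 1) * K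

variable {G}

theorem FunctionalBound.of_inclusion {β : ℝ} {θ : ∀ m, Module.Dual ℂ (G.SymTest m)} {σ τ : T}
    {A : ℝ} (hA : 0 ≤ A) (h : G.FunctionalBound β θ τ A) {j : H σ →L[ℂ] H τ}
    (hj : G.IsInclusion j) : G.FunctionalBound β θ σ (A * (‖j‖ + 1)) := by
  intro m φ K hK hφ
  refine (h m φ _ (by positivity) (hφ.of_inclusion hj hK)).trans ?_
  have h1 : ‖j‖ ^ m ≤ (‖j‖ + 1) ^ m := pow_le_pow_left₀ (norm_nonneg _) (by linarith) m
  calc A ^ m * (m.factorial : ℝ) ^ (1 / β - 1) * (‖j‖ ^ m * K)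
      ≤ A ^ m * (m.factorial : ℝ) ^ (1 / β - 1) * ((‖j‖ + 1) ^ m * K) := by gcongr
    _ = _ := by rw [mul_pow]; ring

variable (G)

/-- The differential operator `f ↦ ∑ₘ ⟨θ⁽ᵐ⁾, D^m f⟩` of infinite order. As a `tsum`, it has the
value `0` where the series does not converge. -/
def diffOp (θ : ∀ m, Module.Dual ℂ (G.SymTest m)) (f : G.Dual → ℂ) (w : G.Dual) : ℂ :=
  ∑' m, θ m (G.derivative f m w)

variable {G}

/-- Each term of the operator is holomorphic: the functional is extended from `Φ^{⊙m}` to all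
bounded forms by the Hahn-Banach theorem. -/
theorem FunctionalBound.differentiable_term {β : ℝ} {θ : ∀ m, Module.Dual ℂ (G.SymTest m)} {σ : T}
    {A : ℝ} (h : G.FunctionalBound β θ σ A) {f : G.Dual → ℂ} (hf : G.IsEntire f) (m : ℕ) :
    Differentiable ℂ fun y : StrongDual ℂ (H σ) => θ m (G.derivative f m (G.incl σ y)) := by
  have hb : ∀ φ : G.SymTest m, ‖θ m φ‖ ≤
      A ^ m * (m.factorial : ℝ) ^ (1 / β - 1) * ‖G.restrictForm σ m φ‖ := fun φ =>
    h m φ _ (ContinuousMultilinearMap.opNorm_nonneg _) (G.formBound_norm_restrictForm σ φ)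
  obtain ⟨Θ, hΘ⟩ := exists_strongDual_comp_eq
    (E := ContinuousMultilinearMap ℂ (fun _ : Fin m => StrongDual ℂ (H σ)) ℂ)
    (G.restrictForm σ m) (θ m) _ hb
  have h1 : (fun y : StrongDual ℂ (H σ) => θ m (G.derivative f m (G.incl σ y))) =
      fun y => Θ (iteratedFDeriv ℂ m (fun z => f (G.incl σ z)) y) := by
    funext y
    rw [← hΘ]
    congr 1
    ext x
    rw [restrictForm_apply, hf.derivative_apply]
  rw [h1]
  exact Θ.differentiable.comp (differentiable_iteratedFDeriv_of_complex (hf σ) m)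

/-- On `H_{-τ}`, the terms of `∑ₘ ⟨θ⁽ᵐ⁾, D^m f⟩` decay geometrically, with any
prescribed growth of order `a ≤ β` and minimal type. The space `H_{-σ}` and the index `l'` do not
depend on `f`, as is needed for the continuity of the operator. -/
theorem FunctionalBound.exists_norm_term_le {a β : ℝ} (ha : 0 < a) (haβ : a ≤ β)
    {θ : ∀ m, Module.Dual ℂ (G.SymTest m)} {σ₀ : T} {A : ℝ} (hA : 0 < A)
    (h : G.FunctionalBound β θ σ₀ A) (τ : T) (l : ℕ) :
    ∃ (σ : T) (l' : ℕ), ∀ f : G.Dual → ℂ, G.IsEntire f →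
      (∀ m, Differentiable ℂ fun x : StrongDual ℂ (H τ) => θ m (G.derivative f m (G.incl τ x))) ∧
      ∀ N, G.GrowthBound a σ l' f N → ∀ (m : ℕ) (x : StrongDual ℂ (H τ)),
        ‖θ m (G.derivative f m (G.incl τ x))‖ ≤
          N * Real.exp (((2 : ℝ) ^ l)⁻¹ * ‖x‖ ^ a) * (1 / 2) ^ m := by
  obtain ⟨σ, ⟨j, hj⟩, ⟨k, hk⟩⟩ := G.directed τ σ₀
  have hσ := h.of_inclusion hA.le hk
  set A' := A * (‖k‖ + 1)
  have hA' : 0 < A' := by positivity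
  -- The power of `‖j‖ + 1` compensates for the norm of the inclusion `H_{-τ} ⊆ H_{-σ}`.
  set δ : ℝ := ((2 : ℝ) ^ l)⁻¹ / (‖j‖ + 1) ^ a with hδ
  have hδ0 : 0 < δ := by positivity
  obtain ⟨ε, hε, hest⟩ := exists_radius_estimate ha haβ hA' hδ0
  obtain ⟨l', hl'⟩ := exists_inv_two_pow_le hε
  refine ⟨σ, l', fun f hf => ⟨fun m => ?_, fun N hN m x => ?_⟩⟩
  · have h1 := (hσ.differentiable_term hf m).comp (transpose j).differentiable
    convert! h1 using 1
    funext x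
    rw [Function.comp_apply, incl_transpose hj]
  · obtain ⟨ρ, hρ, hest⟩ := hest m
    set y := transpose j x with hy
    have hyx : G.incl σ y = G.incl τ x := incl_transpose hj x
    have hN0 := hN.nonneg
    have h1 := hσ m _ _ (by positivity) (hf.formBound_derivative ha hN m y hρ)
    rw [hyx] at h1
    have h2 := hest ‖y‖ (norm_nonneg y)
    have h3 : δ * ‖y‖ ^ a ≤ ((2 : ℝ) ^ l)⁻¹ * ‖x‖ ^ a := by
      have h4 : ‖y‖ ≤ (‖j‖ + 1) * ‖x‖ := (norm_transpose_le j x).trans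
        (mul_le_mul_of_nonneg_right (by linarith) (norm_nonneg x))
      calc δ * ‖y‖ ^ a ≤ δ * ((‖j‖ + 1) * ‖x‖) ^ a := by gcongr
        _ = ((2 : ℝ) ^ l)⁻¹ * ‖x‖ ^ a := by
            rw [Real.mul_rpow (by positivity) (norm_nonneg x), hδ]
            field_simp
    calc ‖θ m (G.derivative f m (G.incl τ x))‖
        ≤ A' ^ m * (m.factorial : ℝ) ^ (1 / β - 1) *
          (N * Real.exp (((2 : ℝ) ^ l')⁻¹ * (‖y‖ + m * ρ) ^ a) / ρ ^ m) := h1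
      _ ≤ A' ^ m * (m.factorial : ℝ) ^ (1 / β - 1) *
          (N * Real.exp (ε * (‖y‖ + m * ρ) ^ a) / ρ ^ m) := by gcongr
      _ = N * (A' ^ m * (m.factorial : ℝ) ^ (1 / β - 1) *
          (Real.exp (ε * (‖y‖ + m * ρ) ^ a) / ρ ^ m)) := by ring
      _ ≤ N * ((1 / 2) ^ m * Real.exp (((2 : ℝ) ^ l)⁻¹ * ‖x‖ ^ a)) := by
          refine mul_le_mul_of_nonneg_left (h2.trans ?_) hN0
          gcongr
      _ = _ := by ring

theorem FunctionalBound.summable {a β : ℝ} (ha : 0 < a) (haβ : a ≤ β)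
    {θ : ∀ m, Module.Dual ℂ (G.SymTest m)} {σ₀ : T} {A : ℝ} (hA : 0 < A)
    (h : G.FunctionalBound β θ σ₀ A) {f : G.Dual → ℂ} (hf : f ∈ G.EminPos a) (w : G.Dual) :
    Summable fun m => θ m (G.derivative f m w) := by
  obtain ⟨hfe, hfb⟩ := mem_eminPos_iff.1 hf
  obtain ⟨τ, x, rfl⟩ := G.exists_incl w
  obtain ⟨σ, l', hest⟩ := h.exists_norm_term_le ha haβ hA τ 0
  obtain ⟨N, hN⟩ := hfb σ l'
  exact Summable.of_norm_bounded (summable_geometric_two.mul_left _)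
    fun m => (hest f hfe).2 N hN m x

/-- The operator `∑ₘ ⟨θ⁽ᵐ⁾, D^m ·⟩` acts continuously on entire functions of order at most `β` and
minimal type. -/
theorem FunctionalBound.exists_growthBound_diffOp {a β : ℝ} (ha : 0 < a) (haβ : a ≤ β)
    {θ : ∀ m, Module.Dual ℂ (G.SymTest m)} {σ₀ : T} {A : ℝ} (hA : 0 < A)
    (h : G.FunctionalBound β θ σ₀ A) (τ : T) (l : ℕ) :
    ∃ (σ : T) (l' : ℕ), ∀ f : G.Dual → ℂ, G.IsEntire f → ∀ N, G.GrowthBound a σ l' f N →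
      G.GrowthBound a τ l (G.diffOp θ f) (2 * N) := by
  obtain ⟨σ, l', hest⟩ := h.exists_norm_term_le ha haβ hA τ l
  refine ⟨σ, l', fun f hf N hN x => ?_⟩
  refine (tsum_of_norm_bounded (hasSum_geometric_two.mul_left _)
    fun m => (hest f hf).2 N hN m x).trans_eq (by ring)

theorem FunctionalBound.diffOp_mem_eminPos {a β : ℝ} (ha : 0 < a) (haβ : a ≤ β)
    {θ : ∀ m, Module.Dual ℂ (G.SymTest m)} {σ₀ : T} {A : ℝ} (hA : 0 < A)
    (h : G.FunctionalBound β θ σ₀ A) {f : G.Dual → ℂ} (hf : f ∈ G.EminPos a) :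
    G.diffOp θ f ∈ G.EminPos a := by
  obtain ⟨hfe, hfb⟩ := mem_eminPos_iff.1 hf
  refine mem_eminPos_iff.2 ⟨fun τ => ?_, fun τ l => ?_⟩
  · obtain ⟨σ, l', hest⟩ := h.exists_norm_term_le ha haβ hA τ 0
    obtain ⟨N, hN⟩ := hfb σ l'
    obtain ⟨hd, hb⟩ := hest f hfe
    have hN0 := hN.nonneg
    refine differentiable_of_tendstoUniformlyOn
      (f := fun n x => ∑ m ∈ Finset.range n, θ m (G.derivative f m (G.incl τ x)))
      (fun n => Differentiable.fun_sum fun m _ => hd m) fun x => ⟨1, one_pos, ?_⟩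
    refine tendstoUniformlyOn_tsum_nat (u := fun m =>
      N * Real.exp (((2 : ℝ) ^ 0)⁻¹ * (‖x‖ + 1) ^ a) * (1 / 2) ^ m)
      (summable_geometric_two.mul_left _) fun m y hy => (hb N hN m y).trans ?_
    have hyx : ‖y‖ ≤ ‖x‖ + 1 := by
      rw [Metric.mem_ball, dist_eq_norm] at hy
      have := norm_add_le x (y - x)
      rw [add_sub_cancel] at this
      linarith
    gcongr
  · obtain ⟨σ, l', hest⟩ := h.exists_growthBound_diffOp ha haβ hA τ l
    obtain ⟨N, hN⟩ := hfb σ l'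
    exact ⟨_, hest f hfe N hN⟩

end Complete

end GelfandTriple

end

/-! ### The topology of the spaces of entire functions, and density of polynomials -/

noncomputable section

universe u v

namespace GelfandTriple

variable {T : Type u} {H : T → Type v} [∀ τ, NormedAddCommGroup (H τ)]
  [∀ τ, InnerProductSpace ℂ (H τ)] (G : GelfandTriple H)

variable {G} in
theorem mem_eminSubmodule {α : ℝ} {f : G.Dual → ℂ} :
    f ∈ G.eminSubmodule α ↔ ∀ a : Exponent α, f ∈ G.EminPos a.1 :=
  Submodule.mem_iInf _

variable {G} in
theorem Emin.ext {α : ℝ} {f g : G.Emin α} (h : ∀ w, f.toFun w = g.toFun w) : f = g :=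
  Subtype.ext (funext h)

variable {G} in
theorem Emin.mem_eminPos {α : ℝ} (f : G.Emin α) (a : Exponent α) : f.toFun ∈ G.EminPos a.1 :=
  mem_eminSubmodule.1 (Subtype.property (p := fun f => f ∈ G.eminSubmodule α) f) a

/-- Functions on `Φ'`, as elements of `ℰ^α_min(Φ')`. -/
def toEmin {α : ℝ} (f : G.Dual → ℂ) (hf : f ∈ G.eminSubmodule α) : G.Emin α :=
  (⟨f, hf⟩ : G.eminSubmodule α)

theorem withSeminorms_eminSeminorm (α : ℝ) : WithSeminorms (𝕜 := ℂ) (G.eminSeminorm α) := by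
  have : IsTopologicalAddGroup (G.Emin α) := topologicalAddGroup_iInf fun i =>
    letI := (G.eminSeminorm α i).toSeminormedAddCommGroup
    inferInstance
  exact (SeminormFamily.withSeminorms_iff_topologicalSpace_eq_iInf _).2 rfl

theorem exists_exponent {α : ℝ} (hα : 0 ≤ α) : Nonempty (Exponent α) := by
  rcases hα.eq_or_lt with rfl | h
  · exact ⟨⟨1, one_pos, Or.inr rfl⟩⟩
  · exact ⟨⟨α, h, Or.inl rfl⟩⟩

/-- For `α ≤ β`, the exponents `b ≤ β` suffice to define `ℰ^α_min(Φ')`. -/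
theorem exists_exponent_le {α β : ℝ} (hβ : 0 < β) (hαβ : α ≤ β) (a : Exponent α) :
    ∃ b : Exponent α, b.1 ≤ a.1 ∧ b.1 ≤ β := by
  obtain ⟨a, ha, h | h⟩ := a
  · exact ⟨⟨a, ha, Or.inl h⟩, le_rfl, h.trans_le hαβ⟩
  · exact ⟨⟨min a β, lt_min ha hβ, Or.inr h⟩, min_le_left _ _, min_le_right _ _⟩

/-- Linear operators on `ℰ^α_min(Φ')` for which every seminorm of the image is bounded by some
seminorm of the argument. -/
def IsGrowthBounded {α : ℝ} (L : G.Emin α →ₗ[ℂ] G.Emin α) : Prop :=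
  ∀ (a : Exponent α) (τ : T) (l : ℕ), ∃ (b : Exponent α) (σ : T) (l' : ℕ) (C : ℝ), 0 ≤ C ∧
    ∀ (f : G.Emin α) (N : ℝ), G.GrowthBound b.1 σ l' f.toFun N →
      G.GrowthBound a.1 τ l (L f).toFun (C * N)

variable {G}

theorem IsGrowthBounded.comp {α : ℝ} {L M : G.Emin α →ₗ[ℂ] G.Emin α} (hL : G.IsGrowthBounded L)
    (hM : G.IsGrowthBounded M) : G.IsGrowthBounded (L ∘ₗ M) := by
  intro a τ l
  obtain ⟨b, σ, l', C, hC, h⟩ := hL a τ l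
  obtain ⟨b', σ', l'', C', hC', h'⟩ := hM b σ l'
  refine ⟨b', σ', l'', C * C', by positivity, fun f N hN => ?_⟩
  rw [mul_assoc]
  exact h _ _ (h' f N hN)

theorem isGrowthBounded_id {α : ℝ} : G.IsGrowthBounded (α := α) LinearMap.id := fun a τ l =>
  ⟨a, τ, l, 1, zero_le_one, fun f N hN => by rwa [one_mul]⟩

theorem IsGrowthBounded.continuous {α : ℝ} {L : G.Emin α →ₗ[ℂ] G.Emin α}
    (hL : G.IsGrowthBounded L) : Continuous L := by
  refine WithSeminorms.continuous_of_isBounded (G.withSeminorms_eminSeminorm α)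
    (G.withSeminorms_eminSeminorm α) L (Seminorm.IsBounded.of_real fun i => ?_)
  obtain ⟨b, σ, l', C, hC, h⟩ := hL i.1 i.2.1 i.2.2
  refine ⟨{(b, σ, l')}, C, fun f => ?_⟩
  rw [Finset.sup_singleton]
  exact (h f _ (growthBound_growthNorm (f.bddAbove b σ l'))).growthNorm_le

/-- Evaluation at a point of `Φ'`. -/
def evalEmin (α : ℝ) (w : G.Dual) : G.Emin α →ₗ[ℂ] ℂ where
  toFun f := f.toFun w
  map_add' _ _ := rfl
  map_smul' _ _ := rfl

theorem toFun_sum {α : ℝ} {ι : Type*} (s : Finset ι) (f : ι → G.Emin α) (w : G.Dual) :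
    (∑ i ∈ s, f i).toFun w = ∑ i ∈ s, (f i).toFun w :=
  map_sum (evalEmin α w) f s

theorem continuous_evalEmin {α : ℝ} (hα : 0 ≤ α) (w : G.Dual) :
    Continuous (G.evalEmin α w) := by
  obtain ⟨a⟩ := exists_exponent hα
  obtain ⟨τ, x, rfl⟩ := G.exists_incl w
  refine WithSeminorms.continuous_normedSpace_rng ℂ (G.withSeminorms_eminSeminorm α) _
    ⟨{(a, τ, 0)}, (Real.exp (((2 : ℝ) ^ 0)⁻¹ * ‖x‖ ^ a.1)).toNNReal, fun f => ?_⟩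
  rw [Finset.sup_singleton]
  change ‖f.toFun (G.incl τ x)‖ ≤ (Real.exp (((2 : ℝ) ^ 0)⁻¹ * ‖x‖ ^ a.1)).toNNReal *
    G.growthNorm a.1 τ 0 f.toFun
  rw [Real.coe_toNNReal _ (Real.exp_nonneg _), mul_comm]
  exact growthBound_growthNorm (f.bddAbove a τ 0) x

section Complete

variable [∀ τ, CompleteSpace (H τ)]

variable (G) in
/-- The polynomial `ω ↦ ⟨ω^{⊗n}, φ⟩`. -/
def monomial (n : ℕ) : G.SymTest n →ₗ[ℂ] (G.Dual → ℂ) where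
  toFun φ w := φ.1 fun _ => w
  map_add' _ _ := rfl
  map_smul' _ _ := rfl

theorem monomial_apply {n : ℕ} (φ : G.SymTest n) (w : G.Dual) :
    G.monomial n φ w = φ.1 fun _ => w := rfl

theorem isEntire_monomial {n : ℕ} (φ : G.SymTest n) : G.IsEntire (G.monomial n φ) := by
  intro τ
  have h : Differentiable ℂ (G.restrictForm τ n φ) :=
    (ContinuousMultilinearMap.contDiff (n := 1) _).differentiable one_ne_zero
  have hd : Differentiable ℂ fun (x : StrongDual ℂ (H τ)) (_ : Fin n) => x :=
    differentiable_pi.2 fun _ => differentiable_id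
  exact h.comp hd

/-- Polynomials are of order zero. -/
theorem exists_growthBound_monomial {a : ℝ} (ha : 0 < a) (l n : ℕ) :
    ∃ C, 0 ≤ C ∧ ∀ (τ : T) (φ : G.SymTest n) (K : ℝ), 0 ≤ K → G.FormBound τ φ.1 K →
      G.GrowthBound a τ l (G.monomial n φ) (C * K) := by
  obtain ⟨C, hC, h⟩ := exists_pow_le_mul_exp ha (by positivity : (0 : ℝ) < ((2 : ℝ) ^ l)⁻¹) n
  refine ⟨C, hC, fun τ φ K hK hφ x => ?_⟩
  refine (hφ fun _ => x).trans ?_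
  rw [Finset.prod_const, Finset.card_univ, Fintype.card_fin]
  calc K * ‖x‖ ^ n ≤ K * (C * Real.exp (((2 : ℝ) ^ l)⁻¹ * ‖x‖ ^ a)) :=
        mul_le_mul_of_nonneg_left (h _ (norm_nonneg x)) hK
    _ = _ := by ring

theorem monomial_mem_eminPos {a : ℝ} (ha : 0 < a) {n : ℕ} (φ : G.SymTest n) :
    G.monomial n φ ∈ G.EminPos a := by
  refine mem_eminPos_iff.2 ⟨isEntire_monomial φ, fun τ l => ?_⟩
  obtain ⟨C, -, h⟩ := exists_growthBound_monomial (G := G) ha l n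
  obtain ⟨K, hK, hφ⟩ := G.exists_formBound φ τ
  exact ⟨_, h τ φ K hK hφ⟩

variable (G) in
/-- The polynomials `⟨ω^{⊗n}, φ⟩` as elements of `ℰ^α_min(Φ')`. -/
def monomialEmin (α : ℝ) (n : ℕ) : G.SymTest n →ₗ[ℂ] G.Emin α where
  toFun φ := toEmin G (G.monomial n φ)
    (mem_eminSubmodule.2 fun a => monomial_mem_eminPos a.2.1 φ)
  map_add' _ _ := rfl
  map_smul' _ _ := rfl

theorem monomialEmin_toFun {α : ℝ} {n : ℕ} (φ : G.SymTest n) :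
    (G.monomialEmin α n φ).toFun = G.monomial n φ := rfl

variable (G) in
/-- The Taylor coefficient `D^n f(0) / n!` of an entire function. -/
def taylorForm (f : G.Dual → ℂ) (n : ℕ) : G.SymTest n :=
  (n.factorial : ℂ)⁻¹ • G.derivative f n 0

theorem IsEntire.monomial_taylorForm {f : G.Dual → ℂ} (hf : G.IsEntire f) (n : ℕ) {τ : T}
    (x : StrongDual ℂ (H τ)) : G.monomial n (G.taylorForm f n) (G.incl τ x) =
      (n.factorial : ℂ)⁻¹ • iteratedFDeriv ℂ n (fun z => f (G.incl τ z)) 0 fun _ => x := by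
  rw [← hf.derivative_apply, map_zero]
  rfl

theorem IsEntire.hasSum_taylorForm {f : G.Dual → ℂ} (hf : G.IsEntire f) (w : G.Dual) :
    HasSum (fun n => G.monomial n (G.taylorForm f n) w) (f w) := by
  obtain ⟨τ, x, rfl⟩ := G.exists_incl w
  simp only [hf.monomial_taylorForm]
  have h := hasSum_iteratedFDeriv_of_complex (hf τ) 0 x
  rwa [zero_add] at h

/-- The Cauchy estimate on the disc of radius `2` in the direction `ω` gives geometric decay of the
terms of the Taylor series in every norm of `ℰ^a_min(Φ')`. -/
theorem IsEntire.exists_growthBound_taylorForm (a : ℝ) (l : ℕ) :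
    ∃ l' : ℕ, ∀ (τ : T) (f : G.Dual → ℂ), G.IsEntire f → ∀ N, G.GrowthBound a τ l' f N → ∀ n,
      G.GrowthBound a τ l (G.monomial n (G.taylorForm f n)) (N * (1 / 2) ^ n) := by
  obtain ⟨l', hl'⟩ := exists_inv_two_pow_le
    (by positivity : (0 : ℝ) < ((2 : ℝ) ^ l)⁻¹ / (2 : ℝ) ^ a)
  rw [le_div_iff₀ (by positivity)] at hl'
  refine ⟨l', fun τ f hf N hN n x => ?_⟩
  have hN0 := hN.nonneg
  have hf0 : (0 : ℝ) < n.factorial := by exact_mod_cast n.factorial_pos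
  have h := Complex.norm_iteratedDeriv_le_of_forall_mem_sphere_norm_le (c := 0) (R := 2)
    (C := N * Real.exp (((2 : ℝ) ^ l)⁻¹ * ‖x‖ ^ a)) n two_pos
    (differentiable_comp_line (hf τ) 0 x).diffContOnCl (fun z hz => by
      have hz' : ‖z‖ = 2 := by simpa using hz
      refine (hN _).trans (mul_le_mul_of_nonneg_left (Real.exp_le_exp.2 ?_) hN0)
      rw [add_zero, norm_smul, hz', Real.mul_rpow two_pos.le (norm_nonneg x), ← mul_assoc]
      exact mul_le_mul_of_nonneg_right hl' (by positivity))
  rw [iteratedDeriv_comp_line (hf τ)] at h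
  rw [hf.monomial_taylorForm, norm_smul, norm_inv, Complex.norm_natCast, inv_mul_le_iff₀ hf0]
  refine h.trans_eq ?_
  rw [one_div, inv_pow]
  ring

variable (G) in
/-- The Taylor polynomial of degree less than `N`. -/
def taylorSum {α : ℝ} (f : G.Emin α) (N : ℕ) : G.Emin α :=
  ∑ n ∈ Finset.range N, G.monomialEmin α n (G.taylorForm f.toFun n)

theorem tendsto_taylorSum {α : ℝ} (f : G.Emin α) :
    Filter.Tendsto (G.taylorSum f) Filter.atTop (nhds f) := by
  rw [(G.withSeminorms_eminSeminorm α).tendsto_nhds]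
  rintro ⟨a, τ, l⟩ ε hε
  obtain ⟨l', h⟩ := IsEntire.exists_growthBound_taylorForm (G := G) a.1 l
  have hf := (mem_eminPos_iff.1 (f.mem_eminPos a)).1
  set N := G.growthNorm a.1 τ l' f.toFun
  have hN : G.GrowthBound a.1 τ l' f.toFun N := growthBound_growthNorm (f.bddAbove a τ l')
  have key : ∀ n, G.eminSeminorm α (a, τ, l) (G.taylorSum f n - f) ≤ N * 2 * (1 / 2) ^ n := by
    intro n
    rw [map_sub_rev]
    refine GrowthBound.growthNorm_le fun x => ?_
    have h1 : (f - G.taylorSum f n).toFun (G.incl τ x) =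
        f.toFun (G.incl τ x) - ∑ k ∈ Finset.range n,
          G.monomial k (G.taylorForm f.toFun k) (G.incl τ x) := by
      change f.toFun (G.incl τ x) - (G.taylorSum f n).toFun (G.incl τ x) = _
      rw [taylorSum, toFun_sum]
      rfl
    have h2 := hf.hasSum_taylorForm (G.incl τ x)
    have h3 := (hasSum_nat_add_iff' n).2 h2
    rw [h1, ← h3.tsum_eq]
    refine (tsum_of_norm_bounded (hasSum_geometric_two.mul_left
      (N * Real.exp (((2 : ℝ) ^ l)⁻¹ * ‖x‖ ^ a.1) * (1 / 2) ^ n)) fun k => ?_).trans_eq (by ring)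
    refine (h τ f.toFun hf N hN (k + n) x).trans_eq ?_
    rw [pow_add]
    ring
  have hlim : Filter.Tendsto (fun n : ℕ => N * 2 * (1 / 2 : ℝ) ^ n) Filter.atTop (nhds 0) := by
    have := (tendsto_pow_atTop_nhds_zero_of_lt_one (by norm_num) (by norm_num :
      (1 / 2 : ℝ) < 1)).const_mul (N * 2)
    rwa [mul_zero] at this
  filter_upwards [hlim.eventually (gt_mem_nhds hε)] with n hn
  exact (key n).trans_lt hn

open Classical in
theorem sumPairing_dualPow_apply (c : Π₀ n, G.SymTest n) (w : G.Dual) :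
    G.sumPairing G.dualPow c w = ∑ n ∈ c.support, G.monomial n (c n) w :=
  G.sumPairing_apply _ c w

theorem monomial_mem_polynomials {n : ℕ} (φ : G.SymTest n) : G.monomial n φ ∈ G.Polynomials :=
  ⟨DFinsupp.single n φ, funext fun w =>
    DFinsupp.lsum_single (R := ℂ) ℕ (F := fun n => (G.dualPow n w).1) (x := φ)⟩

theorem mem_eminSubmodule_of_mem_polynomials {α : ℝ} {p : G.Dual → ℂ} (hp : p ∈ G.Polynomials) :
    p ∈ G.eminSubmodule α := by
  classical
  obtain ⟨c, rfl⟩ := hp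
  have h : G.sumPairing G.dualPow c = ∑ n ∈ c.support, G.monomial n (c n) := by
    funext w
    rw [sumPairing_dualPow_apply, Finset.sum_apply]
  rw [h]
  exact Submodule.sum_mem _ fun n _ => mem_eminSubmodule.2 fun a => monomial_mem_eminPos a.2.1 _

theorem dense_polynomials {α : ℝ} : Dense {f : G.Emin α | f.toFun ∈ G.Polynomials} := by
  intro f
  refine mem_closure_of_tendsto (tendsto_taylorSum f) (Filter.Eventually.of_forall fun N => ?_)
  have h : (G.taylorSum f N).toFun =
      ∑ n ∈ Finset.range N, G.monomial n (G.taylorForm f.toFun n) := by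
    funext w
    rw [taylorSum, toFun_sum, Finset.sum_apply]
    rfl
  change (G.taylorSum f N).toFun ∈ G.Polynomials
  rw [h]
  exact Submodule.sum_mem _ fun n _ => monomial_mem_polynomials _

end Complete

end GelfandTriple

end

/-! ### Operators determined by their values on powers -/

noncomputable section

universe u v

namespace GelfandTriple

variable {T : Type u} {H : T → Type v} [∀ τ, NormedAddCommGroup (H τ)]
  [∀ τ, InnerProductSpace ℂ (H τ)] {G : GelfandTriple H} [∀ τ, CompleteSpace (H τ)]

variable (G) in
/-- The functionals on `Φ^{⊙n}` that are bounded with respect to the bounded forms on some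
`H_{-τ}`. -/
def boundedFunctionals (n : ℕ) : Submodule ℂ (Module.Dual ℂ (G.SymTest n)) where
  carrier := {Ψ | ∃ (τ : T) (C : ℝ), 0 ≤ C ∧ ∀ (φ : G.SymTest n) (K : ℝ), 0 ≤ K →
    G.FormBound τ φ.1 K → ‖Ψ φ‖ ≤ C * K}
  zero_mem' := ⟨G.center, 0, le_rfl, fun φ K _ _ => by simp⟩
  add_mem' := by
    rintro Ψ Ψ' ⟨τ, C, hC, h⟩ ⟨τ', C', hC', h'⟩
    obtain ⟨σ, ⟨j, hj⟩, ⟨k, hk⟩⟩ := G.directed τ τ'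
    refine ⟨σ, C * ‖j‖ ^ n + C' * ‖k‖ ^ n, by positivity, fun φ K hK hφ => ?_⟩
    refine (norm_add_le _ _).trans ((add_le_add
      (h φ _ (by positivity) (hφ.of_inclusion hj hK))
      (h' φ _ (by positivity) (hφ.of_inclusion hk hK))).trans_eq (by ring))
  smul_mem' := by
    rintro c Ψ ⟨τ, C, hC, h⟩
    refine ⟨τ, ‖c‖ * C, by positivity, fun φ K hK hφ => ?_⟩
    rw [LinearMap.smul_apply, norm_smul, mul_assoc]
    exact mul_le_mul_of_nonneg_left (h φ K hK hφ) (norm_nonneg c)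

theorem symDual_le_boundedFunctionals (n : ℕ) : G.SymDual n ≤ G.boundedFunctionals n := by
  refine iSup_le fun τ Ψ hΨ => ?_
  obtain ⟨σ, κ, hκ, h⟩ := G.exists_norm_le_of_negNorm_le τ
  have hΨ' : G.negNorm τ Ψ < ∞ := hΨ
  exact ⟨σ, (G.negNorm τ Ψ).toReal * κ ^ n, by positivity, fun φ K hK hφ =>
    h n Ψ _ ENNReal.toReal_nonneg (ENNReal.ofReal_toReal hΨ'.ne).ge φ K hK hφ⟩

/-- Functionals that are bounded in some norm are determined by their values on tensor powers. -/
theorem eq_of_testPow {n : ℕ} {Ψ Ψ' : Module.Dual ℂ (G.SymTest n)}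
    (hΨ : Ψ ∈ G.boundedFunctionals n) (hΨ' : Ψ' ∈ G.boundedFunctionals n)
    (h : ∀ ξ, Ψ (G.testPow n ξ) = Ψ' (G.testPow n ξ)) : Ψ = Ψ' := by
  obtain ⟨τ, C, -, hC⟩ := Submodule.sub_mem _ hΨ hΨ'
  exact sub_eq_zero.1 (G.eq_zero_of_testPow (Ψ - Ψ') hC fun ξ => by
    rw [LinearMap.sub_apply, h, sub_self])

/-- Pointwise values of the image of `⟨ω^{⊗n}, φ⟩` depend boundedly on `φ`. -/
theorem IsGrowthBounded.mem_boundedFunctionals {α : ℝ} (hα : 0 ≤ α) {L : G.Emin α →ₗ[ℂ] G.Emin α}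
    (hL : G.IsGrowthBounded L) (n : ℕ) (w : G.Dual) :
    evalEmin α w ∘ₗ L ∘ₗ G.monomialEmin α n ∈ G.boundedFunctionals n := by
  obtain ⟨a⟩ := exists_exponent hα
  obtain ⟨τ, x, rfl⟩ := G.exists_incl w
  obtain ⟨b, σ, l', C, hC, h⟩ := hL a τ 0
  obtain ⟨C', hC', h'⟩ := exists_growthBound_monomial (G := G) b.2.1 l' n
  refine ⟨σ, C * C' * Real.exp (((2 : ℝ) ^ 0)⁻¹ * ‖x‖ ^ a.1), by positivity,
    fun φ K hK hφ => ?_⟩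
  exact (h (G.monomialEmin α n φ) _ (h' σ φ K hK hφ) x).trans_eq (by ring)

/-- A growth bounded operator that fixes the powers `⟨ω, ξ⟩ⁿ` is the identity. -/
theorem IsGrowthBounded.eq_id {α : ℝ} (hα : 0 ≤ α) {L : G.Emin α →ₗ[ℂ] G.Emin α}
    (hL : G.IsGrowthBounded L) (h : ∀ (n : ℕ) (ξ : G.Test) (w : G.Dual),
      (L (G.monomialEmin α n (G.testPow n ξ))).toFun w = (w.1 ξ) ^ n) (f : G.Emin α) :
    L f = f := by
  have hmon : ∀ (n : ℕ) (φ : G.SymTest n), L (G.monomialEmin α n φ) = G.monomialEmin α n φ := by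
    intro n φ
    refine Emin.ext fun w => ?_
    refine LinearMap.congr_fun (eq_of_testPow (hL.mem_boundedFunctionals hα n w)
      (isGrowthBounded_id.mem_boundedFunctionals hα n w) fun ξ => ?_) φ
    refine (h n ξ w).trans ?_
    change _ = (G.testPow n ξ).1 fun _ => w
    rw [testPow_apply, Finset.prod_const, Finset.card_univ, Fintype.card_fin]
  have hsum : ∀ N, L (G.taylorSum f N) = G.taylorSum f N := by
    intro N
    rw [taylorSum, map_sum]
    exact Finset.sum_congr rfl fun n _ => hmon n _
  refine Emin.ext fun w => ?_
  have hc := continuous_evalEmin (G := G) hα w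
  have h1 := ((hc.comp hL.continuous).tendsto f).comp (tendsto_taylorSum f)
  have h2 := (hc.tendsto f).comp (tendsto_taylorSum f)
  refine tendsto_nhds_unique h1 (h2.congr fun N => ?_)
  rw [Function.comp_apply, Function.comp_apply, Function.comp_apply, hsum]

end GelfandTriple

end

/-! ### The action of differential operators on powers -/

noncomputable section

universe u v

namespace GelfandTriple

variable {T : Type u} {H : T → Type v} [∀ τ, NormedAddCommGroup (H τ)]
  [∀ τ, InnerProductSpace ℂ (H τ)] {G : GelfandTriple H}

theorem Emin.isEntire {α : ℝ} (hα : 0 ≤ α) (f : G.Emin α) : G.IsEntire f.toFun := by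
  obtain ⟨a⟩ := exists_exponent hα
  exact (mem_eminPos_iff.1 (f.mem_eminPos a)).1

variable [∀ τ, CompleteSpace (H τ)]

section DiffOp

variable {α β A : ℝ} {θ : ∀ m, Module.Dual ℂ (G.SymTest m)} {σ₀ : T}

theorem FunctionalBound.diffOp_mem_eminSubmodule (hβ : 0 < β) (hαβ : α ≤ β) (hA : 0 < A)
    (h : G.FunctionalBound β θ σ₀ A) (f : G.Emin α) :
    G.diffOp θ f.toFun ∈ G.eminSubmodule α := by
  refine mem_eminSubmodule.2 fun a => ?_
  obtain ⟨b, hba, hbβ⟩ := exists_exponent_le hβ hαβ a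
  have h1 := mem_eminPos_iff.1 (h.diffOp_mem_eminPos b.2.1 hbβ hA (f.mem_eminPos b))
  refine mem_eminPos_iff.2 ⟨h1.1, fun τ l => ?_⟩
  obtain ⟨N, hN⟩ := h1.2 τ l
  exact ⟨_, hN.of_le b.2.1.le hba⟩

theorem FunctionalBound.summable_toFun (hβ : 0 < β) (hα : 0 ≤ α) (hαβ : α ≤ β) (hA : 0 < A)
    (h : G.FunctionalBound β θ σ₀ A) (f : G.Emin α) (w : G.Dual) :
    Summable fun m => θ m (G.derivative f.toFun m w) := by
  obtain ⟨a⟩ := exists_exponent hα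
  obtain ⟨b, -, hbβ⟩ := exists_exponent_le hβ hαβ a
  exact h.summable b.2.1 hbβ hA (f.mem_eminPos b) w

theorem FunctionalBound.diffOp_add (hβ : 0 < β) (hα : 0 ≤ α) (hαβ : α ≤ β) (hA : 0 < A)
    (h : G.FunctionalBound β θ σ₀ A) (f g : G.Emin α) (w : G.Dual) :
    G.diffOp θ (f.toFun + g.toFun) w = G.diffOp θ f.toFun w + G.diffOp θ g.toFun w := by
  rw [diffOp, diffOp, diffOp, ← (h.summable_toFun hβ hα hαβ hA f w).tsum_add
    (h.summable_toFun hβ hα hαβ hA g w)]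
  refine tsum_congr fun m => ?_
  rw [(f.isEntire hα).derivative_add (g.isEntire hα), map_add]

theorem diffOp_smul (hα : 0 ≤ α) (c : ℂ) (f : G.Emin α) (w : G.Dual) :
    G.diffOp θ (c • f.toFun) w = c * G.diffOp θ f.toFun w := by
  rw [diffOp, diffOp, ← tsum_mul_left]
  refine tsum_congr fun m => ?_
  rw [(f.isEntire hα).derivative_smul, map_smul, smul_eq_mul]

/-- The operator `∑ₘ ⟨θ⁽ᵐ⁾, D^m ·⟩` acts linearly on `ℰ^α_min(Φ')`. -/
theorem FunctionalBound.exists_linearMap (hβ : 0 < β) (hα : 0 ≤ α) (hαβ : α ≤ β) (hA : 0 < A)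
    (h : G.FunctionalBound β θ σ₀ A) :
    ∃ L : G.Emin α →ₗ[ℂ] G.Emin α, ∀ f, (L f).toFun = G.diffOp θ f.toFun :=
  ⟨{ toFun := fun f => toEmin G (G.diffOp θ f.toFun) (h.diffOp_mem_eminSubmodule hβ hαβ hA f)
     map_add' := fun f g => Emin.ext fun w => h.diffOp_add hβ hα hαβ hA f g w
     map_smul' := fun c f => Emin.ext fun w => diffOp_smul hα c f w }, fun _ => rfl⟩

theorem FunctionalBound.isGrowthBounded (hβ : 0 < β) (hα : 0 ≤ α) (hαβ : α ≤ β) (hA : 0 < A)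
    (h : G.FunctionalBound β θ σ₀ A) {L : G.Emin α →ₗ[ℂ] G.Emin α}
    (hL : ∀ f, (L f).toFun = G.diffOp θ f.toFun) : G.IsGrowthBounded L := by
  intro a τ l
  obtain ⟨b, hba, hbβ⟩ := exists_exponent_le hβ hαβ a
  obtain ⟨σ, l', hb⟩ := h.exists_growthBound_diffOp b.2.1 hbβ hA τ l
  -- The factor `2` is the sum of the geometric series; the factor `e` comes from raising the order
  -- from `b` to `a`.
  refine ⟨b, σ, l', Real.exp 1 * 2, by positivity, fun f N hN => ?_⟩
  have h1 := (hb f.toFun (f.isEntire hα) N hN).of_le b.2.1.le hba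
  rw [hL, mul_assoc]
  exact h1

end DiffOp

theorem monomial_testPow (n : ℕ) (ξ : G.Test) (w : G.Dual) :
    G.monomial n (G.testPow n ξ) w = (w.1 ξ) ^ n := by
  rw [monomial_apply, testPow_apply, Finset.prod_const, Finset.card_univ, Fintype.card_fin]

theorem derivative_testPow (n m : ℕ) (ξ : G.Test) (w : G.Dual) :
    G.derivative (G.monomial n (G.testPow n ξ)) m w =
      ((n.descFactorial m : ℂ) * (w.1 ξ) ^ (n - m)) • G.testPow m ξ := by
  refine (isEntire_monomial _).derivative_eq fun τ y hy x => ?_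
  subst hy
  let ℓ : StrongDual ℂ (H τ) →L[ℂ] ℂ := ContinuousLinearMap.apply ℂ ℂ (G.toH τ ξ)
  have h1 : (fun z => G.monomial n (G.testPow n ξ) (G.incl τ z)) = (fun t : ℂ => t ^ n) ∘ ℓ := by
    funext z
    exact monomial_testPow n ξ _
  have hpow : ContDiff ℂ m fun t : ℂ => t ^ n := contDiff_id.pow n
  rw [h1, ℓ.iteratedFDeriv_comp_right hpow y le_rfl,
    ContinuousMultilinearMap.compContinuousLinearMap_apply,
    iteratedFDeriv_apply_eq_iteratedDeriv_mul_prod, iteratedDeriv_pow]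
  change ((n.descFactorial m : ℂ) * ((G.incl τ y).1 ξ) ^ (n - m)) *
    (G.testPow m ξ).1 (fun i => G.incl τ (x i)) = _
  rw [testPow_apply, smul_eq_mul, mul_comm]
  rfl

/-- On powers, the operator `∑ₘ ⟨θ⁽ᵐ⁾, D^m ·⟩` multiplies exponential generating functions by
`∑ₘ ⟨θ⁽ᵐ⁾, ξ^{⊗m}⟩`. -/
theorem diffOp_testPow (θ : ∀ m, Module.Dual ℂ (G.SymTest m)) (n : ℕ) (ξ : G.Test) (w : G.Dual) :
    G.diffOp θ (G.monomial n (G.testPow n ξ)) w =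
      ∑ p ∈ Finset.HasAntidiagonal.antidiagonal n, (n.factorial : ℂ) * (p.2.factorial : ℂ)⁻¹ *
        θ p.1 (G.testPow p.1 ξ) * (w.1 ξ) ^ p.2 := by
  rw [diffOp, tsum_eq_sum (s := Finset.range (n + 1)) (fun m hm => by
    rw [derivative_testPow, Nat.descFactorial_of_lt (by simpa using hm)]
    simp), Finset.Nat.sum_antidiagonal_eq_sum_range_succ_mk]
  refine Finset.sum_congr rfl fun m hm => ?_
  have hmn : m ≤ n := by simpa [Nat.lt_succ_iff] using hm
  have h : ((n - m).factorial : ℂ) * (n.descFactorial m : ℂ) = n.factorial := by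
    exact_mod_cast Nat.factorial_mul_descFactorial hmn
  have h0 : ((n - m).factorial : ℂ) ≠ 0 := by exact_mod_cast (n - m).factorial_ne_zero
  rw [derivative_testPow, map_smul, smul_eq_mul, ← h]
  field_simp

theorem diffOp_testPow_eq_coeff (θ : ∀ m, G.SymDual m) (n : ℕ) (ξ : G.Test) (w : G.Dual) :
    G.diffOp (fun m => (θ m).1) (G.monomial n (G.testPow n ξ)) w =
      n.factorial * PowerSeries.coeff n (G.formalSeries θ ξ *
        PowerSeries.mk fun k => ((k.factorial : ℂ))⁻¹ * (w.1 ξ) ^ k) := by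
  rw [diffOp_testPow, PowerSeries.coeff_mul, Finset.mul_sum]
  refine Finset.sum_congr rfl fun p _ => ?_
  rw [formalSeries, PowerSeries.coeff_mk, PowerSeries.coeff_mk]
  ring

theorem map_monomialEmin_testPow {α : ℝ} {θ : ∀ m, Module.Dual ℂ (G.SymTest m)}
    {L : G.Emin α →ₗ[ℂ] G.Emin α} (hL : ∀ f, (L f).toFun = G.diffOp θ f.toFun) (n : ℕ)
    (ξ : G.Test) : L (G.monomialEmin α n (G.testPow n ξ)) =
      ∑ p ∈ Finset.HasAntidiagonal.antidiagonal n, ((n.factorial : ℂ) * (p.2.factorial : ℂ)⁻¹ *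
        θ p.1 (G.testPow p.1 ξ)) • G.monomialEmin α p.2 (G.testPow p.2 ξ) := by
  refine Emin.ext fun w => ?_
  rw [hL, monomialEmin_toFun, diffOp_testPow, toFun_sum]
  refine Finset.sum_congr rfl fun p _ => ?_
  exact congrArg _ (monomial_testPow p.2 ξ w).symm

/-- If `∑ ⟨θ⁽ᵐ⁾, ξ^{⊗m}⟩` and `∑ ⟨ρ⁽ᵐ⁾, ξ^{⊗m}⟩` are reciprocal, the corresponding operators are
inverse to each other on powers. -/
theorem diffOp_comp_testPow {α : ℝ} (θ ρ : ∀ m, G.SymDual m) {L M : G.Emin α →ₗ[ℂ] G.Emin α}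
    (hL : ∀ f, (L f).toFun = G.diffOp (fun m => (θ m).1) f.toFun)
    (hM : ∀ f, (M f).toFun = G.diffOp (fun m => (ρ m).1) f.toFun) (n : ℕ) (ξ : G.Test)
    (h : G.formalSeries θ ξ * G.formalSeries ρ ξ = 1) (w : G.Dual) :
    (M (L (G.monomialEmin α n (G.testPow n ξ)))).toFun w = (w.1 ξ) ^ n := by
  have hcancel : ∀ N k t z : ℂ, k ≠ 0 → N * k⁻¹ * t * (k * z) = N * (t * z) := by
    intro N k t z hk
    field_simp
  have h2 : (M (L (G.monomialEmin α n (G.testPow n ξ)))).toFun w =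
      n.factorial * PowerSeries.coeff n (G.formalSeries θ ξ * (G.formalSeries ρ ξ *
        PowerSeries.mk fun k => ((k.factorial : ℂ))⁻¹ * (w.1 ξ) ^ k)) := by
    rw [map_monomialEmin_testPow hL, map_sum, toFun_sum, PowerSeries.coeff_mul, Finset.mul_sum]
    refine Finset.sum_congr rfl fun p _ => ?_
    have hθ : PowerSeries.coeff p.1 (G.formalSeries θ ξ) = (θ p.1).1 (G.testPow p.1 ξ) :=
      PowerSeries.coeff_mk _ _
    have h0 : (p.2.factorial : ℂ) ≠ 0 := by exact_mod_cast p.2.factorial_ne_zero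
    rw [map_smul]
    change _ * (M (G.monomialEmin α p.2 (G.testPow p.2 ξ))).toFun w = _
    rw [hM, monomialEmin_toFun, diffOp_testPow_eq_coeff ρ, hθ]
    exact hcancel _ _ _ _ h0
  rw [h2, ← mul_assoc, h, one_mul, PowerSeries.coeff_mk, mul_inv_cancel_left₀]
  exact_mod_cast n.factorial_ne_zero

/-- Bounds on `‖θ⁽ⁿ⁾‖_{-τ}` give bounds relative to the bounded forms on a smaller space. The
value at `n = 0` is not covered by the growth condition. -/
theorem exists_functionalBound {β C : ℝ} {τ : T} (hC : 1 ≤ C) (θ : ∀ n, G.SymDual n)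
    (h0 : (θ 0).1 (G.testPow 0 0) = 1) (h : ∀ n : ℕ, 1 ≤ n →
      G.negNorm τ (θ n).1 ≤ ENNReal.ofReal (C ^ n * (n.factorial : ℝ) ^ (1 / β - 1))) :
    ∃ (σ : T) (A : ℝ), 0 < A ∧ G.FunctionalBound β (fun m => (θ m).1) σ A := by
  obtain ⟨σ, κ, hκ, hb⟩ := G.exists_norm_le_of_negNorm_le τ
  refine ⟨σ, C * κ, by positivity, fun m φ K hK hφ => ?_⟩
  rcases Nat.eq_zero_or_pos m with rfl | hm
  · have h1 : φ = (φ.1 fun _ => 0) • G.testPow 0 0 := by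
      apply Subtype.ext
      ext v
      change φ.1 v = (φ.1 fun _ => 0) * (G.testPow 0 0).1 v
      rw [testPow_apply, Finset.univ_eq_empty, Finset.prod_empty, mul_one]
      congr 1
      exact Subsingleton.elim _ _
    have h2 := hφ fun i => i.elim0
    rw [Finset.univ_eq_empty, Finset.prod_empty, mul_one] at h2
    rw [h1, map_smul, h0, smul_eq_mul, mul_one]
    simp only [pow_zero, Nat.factorial_zero, Nat.cast_one, Real.one_rpow, one_mul]
    convert h2 using 3
  · refine (hb m _ _ (by positivity) (h m hm) φ K hK hφ).trans_eq ?_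
    rw [mul_pow]
    ring

end GelfandTriple

end

/-! ### Appell sequences and the Sheffer operator -/

noncomputable section

universe u v

namespace GelfandTriple

variable {T : Type u} {H : T → Type v} [∀ τ, NormedAddCommGroup (H τ)]
  [∀ τ, InnerProductSpace ℂ (H τ)] {G : GelfandTriple H} [∀ τ, CompleteSpace (H τ)]

theorem shefferOperator_sumPairing (S : ∀ n, G.Dual → G.SymDual n) (c : Π₀ n, G.SymTest n)
    (p : G.Polynomials) (hp : p.1 = G.sumPairing G.dualPow c) :
    G.shefferOperator S p = G.sumPairing S c := by
  have h : p = LinearEquiv.ofInjective (G.sumPairing G.dualPow)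
      G.sumPairing_dualPow_injective c := Subtype.ext hp
  rw [h]
  exact congrArg (G.sumPairing S) (LinearEquiv.symm_apply_apply
    (LinearEquiv.ofInjective (G.sumPairing G.dualPow) G.sumPairing_dualPow_injective) c)

theorem constantCoeff_formalSeries (ρ : ∀ n, G.SymDual n) (ξ : G.Test) :
    PowerSeries.constantCoeff (G.formalSeries ρ ξ) = (ρ 0).1 (G.testPow 0 ξ) := by
  rw [← PowerSeries.coeff_zero_eq_constantCoeff_apply]
  exact PowerSeries.coeff_mk _ _

theorem dualPow_zero_testPow (ξ : G.Test) : (G.dualPow 0 0).1 (G.testPow 0 ξ) = 1 := by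
  change (G.testPow 0 ξ).1 (fun _ => 0) = 1
  rw [testPow_apply, Finset.univ_eq_empty, Finset.prod_empty]

theorem IsReciprocal.mul_eq_one {θ ρ : ∀ n, G.SymDual n} (h : G.IsReciprocal θ ρ)
    (hρ : ρ 0 = G.dualPow 0 0) (ξ : G.Test) : G.formalSeries ρ ξ * G.formalSeries θ ξ = 1 := by
  rw [h ξ]
  refine PowerSeries.mul_inv_cancel _ ?_
  rw [constantCoeff_formalSeries, hρ, dualPow_zero_testPow]
  exact one_ne_zero

theorem IsReciprocal.zero_testPow {θ ρ : ∀ n, G.SymDual n} (h : G.IsReciprocal θ ρ)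
    (hρ : ρ 0 = G.dualPow 0 0) : (θ 0).1 (G.testPow 0 0) = 1 := by
  have h1 := congrArg PowerSeries.constantCoeff (h.mul_eq_one hρ 0)
  rwa [map_mul, constantCoeff_formalSeries, constantCoeff_formalSeries, hρ, dualPow_zero_testPow,
    one_mul, map_one] at h1

/-- If `S` is the Appell sequence with the reciprocal series `θ`, the operator
`∑ₘ ⟨θ⁽ᵐ⁾, D^m ·⟩` sends `⟨ω^{⊗n}, φ⟩` to `⟨S⁽ⁿ⁾(ω), φ⟩`. For tensor powers this is the identity of
generating functions, and both sides are bounded in `φ`. -/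
theorem IsAppellSequence.map_monomialEmin {α : ℝ} (hα : 0 ≤ α) {S : ∀ n, G.Dual → G.SymDual n}
    {θ ρ : ∀ n, G.SymDual n} (hS : G.IsAppellSequence S ρ) (hθ : G.IsReciprocal θ ρ)
    {L : G.Emin α →ₗ[ℂ] G.Emin α} (hLb : G.IsGrowthBounded L)
    (hL : ∀ f, (L f).toFun = G.diffOp (fun m => (θ m).1) f.toFun) (n : ℕ) (φ : G.SymTest n)
    (w : G.Dual) : (L (G.monomialEmin α n φ)).toFun w = (S n w).1 φ := by
  have h0 : evalEmin α w ∘ₗ L ∘ₗ G.monomialEmin α n = (S n w).1 := by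
    refine eq_of_testPow (hLb.mem_boundedFunctionals hα n w)
      (symDual_le_boundedFunctionals n (S n w).2) fun ξ => ?_
    have h := congrArg (PowerSeries.coeff n) (hS.2.2 w ξ)
    rw [PowerSeries.coeff_mk, ← hθ ξ, mul_comm (PowerSeries.mk _)] at h
    have h1 := congrFun (hL (G.monomialEmin α n (G.testPow n ξ))) w
    rw [monomialEmin_toFun, diffOp_testPow_eq_coeff θ, ← h, mul_inv_cancel_left₀] at h1
    · exact h1
    · exact_mod_cast n.factorial_ne_zero
  exact LinearMap.congr_fun h0 φ

theorem map_toFun_eq_shefferOperator {α : ℝ} {S : ∀ n, G.Dual → G.SymDual n}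
    {L : G.Emin α →ₗ[ℂ] G.Emin α}
    (h : ∀ (n : ℕ) (φ : G.SymTest n) (w : G.Dual),
      (L (G.monomialEmin α n φ)).toFun w = (S n w).1 φ)
    (p : G.Polynomials) (f : G.Emin α) (hf : f.toFun = p.1) :
    (L f).toFun = G.shefferOperator S p := by
  classical
  obtain ⟨c, hc⟩ := p.2
  have hfc : f = ∑ n ∈ c.support, G.monomialEmin α n (c n) := by
    refine Emin.ext fun w => ?_
    rw [hf, ← hc, toFun_sum]
    exact sumPairing_apply G _ c w
  rw [shefferOperator_sumPairing S c p hc.symm, hfc, map_sum]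
  funext w
  rw [toFun_sum, sumPairing_apply]
  exact Finset.sum_congr rfl fun n _ => h n (c n) w

end GelfandTriple

end

theorem theorem3p4 {T : Type*} {H : T → Type*} [∀ τ, NormedAddCommGroup (H τ)]
    [∀ τ, InnerProductSpace ℂ (H τ)] [∀ τ, CompleteSpace (H τ)]
    [∀ τ, TopologicalSpace.SeparableSpace (H τ)] (G : GelfandTriple H)
    (S : ∀ n, G.Dual → G.SymDual n) (ρ θ : ∀ n, G.SymDual n)
    (hS : G.IsAppellSequence S ρ) (hθ : G.IsReciprocal θ ρ)
    (β : ℝ) (hβ : 1 < β)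
    (hbound : ∃ (τ : T) (C : ℝ), 1 ≤ C ∧ ∀ n : ℕ, 1 ≤ n →
      G.negNorm τ (θ n).1 ≤ ENNReal.ofReal (C ^ n * (n.factorial : ℝ) ^ (1 / β - 1)) ∧
      G.negNorm τ (ρ n).1 ≤ ENNReal.ofReal (C ^ n * (n.factorial : ℝ) ^ (1 / β - 1)))
    (α : ℝ) (hα : α ∈ Set.Icc 0 β) :
    (∀ p ∈ G.Polynomials, p ∈ G.eminSubmodule α) ∧
    Dense {f : G.Emin α | f.toFun ∈ G.Polynomials} ∧
    ∃ L : G.Emin α ≃L[ℂ] G.Emin α,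
      ∀ (p : G.Polynomials) (f : G.Emin α), f.toFun = p.1 →
        (L f).toFun = G.shefferOperator S p := by
  refine ⟨fun p hp => GelfandTriple.mem_eminSubmodule_of_mem_polynomials hp,
    GelfandTriple.dense_polynomials, ?_⟩
  obtain ⟨τ, C, hC, hbound⟩ := hbound
  have hβ0 : 0 < β := one_pos.trans hβ
  have hmul := hθ.mul_eq_one hS.2.1
  have hρ0 : (ρ 0).1 (G.testPow 0 0) = 1 := by
    rw [hS.2.1]
    exact GelfandTriple.dualPow_zero_testPow 0
  obtain ⟨σ, A, hA, hFθ⟩ := GelfandTriple.exists_functionalBound hC θ (hθ.zero_testPow hS.2.1)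
    fun n hn => (hbound n hn).1
  obtain ⟨σ', A', hA', hFρ⟩ := GelfandTriple.exists_functionalBound hC ρ hρ0
    fun n hn => (hbound n hn).2
  obtain ⟨L, hL⟩ := hFθ.exists_linearMap hβ0 hα.1 hα.2 hA
  obtain ⟨M, hM⟩ := hFρ.exists_linearMap hβ0 hα.1 hα.2 hA'
  have hLb := hFθ.isGrowthBounded hβ0 hα.1 hα.2 hA hL
  have hMb := hFρ.isGrowthBounded hβ0 hα.1 hα.2 hA' hM
  have hML : ∀ f, M (L f) = f := (hMb.comp hLb).eq_id hα.1 fun n ξ w =>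
    GelfandTriple.diffOp_comp_testPow θ ρ hL hM n ξ ((mul_comm _ _).trans (hmul ξ)) w
  have hLM : ∀ f, L (M f) = f := (hLb.comp hMb).eq_id hα.1 fun n ξ w =>
    GelfandTriple.diffOp_comp_testPow ρ θ hM hL n ξ (hmul ξ) w
  exact ⟨{ L with
      invFun := M
      left_inv := hML
      right_inv := hLM
      continuous_toFun := hLb.continuous
      continuous_invFun := hMb.continuous },
    GelfandTriple.map_toFun_eq_shefferOperator (L := L) (hS.map_monomialEmin hα.1 hθ hLb hL)⟩
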